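/- Let $\langle x,y\rangle=-x_0y_0+x_1y_1+x_2y_2$ on $\mathbb L^3$, let $\mathbb H^2=\{p\in\mathbb L^3:\langle p,p\rangle=-1,\ p_0>0\}$, and give $\mathbb H^2\times\mathbb H^2\subset\mathbb L^3\times\mathbb L^3$ the product metric. For a real number $t$ put $\widetilde M_t=\{(p,q)\in\mathbb H^2\times\mathbb H^2:\langle p,q\rangle=-t\}$, and for a smooth immersion of a 3-dimensional hypersurface into $\mathbb H^2\times\mathbb H^2$ with unit normal $\nu$ let $Av=-\widetilde\nabla_v\nu$ be its shape operator and $H=\frac13\operatorname{tr}A$ its mean curvature. Let $t>1$. Then the following hold. 1. $\widetilde M_t$ is a nonempty embedded hypersurface of $\mathbb H^2\times\mathbb H^2$ with smooth unit normal field $N_{(p,q)}=\frac{1}{\sqrt{2(t^2-1)}}(q-tp,\,p-tq)$. It is isoparametric: there is $\delta>0$ such that for $|r|<\delta$ the parallel displacement $\Phi_r(x)=\exp_x(rN_x)$, $x\in\widetilde M_t$, is an immersion with constant mean curvature. 2. The shape operator of $\widetilde M_t$ with respect to $N$ is $$A(v_1,v_2)=\frac{1}{\sqrt{2(t^2-1)}}\Big(t(v_1,v_2)-(v_2,v_1)+(\langle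 v_1,q\rangle p,\langle v_2,p\rangle q)\Big),\qquad (v_1,v_2)\in T_{(p,q)}\widetilde M_t .$$ At each point its eigenvalues (the principal curvatures) are exactly the three distinct numbers $\frac1{\sqrt2}\sqrt{\frac{t+1}{t-1}}$, $\frac1{\sqrt2}\sqrt{\frac{t-1}{t+1}}$ and $0$, the tangent space has dimension $3$, and the mean curvature is $H_t=\frac{\sqrt2\,t}{3\sqrt{t^2-1}}$. 3. For all $r\in\mathbb R$ and $(p,q)\in\widetilde M_t$, $$\Phi_r(p,q)=\Big(\cosh\tfrac r{\sqrt2}\,p+\sinh\tfrac r{\sqrt2}\,\tfrac{q-tp}{\sqrt{t^2-1}},\ \cosh\tfrac r{\sqrt2}\,q+\sinh\tfrac r{\sqrt2}\,\tfrac{p-tq}{\sqrt{t^2-1}}\Big),$$ and $\Phi_r(\widetilde M_t)=\widetilde M_{\phi(r,t)}$, where $\phi(r,t)=t\cosh(\sqrt2\,r)-\sqrt{t^2-1}\,\sinh(\sqrt2\,r)$. 4. Fix $s>1$. A solution of the mean curvature flow (MCF) on $[0,T)$ with initial data $\widetilde M_s$ is a map $F:\widetilde M_s\times[0,T)\to\mathbb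 H^2\times\mathbb H^2$, smooth up to time $0$, with $F(x,0)=x$, every $F(\cdot,\tau)$ an immersion, and $\partial_\tau F=H\nu$ for a smooth unit normal field $\nu(\cdot,\tau)$ along $F(\cdot,\tau)$, where $H(\cdot,\tau)$ is the mean curvature with respect to $\nu(\cdot,\tau)$. Here $\Phi_r$ is taken with respect to $\widetilde M_s$. Consider the initial value problem $$\varepsilon(0)=0,\qquad \varepsilon'(\tau)=H_{\phi(\varepsilon(\tau),s)}=\frac{\sqrt2\,\phi(\varepsilon(\tau),s)}{3\sqrt{\phi(\varepsilon(\tau),s)^2-1}}$$ on $[0,T)$, where a solution is required to satisfy $\phi(\varepsilon(\tau),s)>1$, so that the right-hand side is defined. (a) It has a solution on $[0,T)$ for some $T>0$, and for each $T>0$ it has at most one solution on $[0,T)$. (b) For every $T>0$ and every function $\varepsilon$ on $[0,T)$, the map $(x,\tau)\mapsto\Phi_{\varepsilon(\tau)}(x)$ is a solution of the MCF on $[0,T)$ with initial data $\widetilde M_s$ if and only if $\varepsilon$ solves this problem on $[0,T)$. (c) For every $T>0$, the solutions of the MCF on $[0,T)$ with initial data $\widetilde M_s$ whose second fundamental form is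 bounded on $\widetilde M_s\times[0,T']$ for every $T'<T$ are exactly the maps $F(x,\tau)=\Phi_{\varepsilon(\tau)}(x)$ with $\varepsilon$ a solution of this problem on $[0,T)$. -/

import Mathlib

open Set
open scoped ContDiff

noncomputable section

namespace HHFlow

/-! ### The Riemannian product of two hyperbolic planes inside `L³ × L³` -/

/-- The vector space underlying Lorentz–Minkowski 3-space. Only its topology and linear structure
are used, never its sup norm. -/
abbrev L3 : Type := Fin 3 → ℝ

/-- The vector space underlying `L³ × L³`. -/
abbrev L6 : Type := L3 × L3

/-- The Lorentzian inner product of signature `(-,+,+)` on `L³`. -/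
def lor (x y : L3) : ℝ := -(x 0 * y 0) + x 1 * y 1 + x 2 * y 2

/-- The product inner product on `L³ × L³`; it induces the product metric on `H² × H²`. -/
def ip (v w : L6) : ℝ := lor v.1 w.1 + lor v.2 w.2

/-- The hyperbolic plane: the upper sheet of the hyperboloid `⟨p, p⟩ = -1`. -/
def H2 : Set L3 := {p | lor p p = -1 ∧ 0 < p 0}

/-- The product `H² × H²`. -/
def HH : Set L6 := H2 ×ˢ H2

/-- `v` is tangent to `H² × H²` at `x`. -/
def IsTangentHH (x v : L6) : Prop := lor v.1 x.1 = 0 ∧ lor v.2 x.2 = 0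

/-- Orthogonal projection of `L³ × L³` onto the tangent space of `H² × H²` at `x`. -/
def proj (x v : L6) : L6 := (v.1 + lor v.1 x.1 • x.1, v.2 + lor v.2 x.2 • x.2)

/-- A geodesic of `H² × H²`, defined on the whole line: a smooth curve whose covariant
acceleration (the tangential part of its acceleration in `L³ × L³`) vanishes. -/
def IsGeodesic (γ : ℝ → L6) : Prop :=
  ContDiff ℝ ∞ γ ∧ (∀ s, γ s ∈ HH) ∧ ∀ s, proj (γ s) (deriv (deriv γ) s) = 0

open Classical in
/-- The exponential map of `H² × H²`: the value at time `1` of the geodesic that starts at `x`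
with velocity `v` (and `x` if there is none, that is, if `x` is not in `H² × H²` or `v` is not
tangent at `x`). -/
def expMap (x v : L6) : L6 :=
  if h : ∃ γ : ℝ → L6, IsGeodesic γ ∧ γ 0 = x ∧ deriv γ 0 = v then h.choose 1 else x

/-! ### Hypersurfaces of `H² × H²` -/

/-- `M` is an embedded smooth hypersurface of `H² × H²`: near each of its points it is the zero
set in `H² × H²` of a smooth function whose differential does not vanish on the tangent space of
`H² × H²`. -/
def IsHypersurface (M : Set L6) : Prop :=
  M ⊆ HH ∧ ∀ x ∈ M, ∃ (U : Set L6) (ρ : L6 → ℝ), IsOpen U ∧ x ∈ U ∧ ContDiffOn ℝ ∞ ρ U ∧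
    M ∩ U = {y | y ∈ HH ∧ y ∈ U ∧ ρ y = 0} ∧ ∃ v, IsTangentHH x v ∧ fderiv ℝ ρ x v ≠ 0

/-- The tangent space of an embedded submanifold `M` at `x`. -/
abbrev TM (M : Set L6) (x : L6) : Submodule ℝ L6 := Submodule.span ℝ (tangentConeAt ℝ M x)

/-- The differential at `x` of a map `G` defined on the submanifold `M`, as a linear map on the
tangent space. By `dM_eq` below it does not depend on how `G` is extended off `M`. -/
def dM (M : Set L6) (G : L6 → L6) (x : L6) : TM M x →ₗ[ℝ] L6 :=
  (fderivWithin ℝ G M x).toLinearMap ∘ₗ (TM M x).subtype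

theorem dM_eq {M : Set L6} {G : L6 → L6} {x : L6} {L : L6 →L[ℝ] L6}
    (h : HasFDerivWithinAt G L M x) (v : TM M x) : dM M G x v = L v := by
  have h1 : EqOn (fderivWithin ℝ G M x) L (tangentConeAt ℝ M x) :=
    h.differentiableWithinAt.hasFDerivWithinAt.unique_on h
  exact LinearMap.eqOn_span (f := (fderivWithin ℝ G M x).toLinearMap) (g := L.toLinearMap)
    h1 v.2

/-- `G : M → H² × H²` is a smooth immersion. -/
def IsImmersion (M : Set L6) (G : L6 → L6) : Prop :=
  ContDiffOn ℝ ∞ G M ∧ MapsTo G M HH ∧ ∀ x ∈ M, Function.Injective (dM M G x)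

/-- `ν` is a smooth unit normal vector field along `G : M → H² × H²`. -/
def IsUnitNormal (M : Set L6) (G ν : L6 → L6) : Prop :=
  ContDiffOn ℝ ∞ ν M ∧ ∀ x ∈ M, IsTangentHH (G x) (ν x) ∧ ip (ν x) (ν x) = 1 ∧
    ∀ v : TM M x, ip (dM M G x v) (ν x) = 0

/-- `A` is the shape operator at `x` of `G : M → H² × H²` with respect to the unit normal field
`ν`, that is `dG (A v) = -∇_v ν`. The Levi-Civita derivative `∇_v ν` of `H² × H²` is the
tangential part of the derivative of `ν` in `L³ × L³`. -/
def IsShapeOperator (M : Set L6) (G ν : L6 → L6) (x : L6) (A : Module.End ℝ (TM M x)) : Prop :=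
  ∀ v : TM M x, dM M G x (A v) = -proj (G x) (dM M ν x v)

/-- The mean curvature (normalized: a third of the trace of the shape operator) at `x` of
`G : M → H² × H²` with respect to `ν` exists and equals `h`. -/
def HasMeanCurvature (M : Set L6) (G ν : L6 → L6) (x : L6) (h : ℝ) : Prop :=
  ∃ A : Module.End ℝ (TM M x), IsShapeOperator M G ν x A ∧ h = LinearMap.trace ℝ (TM M x) A / 3

/-- Parallel displacement at (signed) distance `r` in the direction of the normal field `N`. -/
def parallel (N : L6 → L6) (r : ℝ) (x : L6) : L6 := expMap x (r • N x)

/-- The hypersurface `M` with unit normal field `N` is isoparametric: all nearby parallel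
hypersurfaces (on both sides) have constant mean curvature. -/
def IsIsoparametric (M : Set L6) (N : L6 → L6) : Prop :=
  IsHypersurface M ∧ IsUnitNormal M id N ∧
    ∃ δ > 0, ∀ r : ℝ, |r| < δ → IsImmersion M (parallel N r) ∧
      ∃ ν, IsUnitNormal M (parallel N r) ν ∧
        ∃ h : ℝ, ∀ x ∈ M, HasMeanCurvature M (parallel N r) ν x h

/-! ### Mean curvature flow -/

/-- `F : M × [0, T) → H² × H²` is a smooth solution of the mean curvature flow
`∂_τ F = H ν` with initial data `M`. -/
def IsMCF (M : Set L6) (T : ℝ) (F : L6 → ℝ → L6) : Prop :=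
  ContDiffOn ℝ ∞ (fun z : L6 × ℝ => F z.1 z.2) (M ×ˢ Ico 0 T) ∧
  (∀ x ∈ M, F x 0 = x) ∧
  (∀ τ ∈ Ico 0 T, IsImmersion M (fun x => F x τ)) ∧
  ∃ (ν : L6 → ℝ → L6) (H : L6 → ℝ → ℝ),
    ContDiffOn ℝ ∞ (fun z : L6 × ℝ => ν z.1 z.2) (M ×ˢ Ico 0 T) ∧
    ∀ τ ∈ Ico 0 T, IsUnitNormal M (fun x => F x τ) (fun x => ν x τ) ∧
      ∀ x ∈ M, HasMeanCurvature M (fun y => F y τ) (fun y => ν y τ) x (H x τ) ∧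
        HasDerivWithinAt (fun σ => F x σ) (H x τ • ν x τ) (Ico 0 T) τ

/-- The second fundamental form of the flow `F` is bounded on `M × [0, T']` for every `T' < T`.
The squared norm `|A|²` is the trace of `A²`; it does not depend on the choice of the normal. -/
def HasBoundedSecondForm (M : Set L6) (T : ℝ) (F : L6 → ℝ → L6) : Prop :=
  ∀ T' < T, ∃ C : ℝ, ∀ τ ∈ Icc 0 T', ∀ ν, IsUnitNormal M (fun x => F x τ) ν →
    ∀ x ∈ M, ∀ A, IsShapeOperator M (fun y => F y τ) ν x A →
      LinearMap.trace ℝ (TM M x) (A * A) ≤ C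

/-! ### The family of hypersurfaces -/

/-- The set `{(p, q) ∈ H² × H² : ⟨p, q⟩ = -t}`. -/
def Mt (t : ℝ) : Set L6 := {x | x ∈ HH ∧ lor x.1 x.2 = -t}

/-- The normal field `(q - t p, p - t q) / √(2 (t² - 1))` of `Mt t`. -/
def Nt (t : ℝ) (x : L6) : L6 :=
  (Real.sqrt (2 * (t ^ 2 - 1)))⁻¹ • (x.2 - t • x.1, x.1 - t • x.2)

/-- `φ(r, t) = t cosh(√2 r) - √(t² - 1) sinh(√2 r)`. -/
def phi (r t : ℝ) : ℝ :=
  t * Real.cosh (Real.sqrt 2 * r) - Real.sqrt (t ^ 2 - 1) * Real.sinh (Real.sqrt 2 * r)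

/-- `ε` solves on `[0, T)` the initial value problem `ε(0) = 0`,
`ε' = √2 φ(ε, s) / (3 √(φ(ε, s)² - 1))`, staying where the right-hand side is defined. -/
def SolvesODE (s T : ℝ) (ε : ℝ → ℝ) : Prop :=
  ε 0 = 0 ∧ ∀ τ ∈ Ico 0 T, 1 < phi (ε τ) s ∧
    HasDerivWithinAt ε
      (Real.sqrt 2 * phi (ε τ) s / (3 * Real.sqrt (phi (ε τ) s ^ 2 - 1))) (Ico 0 T) τ

end HHFlow

end

noncomputable section

namespace HHFlow

/-! ### Algebra of the Lorentzian inner product -/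

/-! A point of `Mt t` is a pair at hyperbolic distance `arcosh t`. Write it as `pairOf a m w`:
midpoint `m`, unit tangent `w` at `m`, half distance `a = arcosh t / 2`. The normal geodesic fixes
`m` and `w` and changes `a` to `a - r / √2`, so parallel displacement is the restriction of a linear
map (`parMap`, `parMap_pairOf`) and carries `Mt t` onto `Mt (cosh (arcosh t - √2 r))`. The shape
operator is read off in a frame built from the Lorentzian cross product (`shapeMt_principalBasis`).

`Mt t` is not open in the ambient space, so derivatives of maps on it are meaningful only along its
tangent cone. Calculus is moved to a vector space by `orbitMap`, which exponentiates infinitesimal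
isometries: it takes values in `Mt t`, and its differential at `0` is the identity on the tangent
space.

For parallel flows the mean curvature flow reduces to the equation for `ε`. Along it `u = -⟨p, q⟩`
satisfies `u' = -(2/3) u`, which gives the explicit solutions `uSol` and `epsSol`. Conversely `ε`
can be recovered from the position of a single point, so a parallel flow yields a differentiable
solution.

The hard part is that every flow with locally bounded second fundamental form is parallel. Along a
flow, `3 ∂u = Δu - 3u - 2⟨ν₁, ν₂⟩`, and always `2⟨ν₁, ν₂⟩ ≥ -u`; hence `u ≤ uSol` by a maximum
principle (`IsBoundedFlow.le_uSol`). For the reverse bound the inequality points the wrong way, but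
equality holds when `ν` is parallel to the gradient of `u`, and this is nearly so at an extremum of
a slightly penalized `u` (`normal_pinching`). The error is proportional to the penalty and is
absorbed by an exponential weight (`IsBoundedFlow.uSol_le_of_slab`), as long as `u` stays away from
`1`. Since the hypersurface is noncompact, the penalty is a multiple of `p₀ + q₀`, which remains
proper because bounded mean curvature changes it by bounded factors.

Thus the flow lies in `Mt (uSol s τ)`. Its mean curvature vector is then the known normal field, and
its trajectories solve the same ordinary differential equation as the parallel ones. If `uSol`
reached `1`, the image would lie in the two-dimensional diagonal, which no immersion of a
hypersurface allows. -/

theorem lor_comm (x y : L3) : lor x y = lor y x := by simp only [lor]; ring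

@[simp] theorem lor_add_left (x y z : L3) : lor (x + y) z = lor x z + lor y z := by
  simp only [lor, Pi.add_apply]; ring

@[simp] theorem lor_add_right (x y z : L3) : lor x (y + z) = lor x y + lor x z := by
  simp only [lor, Pi.add_apply]; ring

@[simp] theorem lor_smul_left (c : ℝ) (x z : L3) : lor (c • x) z = c * lor x z := by
  simp only [lor, Pi.smul_apply, smul_eq_mul]; ring

@[simp] theorem lor_smul_right (c : ℝ) (x z : L3) : lor x (c • z) = c * lor x z := by
  simp only [lor, Pi.smul_apply, smul_eq_mul]; ring

@[simp] theorem lor_neg_left (x z : L3) : lor (-x) z = -lor x z := by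
  simp only [lor, Pi.neg_apply]; ring

@[simp] theorem lor_neg_right (x z : L3) : lor x (-z) = -lor x z := by
  simp only [lor, Pi.neg_apply]; ring

@[simp] theorem lor_sub_left (x y z : L3) : lor (x - y) z = lor x z - lor y z := by
  simp only [lor, Pi.sub_apply]; ring

@[simp] theorem lor_sub_right (x y z : L3) : lor x (y - z) = lor x y - lor x z := by
  simp only [lor, Pi.sub_apply]; ring

@[simp] theorem lor_zero_left (z : L3) : lor 0 z = 0 := by simp [lor]

@[simp] theorem lor_zero_right (z : L3) : lor z 0 = 0 := by simp [lor]

/-- The Lorentzian inner product as a continuous bilinear map. -/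
def lorL : L3 →L[ℝ] L3 →L[ℝ] ℝ :=
  LinearMap.toContinuousLinearMap
    { toFun := fun x => LinearMap.toContinuousLinearMap
        { toFun := fun y => lor x y
          map_add' := lor_add_right x
          map_smul' := fun c y => lor_smul_right c x y }
      map_add' := fun x y => by ext z; simp
      map_smul' := fun c x => by ext z; simp }

theorem _root_.HasDerivWithinAt.lor {f g : ℝ → L3} {f' g' : L3} {s : Set ℝ} {a : ℝ}
    (hf : HasDerivWithinAt f f' s a) (hg : HasDerivWithinAt g g' s a) :
    HasDerivWithinAt (fun σ => lor (f σ) (g σ)) (lor f' (g a) + lor (f a) g') s a := by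
  have := (lorL.isBoundedBilinearMap.hasFDerivAt (f a, g a)).comp_hasDerivWithinAt a (hf.prodMk hg)
  exact this.congr_deriv (add_comm _ _)

theorem _root_.HasDerivAt.lor {f g : ℝ → L3} {f' g' : L3} {a : ℝ}
    (hf : HasDerivAt f f' a) (hg : HasDerivAt g g' a) :
    HasDerivAt (fun σ => lor (f σ) (g σ)) (lor f' (g a) + lor (f a) g') a := by
  rw [← hasDerivWithinAt_univ] at *
  exact hf.lor hg

theorem _root_.HasDerivWithinAt.fst_L6 {f : ℝ → L6} {f' : L6} {s : Set ℝ} {a : ℝ}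
    (h : HasDerivWithinAt f f' s a) : HasDerivWithinAt (fun σ => (f σ).1) f'.1 s a := h.fst

theorem _root_.HasDerivWithinAt.snd_L6 {f : ℝ → L6} {f' : L6} {s : Set ℝ} {a : ℝ}
    (h : HasDerivWithinAt f f' s a) : HasDerivWithinAt (fun σ => (f σ).2) f'.2 s a := h.snd

theorem _root_.HasDerivAt.fst_L6 {f : ℝ → L6} {f' : L6} {a : ℝ}
    (h : HasDerivAt f f' a) : HasDerivAt (fun σ => (f σ).1) f'.1 a := h.fst

theorem _root_.HasDerivAt.snd_L6 {f : ℝ → L6} {f' : L6} {a : ℝ}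
    (h : HasDerivAt f f' a) : HasDerivAt (fun σ => (f σ).2) f'.2 a := h.snd

theorem contDiff_lor {n : ℕ∞ω} : ContDiff ℝ n (fun z : L6 => lor z.1 z.2) :=
  lorL.isBoundedBilinearMap.contDiff

theorem hasFDerivAt_lor (z : L6) : HasFDerivAt (fun z : L6 => lor z.1 z.2)
    ((lorL z.1).comp (ContinuousLinearMap.snd ℝ L3 L3) +
      (lorL z.2).comp (ContinuousLinearMap.fst ℝ L3 L3)) z := by
  refine (lorL.isBoundedBilinearMap.hasFDerivAt z).congr_fderiv (ContinuousLinearMap.ext fun v => ?_)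
  change lor z.1 v.2 + lor v.1 z.2 = lor z.1 v.2 + lor z.2 v.1
  rw [lor_comm v.1]

@[simp] theorem ip_add_left (x y z : L6) : ip (x + y) z = ip x z + ip y z := by
  simp only [ip, Prod.fst_add, Prod.snd_add, lor_add_left]; ring

@[simp] theorem ip_smul_left (c : ℝ) (x z : L6) : ip (c • x) z = c * ip x z := by
  simp only [ip, Prod.smul_fst, Prod.smul_snd, lor_smul_left]; ring

theorem ip_comm (x y : L6) : ip x y = ip y x := by simp only [ip, lor_comm]

@[simp] theorem ip_add_right (x y z : L6) : ip x (y + z) = ip x y + ip x z := by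
  rw [ip_comm, ip_add_left, ip_comm y, ip_comm z]

@[simp] theorem ip_smul_right (c : ℝ) (x z : L6) : ip x (c • z) = c * ip x z := by
  rw [ip_comm, ip_smul_left, ip_comm z]

@[simp] theorem ip_neg_left (x z : L6) : ip (-x) z = -ip x z := by
  simpa using ip_smul_left (-1) x z

@[simp] theorem ip_neg_right (x z : L6) : ip x (-z) = -ip x z := by
  simpa using ip_smul_right (-1) x z

@[simp] theorem ip_sub_left (x y z : L6) : ip (x - y) z = ip x z - ip y z := by
  simp [sub_eq_add_neg]

@[simp] theorem ip_sub_right (x y z : L6) : ip x (y - z) = ip x y - ip x z := by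
  simp [sub_eq_add_neg]

/-- The product inner product as a continuous bilinear map. -/
def ipL : L6 →L[ℝ] L6 →L[ℝ] ℝ :=
  LinearMap.toContinuousLinearMap
    { toFun := fun x => LinearMap.toContinuousLinearMap
        { toFun := fun y => ip x y
          map_add' := ip_add_right x
          map_smul' := fun c y => ip_smul_right c x y }
      map_add' := fun x y => by ext z <;> simp
      map_smul' := fun c x => by ext z <;> simp }

@[simp] theorem ipL_apply (x y : L6) : ipL x y = ip x y := rfl

theorem _root_.HasDerivAt.ip {f g : ℝ → L6} {f' g' : L6} {a : ℝ}
    (hf : HasDerivAt f f' a) (hg : HasDerivAt g g' a) :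
    HasDerivAt (fun σ => ip (f σ) (g σ)) (ip f' (g a) + ip (f a) g') a := by
  have := (ipL.isBoundedBilinearMap.hasFDerivAt (f a, g a)).comp_hasDerivAt a (hf.prodMk hg)
  exact this.congr_deriv (add_comm _ _)

/-! ### Inequalities on tangent planes of the hyperbolic plane -/

theorem one_le_of_mem_H2 {p : L3} (hp : p ∈ H2) : 1 ≤ p 0 := by
  obtain ⟨h1, h2⟩ := hp
  simp only [lor] at h1
  nlinarith [sq_nonneg (p 1), sq_nonneg (p 2)]

/-- Orthogonality makes `x₀ p₀` the Euclidean product of the spatial parts, and Cauchy–Schwarz with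
`p₁² + p₂² = p₀² - 1` concludes. This is positive definiteness of the tangent planes in quantitative
form. -/
theorem lor_self_lower {p x : L3} (hp : p ∈ H2) (hx : lor x p = 0) :
    x 1 ^ 2 + x 2 ^ 2 ≤ lor x x * p 0 ^ 2 := by
  obtain ⟨h1, h2⟩ := hp
  simp only [lor] at h1 hx ⊢
  have h3 : x 0 * p 0 = x 1 * p 1 + x 2 * p 2 := by linarith
  have h4 : (x 0 * p 0) ^ 2 ≤ (x 1 ^ 2 + x 2 ^ 2) * (p 1 ^ 2 + p 2 ^ 2) := by
    rw [h3]; nlinarith [sq_nonneg (x 1 * p 2 - x 2 * p 1)]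
  have h5 : p 1 ^ 2 + p 2 ^ 2 = p 0 ^ 2 - 1 := by linarith
  rw [h5] at h4
  nlinarith

theorem lor_self_nonneg {p x : L3} (hp : p ∈ H2) (hx : lor x p = 0) : 0 ≤ lor x x := by
  have h1 := lor_self_lower hp hx
  have h2 : 0 < p 0 ^ 2 := pow_pos hp.2 2
  by_contra! h
  nlinarith [sq_nonneg (x 1), sq_nonneg (x 2)]

theorem eq_zero_of_lor_self {p x : L3} (hp : p ∈ H2) (hx : lor x p = 0) (h : lor x x = 0) :
    x = 0 := by
  have h1 := lor_self_lower hp hx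
  rw [h, zero_mul] at h1
  have h2 : x 1 = 0 := by nlinarith [sq_nonneg (x 1), sq_nonneg (x 2)]
  have h3 : x 2 = 0 := by nlinarith [sq_nonneg (x 1), sq_nonneg (x 2)]
  have h4 : x 0 = 0 := by
    simp only [lor, h2, h3] at h
    nlinarith
  ext i
  fin_cases i <;> simp [h2, h3, h4]

theorem lor_sq_le {p x y : L3} (hp : p ∈ H2) (hx : lor x p = 0) (hy : lor y p = 0) :
    lor x y ^ 2 ≤ lor x x * lor y y := by
  have h : ∀ c : ℝ, 0 ≤ lor y y * (c * c) + 2 * lor x y * c + lor x x := fun c => by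
    have := lor_self_nonneg hp (x := x + c • y) (by simp [hx, hy])
    simp only [lor_add_left, lor_add_right, lor_smul_left, lor_smul_right, lor_comm y x] at this
    linarith
  have := discrim_le_zero h
  simp only [discrim] at this
  nlinarith

/-- Only the tangential part `a + ⟨a, p⟩ p` pairs with `x`, and its square norm is `⟨a, a⟩ + ⟨a,
p⟩²`. -/
theorem lor_sq_le_of_tangent {p x : L3} (hp : p ∈ H2) (hx : lor x p = 0) (a : L3) :
    lor x a ^ 2 ≤ lor x x * (lor a a + lor a p ^ 2) := by
  have h := lor_sq_le hp hx (y := a + lor a p • p) (by simp [hp.1])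
  simp only [lor_add_left, lor_add_right, lor_smul_left, lor_smul_right, hx, hp.1,
    lor_comm p a] at h
  nlinarith

/-- Projecting `y` to the plane at `p` costs `⟨y, p⟩²`, and projecting `p` to the plane at `q`
bounds that cost by `⟨y, y⟩ (⟨p, q⟩² - 1)`. -/
theorem lor_sq_le_mul {p q x y : L3} (hp : p ∈ H2) (hq : q ∈ H2) (hx : lor x p = 0)
    (hy : lor y q = 0) : lor x y ^ 2 ≤ lor x x * lor y y * lor p q ^ 2 := by
  have h1 := lor_sq_le_of_tangent hp hx y
  have h2 := lor_sq_le_of_tangent hq hy p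
  rw [hp.1] at h2
  have h3 := lor_self_nonneg hp hx
  nlinarith

theorem one_le_neg_lor {p q : L3} (hp : p ∈ H2) (hq : q ∈ H2) : 1 ≤ -lor p q := by
  have h1 := one_le_of_mem_H2 hp
  have h2 := one_le_of_mem_H2 hq
  have h3 := hp.1
  have h4 := hq.1
  simp only [lor] at *
  have h5 : (p 1 * q 1 + p 2 * q 2) ^ 2 ≤ (p 0 * q 0 - 1) ^ 2 := by
    nlinarith [sq_nonneg (p 1 * q 2 - p 2 * q 1), sq_nonneg (p 0 - q 0)]
  have h6 : 0 ≤ p 0 * q 0 - 1 := by nlinarith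
  have := abs_le_of_sq_le_sq' h5 h6
  linarith [this.2]

theorem eq_of_lor_eq_neg_one {p q : L3} (hp : p ∈ H2) (hq : q ∈ H2) (h : lor p q = -1) :
    p = q := by
  have := eq_zero_of_lor_self hp (x := q - p) (by simp [hp.1, lor_comm q p, h])
    (by simp [hp.1, hq.1, lor_comm q p, h])
  exact (sub_eq_zero.1 this).symm

theorem apply_zero_sq_le {p x : L3} (hp : p ∈ H2) (hx : lor x p = 0) :
    x 0 ^ 2 ≤ lor x x * (p 0 ^ 2 - 1) := by
  have := lor_sq_le_of_tangent hp hx ![1, 0, 0]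
  simp only [lor, Matrix.cons_val_zero, Matrix.cons_val_one, Matrix.cons_val] at this ⊢
  nlinarith

theorem lor_sq_le_of_mem {p q x : L3} (hp : p ∈ H2) (hq : q ∈ H2) (hx : lor x p = 0) :
    lor x q ^ 2 ≤ lor x x * (lor p q ^ 2 - 1) := by
  have := lor_sq_le_of_tangent hp hx q
  rw [hq.1, lor_comm q p] at this
  linarith

theorem ip_self_nonneg {x v : L6} (hx : x ∈ HH) (hv : IsTangentHH x v) : 0 ≤ ip v v :=
  add_nonneg (lor_self_nonneg hx.1 hv.1) (lor_self_nonneg hx.2 hv.2)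

theorem eq_zero_of_ip_self {x v : L6} (hx : x ∈ HH) (hv : IsTangentHH x v) (h : ip v v = 0) :
    v = 0 := by
  have h1 := lor_self_nonneg hx.1 hv.1
  have h2 := lor_self_nonneg hx.2 hv.2
  simp only [ip] at h
  exact Prod.ext (eq_zero_of_lor_self hx.1 hv.1 (by linarith))
    (eq_zero_of_lor_self hx.2 hv.2 (by linarith))

theorem ip_proj {x v w : L6} (hv : IsTangentHH x v) : ip v (proj x w) = ip v w := by
  simp [ip, proj, hv.1, hv.2]

theorem IsTangentHH.add {x v w : L6} (hv : IsTangentHH x v) (hw : IsTangentHH x w) :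
    IsTangentHH x (v + w) := by
  constructor <;> simp [hv.1, hv.2, hw.1, hw.2]

theorem IsTangentHH.smul {x v : L6} (c : ℝ) (hv : IsTangentHH x v) : IsTangentHH x (c • v) := by
  constructor <;> simp [hv.1, hv.2]

theorem IsTangentHH.sub {x v w : L6} (hv : IsTangentHH x v) (hw : IsTangentHH x w) :
    IsTangentHH x (v - w) := by
  constructor <;> simp [hv.1, hv.2, hw.1, hw.2]

theorem ip_sq_le {x v w : L6} (hx : x ∈ HH) (hv : IsTangentHH x v) (hw : IsTangentHH x w) :
    ip v w ^ 2 ≤ ip v v * ip w w := by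
  have h : ∀ c : ℝ, 0 ≤ ip w w * (c * c) + 2 * ip v w * c + ip v v := fun c => by
    have := ip_self_nonneg hx (hv.add (hw.smul c))
    simp only [ip_add_left, ip_add_right, ip_smul_left, ip_smul_right, ip_comm w v] at this
    linarith
  have := discrim_le_zero h
  simp only [discrim] at this
  nlinarith

/-! ### A global smooth parametrization of `Mt t` by an orbit of the isometry group -/

/-- The infinitesimal Lorentz transformation `a ∧ b`. -/
def wedge (a b : L3) : L3 →L[ℝ] L3 := (lorL b).smulRight a - (lorL a).smulRight b

@[simp] theorem wedge_apply (a b x : L3) : wedge a b x = lor b x • a - lor a x • b := rfl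

/-- For `v` tangent to `Mt t` at `x`, the infinitesimal isometry that moves `x` with velocity
`v`. -/
def isometryGen (t : ℝ) (x : L6) : L6 →L[ℝ] (L3 →L[ℝ] L3) :=
  LinearMap.toContinuousLinearMap
    { toFun := fun v => (t ^ 2 - 1)⁻¹ • wedge v.1 (x.1 - t • x.2) +
        (t ^ 2 - 1)⁻¹ • wedge v.2 (x.2 - t • x.1) -
        lor v.2 x.1 • ((t ^ 2 - 1)⁻¹ ^ 2 • wedge (x.1 - t • x.2) (x.2 - t • x.1))
      map_add' := fun v w => by
        ext a i
        simp
        ring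
      map_smul' := fun c v => by
        ext a i
        simp
        ring }

theorem isometryGen_apply (t : ℝ) (x v : L6) (a : L3) : isometryGen t x v a =
    (t ^ 2 - 1)⁻¹ • wedge v.1 (x.1 - t • x.2) a + (t ^ 2 - 1)⁻¹ • wedge v.2 (x.2 - t • x.1) a -
        lor v.2 x.1 • ((t ^ 2 - 1)⁻¹ ^ 2 • wedge (x.1 - t • x.2) (x.2 - t • x.1) a) := rfl

theorem isometryGen_skew (t : ℝ) (x v : L6) (a b : L3) :
    lor (isometryGen t x v a) b + lor a (isometryGen t x v b) = 0 := by
  have h : ∀ c d : L3, lor (wedge c d a) b + lor a (wedge c d b) = 0 := fun c d => by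
    simp only [wedge_apply, lor_sub_left, lor_sub_right, lor_smul_left, lor_smul_right,
      lor_comm a c, lor_comm a d]
    ring
  have h1 := h v.1 (x.1 - t • x.2)
  have h2 := h v.2 (x.2 - t • x.1)
  have h3 := h (x.1 - t • x.2) (x.2 - t • x.1)
  rw [isometryGen_apply, isometryGen_apply]
  simp only [lor_sub_left, lor_sub_right, lor_smul_left, lor_smul_right, lor_add_left,
    lor_add_right] at *
  linear_combination (t ^ 2 - 1)⁻¹ * h1 + (t ^ 2 - 1)⁻¹ * h2 -
    lor v.2 x.1 * (t ^ 2 - 1)⁻¹ ^ 2 * h3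

/-- The tangent space of `Mt t` at `x`, by its equations. -/
def tanSpace (x : L6) : Submodule ℝ L6 where
  carrier := {v | IsTangentHH x v ∧ lor v.1 x.2 + lor x.1 v.2 = 0}
  add_mem' := fun {v w} hv hw => ⟨hv.1.add hw.1, by
    have h1 := hv.2
    have h2 := hw.2
    simp only [Prod.fst_add, Prod.snd_add, lor_add_left, lor_add_right] at *
    linarith⟩
  zero_mem' := by simp [IsTangentHH]
  smul_mem' := fun c v hv => ⟨hv.1.smul c, by
    have h1 := hv.2
    simp only [Prod.smul_fst, Prod.smul_snd, lor_smul_left, lor_smul_right]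
    linear_combination c * h1⟩

/-- The vectors `(p - t q) / (t² - 1)` and `(q - t p) / (t² - 1)` form the basis of the plane of `p`
and `q` dual to `(p, q)`. The first two wedges therefore send `p` to `v₁` and `q` to `v₂` up to
cross terms. The third wedge removes these; it can remove both because tangency gives `⟨v₁, q⟩ =
-⟨v₂, p⟩`. -/
theorem isometryGen_of_mem {t : ℝ} (ht : 1 < t) {x v : L6} (hx : x ∈ Mt t) (hv : v ∈ tanSpace x) :
    isometryGen t x v x.1 = v.1 ∧ isometryGen t x v x.2 = v.2 := by
  obtain ⟨⟨hp, hq⟩, hpq⟩ := hx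
  obtain ⟨⟨h1, h2⟩, h3⟩ := hv
  have ht' : t ^ 2 - 1 ≠ 0 := by nlinarith
  have hqp : lor x.2 x.1 = -t := by rw [lor_comm, hpq]
  have h4 : lor v.1 x.2 = -lor v.2 x.1 := by rw [lor_comm v.2]; linarith
  constructor <;>
  · rw [isometryGen_apply]
    simp only [wedge_apply, lor_sub_left, lor_smul_left, hp.1, hq.1, hpq, hqp, h1, h2, h4]
    ext i
    simp only [Pi.add_apply, Pi.sub_apply, Pi.smul_apply, smul_eq_mul]
    field_simp
    ring

open NormedSpace in
theorem lor_exp_apply {B : L3 →L[ℝ] L3} (hB : ∀ a b, lor (B a) b + lor a (B b) = 0) (a b : L3)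
    (σ : ℝ) : lor (exp (σ • B) a) (exp (σ • B) b) = lor a b := by
  have hd : ∀ (c : L3) (σ : ℝ), HasDerivAt (fun σ : ℝ => exp (σ • B) c) (B (exp (σ • B) c)) σ :=
    fun c σ => (hasDerivAt_exp_smul_const' B σ).clm_apply (hasDerivAt_const σ c) |>.congr_deriv
      (by simp)
  have h0 : ∀ σ, HasDerivAt (fun σ : ℝ => lor (exp (σ • B) a) (exp (σ • B) b)) 0 σ := fun σ =>
    ((hd a σ).lor (hd b σ)).congr_deriv (hB _ _)
  have := is_const_of_deriv_eq_zero (fun σ => (h0 σ).differentiableAt) (fun σ => (h0 σ).deriv) σ 0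
  simpa using this

open NormedSpace in
-- The path `exp (σ B) p` stays on the two-sheeted hyperboloid, where the zeroth coordinate never
-- vanishes, so by continuity it cannot change sheet.
theorem exp_apply_mem_H2 {B : L3 →L[ℝ] L3} (hB : ∀ a b, lor (B a) b + lor a (B b) = 0) {p : L3}
    (hp : p ∈ H2) : exp B p ∈ H2 := by
  have h1 : ∀ σ : ℝ, lor (exp (σ • B) p) (exp (σ • B) p) = -1 := fun σ => by
    rw [lor_exp_apply hB, hp.1]
  have hc : Continuous fun σ : ℝ => (exp (σ • B) p : L3) 0 :=
    (continuous_apply 0).comp <| continuous_iff_continuousAt.2 fun σ =>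
      ((hasDerivAt_exp_smul_const' B σ).clm_apply (hasDerivAt_const σ p)).continuousAt
  have hne : ∀ σ : ℝ, (exp (σ • B) p : L3) 0 ≠ 0 := fun σ h => by
    have := h1 σ
    simp only [lor, h] at this
    nlinarith [sq_nonneg ((exp (σ • B) p : L3) 1), sq_nonneg ((exp (σ • B) p : L3) 2)]
  refine ⟨by simpa using h1 1, ?_⟩
  by_contra! hle
  obtain ⟨σ, -, hσ⟩ := intermediate_value_Icc' (zero_le_one (α := ℝ)) hc.continuousOn
    (show (0 : ℝ) ∈ Icc _ _ from ⟨by simpa using hle, by simpa using hp.2.le⟩)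
  exact hne σ hσ

/-- A smooth map from `L³ × L³` into `Mt t` that sends `0` to `x` and whose differential at `0`
is the identity on the tangent space of `Mt t`. -/
def orbitMap (t : ℝ) (x v : L6) : L6 :=
  (NormedSpace.exp (isometryGen t x v) x.1, NormedSpace.exp (isometryGen t x v) x.2)

@[simp] theorem orbitMap_zero (t : ℝ) (x : L6) : orbitMap t x 0 = x := by
  simp [orbitMap]

theorem orbitMap_mem {t : ℝ} {x : L6} (hx : x ∈ Mt t) (v : L6) : orbitMap t x v ∈ Mt t := by
  refine ⟨⟨exp_apply_mem_H2 (isometryGen_skew t x v) hx.1.1,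
    exp_apply_mem_H2 (isometryGen_skew t x v) hx.1.2⟩, ?_⟩
  have := lor_exp_apply (isometryGen_skew t x v) x.1 x.2 1
  rw [one_smul] at this
  exact this.trans hx.2

theorem contDiff_orbitMap (t : ℝ) (x : L6) : ContDiff ℝ ∞ (orbitMap t x) := by
  have h : ContDiff ℝ ∞ (NormedSpace.exp : (L3 →L[ℝ] L3) → L3 →L[ℝ] L3) :=
    contDiff_iff_contDiffAt.2 fun B => (NormedSpace.exp_analytic B).contDiffAt
  have h2 := h.comp (isometryGen t x).contDiff
  exact (h2.clm_apply contDiff_const).prodMk (h2.clm_apply contDiff_const)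

theorem hasFDerivAt_orbitMap_zero (t : ℝ) (x : L6) :
    HasFDerivAt (orbitMap t x) (((isometryGen t x).flip x.1).prod ((isometryGen t x).flip x.2))
      0 := by
  have h : HasFDerivAt (fun v => NormedSpace.exp (isometryGen t x v)) (isometryGen t x) 0 := by
    have h1 : HasFDerivAt (NormedSpace.exp : (L3 →L[ℝ] L3) → L3 →L[ℝ] L3)
        (1 : (L3 →L[ℝ] L3) →L[ℝ] (L3 →L[ℝ] L3)) (isometryGen t x 0) := by
      rw [map_zero]
      exact hasFDerivAt_exp_zero
    exact h1.comp 0 (isometryGen t x).hasFDerivAt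
  have h2 : ∀ a : L3, HasFDerivAt (fun v => NormedSpace.exp (isometryGen t x v) a)
      ((isometryGen t x).flip a) 0 := fun a =>
    (h.clm_apply (hasFDerivAt_const a 0)).congr_fderiv
      (by rw [ContinuousLinearMap.comp_zero, zero_add])
  exact (h2 x.1).prodMk (h2 x.2)

theorem fderiv_orbitMap_zero {t : ℝ} (ht : 1 < t) {x v : L6} (hx : x ∈ Mt t)
    (hv : v ∈ tanSpace x) : fderiv ℝ (orbitMap t x) 0 v = v := by
  rw [(hasFDerivAt_orbitMap_zero t x).fderiv]
  obtain ⟨h1, h2⟩ := isometryGen_of_mem ht hx hv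
  exact Prod.ext h1 h2

/-! ### Tangent cones and the tangent space of `Mt t` -/

theorem fderiv_mem_tangentCone {M : Set L6} {E : Type*} [NormedAddCommGroup E] [NormedSpace ℝ E]
    {f : E → L6} {y : E} (hf : DifferentiableAt ℝ f y) (hm : ∀ z, f z ∈ M) (v : E) :
    fderiv ℝ f y v ∈ tangentConeAt ℝ M (f y) := by
  have h := hf.hasFDerivAt.hasFDerivWithinAt (s := univ) |>.mapsTo_tangent_cone
  exact tangentConeAt_mono (by rintro _ ⟨z, -, rfl⟩; exact hm z)
    (h (by rw [tangentConeAt_univ]; trivial))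

/-- Within `M` the function has both `f'` and `0` as derivatives, and derivatives within a set are
unique on its tangent cone. -/
theorem eq_zero_of_mem_tangentCone {M : Set L6} {f : L6 → ℝ} {f' : L6 →L[ℝ] ℝ} {x v : L6} {c : ℝ}
    (hf : HasFDerivAt f f' x) (hc : ∀ y ∈ M, f y = c) (hx : x ∈ M)
    (hv : v ∈ tangentConeAt ℝ M x) : f' v = 0 := by
  have h0 : HasFDerivWithinAt f (0 : L6 →L[ℝ] ℝ) M x :=
    (hasFDerivWithinAt_const c x M).congr hc (hc x hx)
  exact hf.hasFDerivWithinAt.unique_on h0 hv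

theorem hasFDerivAt_lor_fst (x : L6) : HasFDerivAt (fun z : L6 => lor z.1 z.1)
    ((2 : ℝ) • (lorL x.1).comp (ContinuousLinearMap.fst ℝ L3 L3)) x := by
  refine (HasFDerivAt.comp (f := fun z : L6 => ((z.1, z.1) : L6)) x (hasFDerivAt_lor _)
    (hasFDerivAt_fst.prodMk hasFDerivAt_fst)).congr_fderiv (ContinuousLinearMap.ext fun v => ?_)
  change lor x.1 v.1 + lor x.1 v.1 = 2 * lor x.1 v.1
  ring

theorem hasFDerivAt_lor_snd (x : L6) : HasFDerivAt (fun z : L6 => lor z.2 z.2)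
    ((2 : ℝ) • (lorL x.2).comp (ContinuousLinearMap.snd ℝ L3 L3)) x := by
  refine (HasFDerivAt.comp (f := fun z : L6 => ((z.2, z.2) : L6)) x (hasFDerivAt_lor _)
    (hasFDerivAt_snd.prodMk hasFDerivAt_snd)).congr_fderiv (ContinuousLinearMap.ext fun v => ?_)
  change lor x.2 v.2 + lor x.2 v.2 = 2 * lor x.2 v.2
  ring

theorem isTangentHH_of_mem_tangentCone {M : Set L6} (hM : M ⊆ HH) {x v : L6} (hx : x ∈ M)
    (hv : v ∈ tangentConeAt ℝ M x) : IsTangentHH x v := by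
  have h1 : 2 * lor x.1 v.1 = 0 :=
    eq_zero_of_mem_tangentCone (hasFDerivAt_lor_fst x) (fun y hy => (hM hy).1.1) hx hv
  have h2 : 2 * lor x.2 v.2 = 0 :=
    eq_zero_of_mem_tangentCone (hasFDerivAt_lor_snd x) (fun y hy => (hM hy).2.1) hx hv
  constructor <;> rw [lor_comm] <;> linarith

/-- The defining equations of `Mt t` bound the tangent cone from above; the curves supplied by
`orbitMap` realize every vector that satisfies the linearized equations. -/
theorem TM_Mt {t : ℝ} (ht : 1 < t) {x : L6} (hx : x ∈ Mt t) : TM (Mt t) x = tanSpace x := by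
  refine le_antisymm (Submodule.span_le.2 fun v hv => ⟨?_, ?_⟩) fun v hv => ?_
  · exact isTangentHH_of_mem_tangentCone (fun y hy => hy.1) hx hv
  · have : lor x.1 v.2 + lor x.2 v.1 = 0 :=
      eq_zero_of_mem_tangentCone (hasFDerivAt_lor x) (fun y hy => hy.2) hx hv
    rw [lor_comm v.1, add_comm]
    exact this
  · have h := fderiv_mem_tangentCone (M := Mt t) (y := 0)
      ((contDiff_orbitMap t x).differentiable (by simp) 0) (orbitMap_mem hx) v
    rw [fderiv_orbitMap_zero ht hx hv, orbitMap_zero] at h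
    exact Submodule.subset_span h

/-- A map that is smooth on `Mt t` is smooth in the orbit parametrization. -/
theorem ContDiffOn.comp_orbitMap {E : Type*} [NormedAddCommGroup E] [NormedSpace ℝ E] {t : ℝ}
    {x : L6} (hx : x ∈ Mt t) {G : L6 → E} (hG : ContDiffOn ℝ ∞ G (Mt t)) :
    ContDiff ℝ ∞ (G ∘ orbitMap t x) := by
  rw [← contDiffOn_univ]
  exact hG.comp (contDiff_orbitMap t x).contDiffOn fun y _ => orbitMap_mem hx y

theorem fderiv_comp_orbitMap {t : ℝ} {x : L6} (hx : x ∈ Mt t) {G : L6 → L6}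
    (hG : ContDiffOn ℝ ∞ G (Mt t)) (y v : L6) :
    ∃ w : TM (Mt t) (orbitMap t x y), (w : L6) = fderiv ℝ (orbitMap t x) y v ∧
      fderiv ℝ (G ∘ orbitMap t x) y v = dM (Mt t) G (orbitMap t x y) w := by
  have hd := (contDiff_orbitMap t x).differentiable (by simp) y
  refine ⟨⟨_, Submodule.subset_span (fderiv_mem_tangentCone hd (orbitMap_mem hx) v)⟩, rfl, ?_⟩
  have h1 := (hG.differentiableOn (by simp) _ (orbitMap_mem hx y)).hasFDerivWithinAt
  rw [(h1.comp_hasFDerivAt y hd.hasFDerivAt (by simp [orbitMap_mem hx])).fderiv]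
  rfl

/-- This trades the intrinsic differential on `Mt t` for an ordinary derivative on a vector space,
where second derivatives exist and are symmetric. -/
theorem fderiv_comp_orbitMap_zero {t : ℝ} (ht : 1 < t) {x : L6} (hx : x ∈ Mt t) {G : L6 → L6}
    (hG : ContDiffOn ℝ ∞ G (Mt t)) (v : TM (Mt t) x) :
    fderiv ℝ (G ∘ orbitMap t x) 0 v = dM (Mt t) G x v := by
  have hd := (contDiff_orbitMap t x).differentiable (by simp) 0
  have h1 := (hG.differentiableOn (by simp) _ hx).hasFDerivWithinAt
  rw [← orbitMap_zero t x] at h1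
  rw [(h1.comp_hasFDerivAt 0 hd.hasFDerivAt (by simp [orbitMap_mem hx])).fderiv]
  have hv : (v : L6) ∈ tanSpace x := (TM_Mt ht hx).le v.2
  simp [fderiv_orbitMap_zero ht hx hv, dM]

/-! ### Positive definite forms on finite-dimensional spaces -/

section PosDef

variable {V : Type*} [AddCommGroup V] [Module ℝ V]
  {B : V →ₗ[ℝ] V →ₗ[ℝ] ℝ}

theorem exists_orthonormal_basis_of_posDef [FiniteDimensional ℝ V] (hs : ∀ v w, B v w = B w v)
    (hp : ∀ v, v ≠ 0 → 0 < B v v) :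
    ∃ b : Module.Basis (Fin (Module.finrank ℝ V)) ℝ V, ∀ i j, B (b i) (b j) = if i = j then 1 else 0 := by
  let c : InnerProductSpace.Core ℝ V :=
    { inner := fun v w => B v w
      conj_inner_symm := fun v w => hs w v
      re_inner_nonneg := fun v => by
        by_cases h : v = 0
        · simp [h]
        · exact (hp v h).le
      add_left := fun v w z => by simp
      smul_left := fun v w r => by simp
      definite := fun v h => by
        by_contra hv
        exact (hp v hv).ne' h }
  let _ := c.toNormedAddCommGroup
  let _ := InnerProductSpace.ofCore c.toCore
  refine ⟨(stdOrthonormalBasis ℝ V).toBasis, fun i j => ?_⟩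
  rw [OrthonormalBasis.coe_toBasis]
  exact orthonormal_iff_ite.1 (stdOrthonormalBasis ℝ V).orthonormal i j

variable {ι : Type*} [Fintype ι] [DecidableEq ι] {b : Module.Basis ι ℝ V}

theorem repr_eq_of_orthogonal {s : ι → ℝ} (hs : ∀ i, s i * s i = 1)
    (hb : ∀ i j, B (b i) (b j) = if i = j then s i else 0) (v : V) (i : ι) :
    b.repr v i = s i * B (b i) v := by
  conv_rhs => rw [← b.sum_repr v, map_sum]
  simp only [map_smul, hb, smul_eq_mul, mul_ite, mul_zero, Finset.sum_ite_eq, Finset.mem_univ,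
    if_true]
  rw [mul_left_comm, hs, mul_one]

theorem trace_eq_sum_of_orthogonal {s : ι → ℝ} (hs : ∀ i, s i * s i = 1)
    (hb : ∀ i j, B (b i) (b j) = if i = j then s i else 0) (A : Module.End ℝ V) :
    LinearMap.trace ℝ V A = ∑ i, s i * B (b i) (A (b i)) := by
  rw [LinearMap.trace_eq_matrix_trace ℝ b, Matrix.trace]
  exact Finset.sum_congr rfl fun i _ => by
    rw [Matrix.diag_apply, LinearMap.toMatrix_apply, repr_eq_of_orthogonal hs hb]

theorem trace_eq_sum_of_orthonormal (hb : ∀ i j, B (b i) (b j) = if i = j then 1 else 0)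
    (A : Module.End ℝ V) : LinearMap.trace ℝ V A = ∑ i, B (b i) (A (b i)) := by
  simpa using trace_eq_sum_of_orthogonal (s := fun _ => 1) (by simp) hb A

/-- Cauchy–Schwarz on the diagonal entries, each of which satisfies `B(b, A b)² ≤ B(A b, A b)`. It
turns a bound on `|A|²` into one on the mean curvature. -/
theorem trace_sq_le [FiniteDimensional ℝ V] (hs : ∀ v w, B v w = B w v) (hp : ∀ v, v ≠ 0 → 0 < B v v)
    {A : Module.End ℝ V} (hA : ∀ v w, B (A v) w = B v (A w)) :
    LinearMap.trace ℝ V A ^ 2 ≤ Module.finrank ℝ V * LinearMap.trace ℝ V (A * A) := by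
  obtain ⟨b, hb⟩ := exists_orthonormal_basis_of_posDef hs hp
  rw [trace_eq_sum_of_orthonormal hb, trace_eq_sum_of_orthonormal hb]
  have h1 := sq_sum_le_card_mul_sum_sq (s := Finset.univ) (f := fun i => B (b i) (A (b i)))
  rw [Finset.card_univ, Fintype.card_fin] at h1
  refine h1.trans (mul_le_mul_of_nonneg_left (Finset.sum_le_sum fun i _ => ?_) (by positivity))
  -- The part of `A (b i)` orthogonal to `b i`; its square norm is the defect in the required
  -- inequality.
  set z := A (b i) - B (b i) (A (b i)) • b i with hz
  have h2 : 0 ≤ B z z := by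
    by_cases h : z = 0
    · simp [h]
    · exact (hp z h).le
  have h3 : B (b i) ((A * A) (b i)) = B (A (b i)) (A (b i)) := by
    rw [Module.End.mul_apply, hA]
  rw [h3]
  simp only [hz, map_sub, map_smul, LinearMap.sub_apply, LinearMap.smul_apply, smul_eq_mul, hb,
    hs (A (b i)) (b i), if_true] at h2
  nlinarith

end PosDef

/-! ### The second fundamental form -/

variable {t : ℝ} {x : L6} {F ν : L6 → L6}

theorem isTangentHH_dM (ht : 1 < t) (hF : IsImmersion (Mt t) F) (hx : x ∈ Mt t)
    (v : TM (Mt t) x) : IsTangentHH (F x) (dM (Mt t) F x v) := by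
  have h := fderiv_mem_tangentCone (M := HH)
    ((ContDiffOn.comp_orbitMap hx hF.1).differentiable (by simp) 0)
    (fun z => hF.2.1 (orbitMap_mem hx z)) v
  rw [fderiv_comp_orbitMap_zero ht hx hF.1, Function.comp_apply, orbitMap_zero] at h
  exact isTangentHH_of_mem_tangentCone subset_rfl (hF.2.1 hx) h

/-- The pull-back of the product metric to the tangent space. -/
def pullback (t : ℝ) (F : L6 → L6) (x : L6) : TM (Mt t) x →ₗ[ℝ] TM (Mt t) x →ₗ[ℝ] ℝ :=
  LinearMap.mk₂ ℝ (fun v w => ip (dM (Mt t) F x v) (dM (Mt t) F x w))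
    (by simp) (by simp) (by simp) (by simp)

theorem pullback_apply (v w : TM (Mt t) x) :
    pullback t F x v w = ip (dM (Mt t) F x v) (dM (Mt t) F x w) := rfl

theorem pullback_comm (v w : TM (Mt t) x) : pullback t F x v w = pullback t F x w v :=
  ip_comm _ _

theorem pullback_pos (ht : 1 < t) (hF : IsImmersion (Mt t) F) (hx : x ∈ Mt t)
    (v : TM (Mt t) x) (hv : v ≠ 0) : 0 < pullback t F x v v := by
  have h := isTangentHH_dM ht hF hx v
  refine lt_of_le_of_ne (ip_self_nonneg (hF.2.1 hx) h) fun h0 => hv ?_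
  refine hF.2.2 x hx ?_
  rw [map_zero]
  exact eq_zero_of_ip_self (hF.2.1 hx) h h0.symm

/-- The second derivative of `F : Mt t → H² × H²` at `x` in the orbit parametrization. -/
def hess (t : ℝ) (F : L6 → L6) (x v w : L6) : L6 :=
  fderiv ℝ (fderiv ℝ (F ∘ orbitMap t x)) 0 v w

theorem hess_symm (hF : ContDiffOn ℝ ∞ F (Mt t)) (hx : x ∈ Mt t) (v w : L6) :
    hess t F x v w = hess t F x w v := by
  have h := (ContDiffOn.comp_orbitMap hx hF).contDiffAt (x := 0)
  exact (h.isSymmSndFDerivAt (by rw [minSmoothness_of_isRCLikeNormedField]; exact WithTop.coe_le_coe.2 (le_top (a := 2)))) v w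

theorem hasDerivAt_comp_line {E : Type*} [NormedAddCommGroup E] [NormedSpace ℝ E] {G : L6 → E}
    (hG : Differentiable ℝ G) (v : L6) (σ : ℝ) :
    HasDerivAt (fun σ : ℝ => G (σ • v)) (fderiv ℝ G (σ • v) v) σ := by
  have h : HasDerivAt (fun σ : ℝ => σ • v) v σ := by
    simpa using (hasDerivAt_id σ).smul_const v
  exact (hG _).hasFDerivAt.comp_hasDerivAt σ h

theorem hasDerivAt_fderiv_line (hF : ContDiffOn ℝ ∞ F (Mt t)) (hx : x ∈ Mt t) (v w : L6) :
    HasDerivAt (fun σ : ℝ => fderiv ℝ (F ∘ orbitMap t x) (σ • v) w) (hess t F x v w) 0 := by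
  have h := (ContDiffOn.comp_orbitMap hx hF).fderiv_right (m := 1) (WithTop.coe_le_coe.2 (le_top (a := 1 + 1)))
  have := hasDerivAt_comp_line (h.differentiable (by simp)) v 0
  rw [zero_smul] at this
  exact (this.clm_apply (hasDerivAt_const 0 w)).congr_deriv (by rw [map_zero, add_zero]; rfl)

/-- The Gauss formula: the shape operator represents the normal part of the second derivative. -/
theorem pullback_shape (ht : 1 < t) (hF : IsImmersion (Mt t) F) (hν : IsUnitNormal (Mt t) F ν)
    (hx : x ∈ Mt t) {A : Module.End ℝ (TM (Mt t) x)} (hA : IsShapeOperator (Mt t) F ν x A)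
    (v w : TM (Mt t) x) : pullback t F x (A v) w = ip (hess t F x v w) (ν x) := by
  have h1 := hasDerivAt_fderiv_line hF.1 hx v w
  have h2 := hasDerivAt_comp_line ((ContDiffOn.comp_orbitMap hx hν.1).differentiable (by simp)) v 0
  have h3 := h1.ip h2
  have h4 : (fun σ : ℝ => ip (fderiv ℝ (F ∘ orbitMap t x) (σ • v) w)
      ((ν ∘ orbitMap t x) (σ • v))) = fun _ => 0 := by
    funext σ
    obtain ⟨w', -, hw'⟩ := fderiv_comp_orbitMap hx hF.1 (σ • (v : L6)) w
    rw [hw']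
    exact (hν.2 _ (orbitMap_mem hx _)).2.2 w'
  rw [h4] at h3
  have h5 := h3.unique (hasDerivAt_const 0 0)
  rw [zero_smul, fderiv_comp_orbitMap_zero ht hx hF.1, fderiv_comp_orbitMap_zero ht hx hν.1,
    Function.comp_apply, orbitMap_zero] at h5
  rw [pullback_apply, hA v, ip_neg_left, ip_comm, ip_proj (isTangentHH_dM ht hF hx w)]
  linarith

theorem shape_symm (ht : 1 < t) (hF : IsImmersion (Mt t) F) (hν : IsUnitNormal (Mt t) F ν)
    (hx : x ∈ Mt t) {A : Module.End ℝ (TM (Mt t) x)} (hA : IsShapeOperator (Mt t) F ν x A)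
    (v w : TM (Mt t) x) : pullback t F x (A v) w = pullback t F x v (A w) := by
  rw [pullback_shape ht hF hν hx hA, hess_symm hF.1 hx, pullback_comm,
    pullback_shape ht hF hν hx hA]

/-- The shape operator at a point depends only on the normal vector at that point. -/
theorem shape_eq_smul (ht : 1 < t) (hF : IsImmersion (Mt t) F) {ν' : L6 → L6}
    (hν : IsUnitNormal (Mt t) F ν) (hν' : IsUnitNormal (Mt t) F ν') (hx : x ∈ Mt t)
    {A A' : Module.End ℝ (TM (Mt t) x)} (hA : IsShapeOperator (Mt t) F ν x A)
    (hA' : IsShapeOperator (Mt t) F ν' x A') {c : ℝ} (hc : ν' x = c • ν x) : A' = c • A := by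
  ext1 v
  by_contra h
  have := pullback_pos ht hF hx _ (sub_ne_zero.2 h)
  rw [LinearMap.map_sub₂, LinearMap.smul_apply, LinearMap.map_smul₂,
    pullback_shape ht hF hν' hx hA', pullback_shape ht hF hν hx hA, hc, ip_smul_right,
    smul_eq_mul, sub_self] at this
  exact this.false

/-! ### Principal directions of `Mt t` -/

/-- The Lorentzian cross product. -/
def cross (p q : L3) : L3 :=
  ![-(p 1 * q 2 - p 2 * q 1), p 2 * q 0 - p 0 * q 2, p 0 * q 1 - p 1 * q 0]

theorem lor_cross_left (p q : L3) : lor (cross p q) p = 0 := by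
  simp only [lor, cross, Matrix.cons_val_zero, Matrix.cons_val_one, Matrix.cons_val]; ring

theorem lor_cross_right (p q : L3) : lor (cross p q) q = 0 := by
  simp only [lor, cross, Matrix.cons_val_zero, Matrix.cons_val_one, Matrix.cons_val]; ring

theorem lor_cross_self (p q : L3) :
    lor (cross p q) (cross p q) = lor p q ^ 2 - lor p p * lor q q := by
  simp only [lor, cross, Matrix.cons_val_zero, Matrix.cons_val_one, Matrix.cons_val]; ring

/-- Expansion in the frame `p`, `q`, `p × q`, multiplied by the Gram factor to avoid division. It
shows that the principal directions span the tangent space. -/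
theorem cross_decomposition (p q y : L3) : (lor p q ^ 2 - lor p p * lor q q) • y =
    (lor p q * lor y q - lor q q * lor y p) • p + (lor p q * lor y p - lor p p * lor y q) • q +
      lor y (cross p q) • cross p q := by
  ext i
  fin_cases i <;>
  · simp [lor, cross]
    ring

section

variable {t : ℝ} {x : L6}

theorem lor_swap (hx : x ∈ Mt t) : lor x.2 x.1 = -t := by rw [lor_comm, hx.2]

theorem t_sq_sub_one_pos (ht : 1 < t) : 0 < t ^ 2 - 1 := by nlinarith

/-- The three principal directions of `Mt t` at `x`. -/
def principalVec (t : ℝ) (x : L6) : Fin 3 → L6 :=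
  ![(cross x.1 x.2, -cross x.1 x.2), (cross x.1 x.2, cross x.1 x.2),
    (x.2 - t • x.1, t • x.2 - x.1)]

theorem principalVec_mem (hx : x ∈ Mt t) (i : Fin 3) : principalVec t x i ∈ tanSpace x := by
  have h1 := hx.1.1.1
  have h2 := hx.1.2.1
  have h3 := hx.2
  have h4 := lor_swap hx
  have h5 := lor_cross_left x.1 x.2
  have h6 := lor_cross_right x.1 x.2
  fin_cases i <;> refine ⟨⟨?_, ?_⟩, ?_⟩ <;>
    simp [principalVec, h1, h2, h3, h4, h5, h6, lor_comm x.1 (cross x.1 x.2)]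

theorem ip_principalVec (hx : x ∈ Mt t) (i j : Fin 3) :
    ip (principalVec t x i) (principalVec t x j) = if i = j then 2 * (t ^ 2 - 1) else 0 := by
  have h1 := hx.1.1.1
  have h2 := hx.1.2.1
  have h3 := hx.2
  have h4 := lor_swap hx
  have h5 := lor_cross_left x.1 x.2
  have h6 := lor_cross_right x.1 x.2
  have h7 := lor_cross_self x.1 x.2
  rw [h1, h2, h3] at h7
  fin_cases i <;> fin_cases j <;>
    simp [principalVec, ip, h1, h2, h3, h4, h5, h6, h7, lor_comm x.1 (cross x.1 x.2),
      lor_comm x.2 (cross x.1 x.2)] <;> ring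

theorem linearIndependent_principalVec (ht : 1 < t) (hx : x ∈ Mt t) :
    LinearIndependent ℝ (principalVec t x) := by
  rw [Fintype.linearIndependent_iff]
  intro g hg i
  have h : ipL (principalVec t x i) (∑ j, g j • principalVec t x j) = 0 := by rw [hg, map_zero]
  simp only [map_sum, map_smul, ipL_apply, ip_principalVec hx, smul_eq_mul, mul_ite, mul_zero,
    Finset.sum_ite_eq, Finset.mem_univ, if_true] at h
  rcases mul_eq_zero.1 h with h | h
  · exact h
  · linarith [t_sq_sub_one_pos ht]

theorem tanSpace_le_span (ht : 1 < t) (hx : x ∈ Mt t) :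
    tanSpace x ≤ Submodule.span ℝ (range (principalVec t x)) := by
  rintro v ⟨⟨h1, h2⟩, h3⟩
  have ht' := t_sq_sub_one_pos ht
  have e : v = (t ^ 2 - 1)⁻¹ • (((lor v.1 (cross x.1 x.2) - lor v.2 (cross x.1 x.2)) / 2) •
      principalVec t x 0 + ((lor v.1 (cross x.1 x.2) + lor v.2 (cross x.1 x.2)) / 2) •
      principalVec t x 1 + lor v.1 x.2 • principalVec t x 2) := by
    rw [eq_inv_smul_iff₀ ht'.ne']
    have d1 := cross_decomposition x.1 x.2 v.1
    have d2 := cross_decomposition x.1 x.2 v.2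
    have h4 : lor v.2 x.1 = -lor v.1 x.2 := by rw [lor_comm v.2]; linarith
    rw [hx.1.1.1, hx.1.2.1, hx.2, h1] at d1
    rw [hx.1.1.1, hx.1.2.1, hx.2, h2, h4] at d2
    have ee : (-t) ^ 2 - -1 * -1 = t ^ 2 - 1 := by ring
    rw [ee] at d1 d2
    refine Prod.ext ?_ ?_
    · rw [Prod.smul_fst, d1]
      simp only [principalVec, Matrix.cons_val_zero, Matrix.cons_val_one, Matrix.cons_val,
        Prod.fst_add, Prod.smul_fst]
      module
    · rw [Prod.smul_snd, d2]
      simp only [principalVec, Matrix.cons_val_zero, Matrix.cons_val_one, Matrix.cons_val,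
        Prod.snd_add, Prod.smul_snd]
      module
  rw [e]
  refine Submodule.smul_mem _ _ (Submodule.add_mem _ (Submodule.add_mem _ ?_ ?_) ?_) <;>
    exact Submodule.smul_mem _ _ (Submodule.subset_span (mem_range_self _))

/-- The basis of principal directions of the tangent space. -/
def principalBasis (ht : 1 < t) (hx : x ∈ Mt t) : Module.Basis (Fin 3) ℝ (TM (Mt t) x) :=
  Module.Basis.mk (v := fun i => (⟨principalVec t x i, (TM_Mt ht hx).ge (principalVec_mem hx i)⟩ :
      TM (Mt t) x))
    (LinearIndependent.of_comp (TM (Mt t) x).subtype (linearIndependent_principalVec ht hx))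
    (by
      rintro ⟨v, hv⟩ -
      have h := tanSpace_le_span ht hx ((TM_Mt ht hx).le hv)
      have e : range (principalVec t x) = (TM (Mt t) x).subtype '' range
          (fun i => (⟨principalVec t x i, (TM_Mt ht hx).ge (principalVec_mem hx i)⟩ :
            TM (Mt t) x)) := by
        rw [← range_comp]
        rfl
      rw [e, ← Submodule.map_span] at h
      obtain ⟨w, hw, hw'⟩ := h
      have : w = ⟨v, hv⟩ := Subtype.ext hw'
      exact this ▸ hw)

theorem principalBasis_apply (ht : 1 < t) (hx : x ∈ Mt t) (i : Fin 3) :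
    (principalBasis ht hx i : L6) = principalVec t x i := by
  simp [principalBasis]

theorem finrank_TM (ht : 1 < t) (hx : x ∈ Mt t) : Module.finrank ℝ (TM (Mt t) x) = 3 := by
  rw [Module.finrank_eq_card_basis (principalBasis ht hx), Fintype.card_fin]

/-! ### The shape operator of `Mt t` -/

/-- `(√(2 (t² - 1)))⁻¹`, the normalizing factor of the unit normal field. -/
def nFactor (t : ℝ) : ℝ := (Real.sqrt (2 * (t ^ 2 - 1)))⁻¹

theorem nFactor_pos (ht : 1 < t) : 0 < nFactor t :=
  inv_pos.2 (Real.sqrt_pos.2 (by linarith [t_sq_sub_one_pos ht]))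

theorem nFactor_sq (ht : 1 < t) : nFactor t ^ 2 * (2 * (t ^ 2 - 1)) = 1 := by
  have := t_sq_sub_one_pos ht
  rw [nFactor, inv_pow, Real.sq_sqrt (by linarith), inv_mul_cancel₀ (by linarith)]

/-- `Nt t` as a continuous linear map. -/
def NtL (t : ℝ) : L6 →L[ℝ] L6 :=
  nFactor t • (((ContinuousLinearMap.snd ℝ L3 L3) - t • ContinuousLinearMap.fst ℝ L3 L3).prod
    ((ContinuousLinearMap.fst ℝ L3 L3) - t • ContinuousLinearMap.snd ℝ L3 L3))

theorem Nt_def (v : L6) : Nt t v = nFactor t • (v.2 - t • v.1, v.1 - t • v.2) := rfl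

theorem dM_Nt (v : TM (Mt t) x) : dM (Mt t) (Nt t) x v = Nt t v :=
  dM_eq (NtL t).hasFDerivWithinAt v

theorem dM_id (v : TM (Mt t) x) : dM (Mt t) id x v = v :=
  dM_eq (ContinuousLinearMap.id ℝ L6).hasFDerivWithinAt v

theorem isTangentHH_Nt (hx : x ∈ Mt t) : IsTangentHH x (Nt t x) := by
  rw [Nt_def]
  refine IsTangentHH.smul _ ⟨?_, ?_⟩ <;> simp [hx.1.1.1, hx.1.2.1, hx.2, lor_swap hx]

theorem ip_Nt_self (ht : 1 < t) (hx : x ∈ Mt t) : ip (Nt t x) (Nt t x) = 1 := by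
  rw [Nt_def]
  simp only [ip, Prod.smul_fst, Prod.smul_snd, lor_smul_left, lor_smul_right, lor_sub_left,
    lor_sub_right, hx.1.1.1, hx.1.2.1, hx.2, lor_swap hx]
  linear_combination nFactor_sq ht

theorem ip_Nt {v : L6} (hv : IsTangentHH x v) :
    ip v (Nt t x) = nFactor t * (lor v.1 x.2 + lor x.1 v.2) := by
  rw [Nt_def]
  simp only [ip, Prod.smul_fst, Prod.smul_snd, lor_smul_right, lor_sub_right, hv.1, hv.2,
    lor_comm v.2 x.1]
  ring

theorem isUnitNormal_Nt (ht : 1 < t) : IsUnitNormal (Mt t) id (Nt t) :=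
  ⟨(NtL t).contDiff.contDiffOn, fun x hx => ⟨isTangentHH_Nt hx, ip_Nt_self ht hx, fun v => by
    have hv := (TM_Mt ht hx).le v.2
    rw [dM_id, ip_Nt hv.1, hv.2, mul_zero]⟩⟩

theorem isHypersurface_Mt (ht : 1 < t) : IsHypersurface (Mt t) := by
  refine ⟨fun x hx => hx.1, fun x hx => ⟨univ, fun z => lor z.1 z.2 + t, isOpen_univ, mem_univ x,
    (contDiff_lor.add contDiff_const).contDiffOn, ?_, Nt t x, isTangentHH_Nt hx, ?_⟩⟩
  · ext y
    simp [Mt, eq_neg_iff_add_eq_zero]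
  · rw [((hasFDerivAt_lor x).add_const t).fderiv]
    have h := ip_Nt (t := t) (isTangentHH_Nt hx)
    rw [ip_Nt_self ht hx] at h
    intro h0
    change lor x.1 (Nt t x).2 + lor x.2 (Nt t x).1 = 0 at h0
    rw [lor_comm (Nt t x).1, add_comm, h0, mul_zero] at h
    exact one_ne_zero h

/-- The right-hand side of the formula for the shape operator of `Mt t`. -/
def shapeFormula (t : ℝ) (x v : L6) : L6 :=
  nFactor t • (t • v - (v.2, v.1) + (lor v.1 x.2 • x.1, lor v.2 x.1 • x.2))

theorem shapeFormula_mem (hx : x ∈ Mt t) {v : L6} (hv : v ∈ tanSpace x) :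
    shapeFormula t x v ∈ tanSpace x := by
  obtain ⟨⟨h1, h2⟩, h3⟩ := hv
  refine Submodule.smul_mem _ _ ⟨⟨?_, ?_⟩, ?_⟩ <;>
    simp only [Prod.fst_add, Prod.snd_add, Prod.fst_sub, Prod.snd_sub, Prod.smul_fst,
      Prod.smul_snd, lor_add_left, lor_sub_left, lor_add_right, lor_sub_right, lor_smul_left,
      lor_smul_right, h1, h2, hx.1.1.1, hx.1.2.1, hx.2, lor_comm x.1 v.2,
      lor_comm x.1 v.1] at h3 ⊢
  · linear_combination -h3
  · linear_combination -h3
  · ring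

/-- The shape operator of `Mt t`. -/
def shapeMt (ht : 1 < t) (hx : x ∈ Mt t) : Module.End ℝ (TM (Mt t) x) where
  toFun v := ⟨shapeFormula t x v, (TM_Mt ht hx).ge (shapeFormula_mem hx ((TM_Mt ht hx).le v.2))⟩
  map_add' v w := by
    ext i <;> simp [shapeFormula] <;> ring
  map_smul' c v := by
    ext i <;> simp [shapeFormula] <;> ring

theorem coe_shapeMt (ht : 1 < t) (hx : x ∈ Mt t) (v : TM (Mt t) x) :
    (shapeMt ht hx v : L6) = shapeFormula t x v := rfl

theorem shapeFormula_eq {v : L6} (hv : v ∈ tanSpace x) :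
    shapeFormula t x v = -proj x (Nt t v) := by
  obtain ⟨⟨h1, h2⟩, h3⟩ := hv
  rw [Nt_def]
  refine Prod.ext ?_ ?_ <;>
    simp only [shapeFormula, proj, Prod.fst_add, Prod.snd_add, Prod.fst_sub, Prod.snd_sub,
      Prod.fst_neg, Prod.snd_neg, Prod.smul_fst, Prod.smul_snd, lor_smul_left, lor_sub_left,
      h1, h2, lor_comm x.1 v.2] at h3 ⊢
  · rw [show lor v.1 x.2 = -lor v.2 x.1 by linarith]
    module
  · rw [show lor v.1 x.2 = -lor v.2 x.1 by linarith]
    module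

theorem isShapeOperator_shapeMt (ht : 1 < t) (hx : x ∈ Mt t) :
    IsShapeOperator (Mt t) id (Nt t) x (shapeMt ht hx) := fun v => by
  rw [dM_id, dM_Nt, coe_shapeMt, shapeFormula_eq ((TM_Mt ht hx).le v.2), id]

/-- The principal curvatures of `Mt t`. -/
def principalCurv (t : ℝ) : Fin 3 → ℝ := ![nFactor t * (t + 1), nFactor t * (t - 1), 0]

/-- On `(n, ∓n)` with `n = p × q` the exchange of factors acts as `∓1` and the correction terms
vanish, whence `t ± 1`. The third direction slides both points along their common geodesic; there
all terms cancel. -/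
theorem shapeMt_principalBasis (ht : 1 < t) (hx : x ∈ Mt t) (i : Fin 3) :
    shapeMt ht hx (principalBasis ht hx i) = principalCurv t i • principalBasis ht hx i := by
  have h1 := hx.1.1.1
  have h2 := hx.1.2.1
  have h3 := hx.2
  have h4 := lor_swap hx
  have h5 := lor_cross_left x.1 x.2
  have h6 := lor_cross_right x.1 x.2
  refine Subtype.ext ?_
  rw [coe_shapeMt, Submodule.coe_smul, principalBasis_apply]
  fin_cases i <;> refine Prod.ext ?_ ?_ <;>
    simp [principalVec, principalCurv, shapeFormula, h1, h2, h3, h4, h5, h6] <;> module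

theorem shapeMt_eq_toLin (ht : 1 < t) (hx : x ∈ Mt t) : shapeMt ht hx =
    Matrix.toLin (principalBasis ht hx) (principalBasis ht hx)
      (Matrix.diagonal (principalCurv t)) := by
  refine (principalBasis ht hx).ext fun i => ?_
  rw [shapeMt_principalBasis, Matrix.toLin_self]
  simp [Matrix.diagonal_apply, ite_smul]

theorem trace_shapeMt (ht : 1 < t) (hx : x ∈ Mt t) :
    LinearMap.trace ℝ _ (shapeMt ht hx) = 2 * t * nFactor t := by
  rw [shapeMt_eq_toLin, Matrix.trace_toLin_eq, Matrix.trace_diagonal, Fin.sum_univ_three]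
  simp [principalCurv]
  ring

theorem trace_shapeMt_sq (ht : 1 < t) (hx : x ∈ Mt t) :
    LinearMap.trace ℝ _ (shapeMt ht hx * shapeMt ht hx) = (t ^ 2 + 1) / (t ^ 2 - 1) := by
  rw [shapeMt_eq_toLin, Module.End.mul_eq_comp, ← Matrix.toLin_mul, Matrix.diagonal_mul_diagonal,
    Matrix.trace_toLin_eq, Matrix.trace_diagonal, Fin.sum_univ_three]
  have := t_sq_sub_one_pos ht
  rw [eq_div_iff this.ne']
  simp [principalCurv]
  linear_combination (t ^ 2 + 1) * nFactor_sq ht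

theorem hasEigenvalue_shapeMt (ht : 1 < t) (hx : x ∈ Mt t) (κ : ℝ) :
    Module.End.HasEigenvalue (shapeMt ht hx) κ ↔ ∃ i, principalCurv t i = κ := by
  rw [shapeMt_eq_toLin, hasEigenvalue_toLin_diagonal_iff]

theorem nFactor_mul_add_one (ht : 1 < t) :
    nFactor t * (t + 1) = 1 / Real.sqrt 2 * Real.sqrt ((t + 1) / (t - 1)) := by
  rw [nFactor, ← Real.sqrt_inv, one_div, ← Real.sqrt_inv, ← Real.sqrt_mul (by norm_num)]
  symm
  rw [Real.sqrt_eq_iff_mul_self_eq (mul_nonneg (by norm_num) (div_nonneg (by linarith) (by linarith)))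
    (by positivity), ← sq, mul_pow, Real.sq_sqrt (inv_nonneg.2 (by linarith [t_sq_sub_one_pos ht]))]
  have h1 : t - 1 ≠ 0 := by linarith
  have h2 : t + 1 ≠ 0 := by linarith
  rw [show t ^ 2 - 1 = (t - 1) * (t + 1) by ring]
  field_simp

theorem nFactor_mul_sub_one (ht : 1 < t) :
    nFactor t * (t - 1) = 1 / Real.sqrt 2 * Real.sqrt ((t - 1) / (t + 1)) := by
  rw [nFactor, ← Real.sqrt_inv, one_div, ← Real.sqrt_inv, ← Real.sqrt_mul (by norm_num)]
  symm
  rw [Real.sqrt_eq_iff_mul_self_eq (mul_nonneg (by norm_num) (div_nonneg (by linarith) (by linarith)))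
    (mul_nonneg (Real.sqrt_nonneg _) (by linarith)), ← sq, mul_pow,
    Real.sq_sqrt (inv_nonneg.2 (by linarith [t_sq_sub_one_pos ht]))]
  have h1 : t - 1 ≠ 0 := by linarith
  have h2 : t + 1 ≠ 0 := by linarith
  rw [show t ^ 2 - 1 = (t - 1) * (t + 1) by ring]
  field_simp

theorem curvature_eq (t : ℝ) : 
    2 * t * nFactor t / 3 = Real.sqrt 2 * t / (3 * Real.sqrt (t ^ 2 - 1)) := by
  rw [nFactor, Real.sqrt_mul (by norm_num)]
  have h : Real.sqrt 2 ≠ 0 := by positivity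
  have h2 : Real.sqrt 2 ^ 2 = 2 := Real.sq_sqrt (by norm_num)
  by_cases h3 : Real.sqrt (t ^ 2 - 1) = 0
  · simp [h3]
  · field_simp
    rw [h2, mul_comm]

theorem hasMeanCurvature_Nt (ht : 1 < t) (hx : x ∈ Mt t) : HasMeanCurvature (Mt t) id (Nt t) x
    (Real.sqrt 2 * t / (3 * Real.sqrt (t ^ 2 - 1))) :=
  ⟨shapeMt ht hx, isShapeOperator_shapeMt ht hx, by rw [trace_shapeMt, curvature_eq]⟩

theorem Mt_nonempty (ht : 1 < t) : (Mt t).Nonempty := by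
  have h := Real.sq_sqrt (t_sq_sub_one_pos ht).le
  refine ⟨(![1, 0, 0], ![t, Real.sqrt (t ^ 2 - 1), 0]), ⟨⟨?_, ?_⟩, ?_, ?_⟩, ?_⟩ <;>
    simp [lor]
  · nlinarith
  · linarith

theorem principalCurvatures_nodup (ht : 1 < t) :
    [1 / Real.sqrt 2 * Real.sqrt ((t + 1) / (t - 1)),
      1 / Real.sqrt 2 * Real.sqrt ((t - 1) / (t + 1)), 0].Nodup := by
  have h := nFactor_pos ht
  rw [← nFactor_mul_add_one ht, ← nFactor_mul_sub_one ht]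
  have h1 : nFactor t * (t + 1) ≠ nFactor t * (t - 1) := fun e => by
    have := mul_left_cancel₀ h.ne' e
    linarith
  have h2 : nFactor t * (t + 1) ≠ 0 := mul_ne_zero h.ne' (by linarith)
  have h3 : nFactor t * (t - 1) ≠ 0 := mul_ne_zero h.ne' (by linarith)
  simp only [List.nodup_cons, List.mem_cons, List.not_mem_nil, not_or, not_false_eq_true, and_true,
    List.nodup_nil]
  exact ⟨⟨h1, h2⟩, h3⟩

end

/-! ### Geodesics -/

/-- The operator factors as `(d/dσ - k)(d/dσ + k)`, so two integrating factors suffice: first `y' +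
k y = 0`, then `y = 0`. -/
theorem eq_zero_of_second_order {E : Type*} [NormedAddCommGroup E] [NormedSpace ℝ E] {k : ℝ}
    {y y' : ℝ → E} (h1 : ∀ σ, HasDerivAt y (y' σ) σ) (h2 : ∀ σ, HasDerivAt y' (k ^ 2 • y σ) σ)
    (h3 : y 0 = 0) (h4 : y' 0 = 0) (σ : ℝ) : y σ = 0 := by
  have he : ∀ (c σ : ℝ), HasDerivAt (fun σ => Real.exp (c * σ)) (c * Real.exp (c * σ)) σ :=
    fun c σ => ((hasDerivAt_id σ).const_mul c).exp.congr_deriv (by simp [mul_comm])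
  have h5 : ∀ σ, HasDerivAt (fun σ => Real.exp (-k * σ) • (y' σ + k • y σ)) 0 σ := fun σ =>
    ((he (-k) σ).smul ((h2 σ).add ((h1 σ).const_smul k))).congr_deriv
      (by simp only [Pi.add_apply, Pi.smul_apply]; module)
  have h6 : ∀ σ, y' σ + k • y σ = 0 := fun σ => by
    have := is_const_of_deriv_eq_zero (fun σ => (h5 σ).differentiableAt) (fun σ => (h5 σ).deriv) σ 0
    simp only [h3, h4, smul_zero, add_zero] at this
    exact (smul_eq_zero.1 this).resolve_left (Real.exp_ne_zero _)
  have h7 : ∀ σ, HasDerivAt (fun σ => Real.exp (k * σ) • y σ) 0 σ := fun σ =>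
    ((he k σ).smul (h1 σ)).congr_deriv (by
      rw [eq_neg_of_add_eq_zero_left (h6 σ)]
      module)
  have := is_const_of_deriv_eq_zero (fun σ => (h7 σ).differentiableAt) (fun σ => (h7 σ).deriv) σ 0
  simp only [h3, smul_zero] at this
  exact (smul_eq_zero.1 this).resolve_left (Real.exp_ne_zero _)

theorem hasDerivAt_cosh_mul (k σ : ℝ) :
    HasDerivAt (fun σ => Real.cosh (k * σ)) (k * Real.sinh (k * σ)) σ :=
  ((hasDerivAt_id σ).const_mul k).cosh.congr_deriv (by simp [mul_comm])

theorem hasDerivAt_sinh_mul (k σ : ℝ) :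
    HasDerivAt (fun σ => Real.sinh (k * σ)) (k * Real.cosh (k * σ)) σ :=
  ((hasDerivAt_id σ).const_mul k).sinh.congr_deriv (by simp [mul_comm])

theorem hasDerivAt_hyperbola (k : ℝ) (p w : L3) (σ : ℝ) :
    HasDerivAt (fun σ => Real.cosh (k * σ) • p + Real.sinh (k * σ) • w)
      (k • (Real.cosh (k * σ) • w + Real.sinh (k * σ) • p)) σ :=
  (((hasDerivAt_cosh_mul k σ).smul_const p).add
    ((hasDerivAt_sinh_mul k σ).smul_const w)).congr_deriv (by module)

/-- A curve in the hyperbolic plane whose acceleration is normal is a hyperbola. -/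
theorem hyperbola_of_geodesic {k : ℝ} {a a' a'' : ℝ → L3} {w : L3}
    (h1 : ∀ σ, HasDerivAt a (a' σ) σ) (h2 : ∀ σ, HasDerivAt a' (a'' σ) σ)
    (hH : ∀ σ, lor (a σ) (a σ) = -1) (hg : ∀ σ, a'' σ + lor (a'' σ) (a σ) • a σ = 0)
    (h0 : a' 0 = k • w) (hw : lor w w = 1) (σ : ℝ) :
    a σ = Real.cosh (k * σ) • a 0 + Real.sinh (k * σ) • w := by
  have e1 : ∀ σ, lor (a' σ) (a σ) = 0 := fun σ => by
    have h := (h1 σ).lor (h1 σ)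
    simp only [hH] at h
    have := h.unique (hasDerivAt_const σ (-1))
    rw [lor_comm (a σ)] at this
    linarith
  have e2 : ∀ σ, lor (a'' σ) (a σ) = -lor (a' σ) (a' σ) := fun σ => by
    have h := (h2 σ).lor (h1 σ)
    simp only [e1] at h
    have := h.unique (hasDerivAt_const σ 0)
    linarith
  have e3 : ∀ σ, a'' σ = lor (a' σ) (a' σ) • a σ := fun σ => by
    have := hg σ
    rw [e2, neg_smul] at this
    exact add_neg_eq_zero.1 this
  -- Constant speed: the acceleration is a multiple of the position, which is orthogonal to the
  -- velocity. The geodesic equation thereby becomes the linear equation `a'' = k² a`.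
  have e4 : ∀ σ, HasDerivAt (fun σ => lor (a' σ) (a' σ)) 0 σ := fun σ =>
    ((h2 σ).lor (h2 σ)).congr_deriv (by
      rw [e3, lor_smul_left, lor_smul_right, lor_comm (a σ), e1]
      ring)
  have e5 : ∀ σ, lor (a' σ) (a' σ) = k ^ 2 := fun σ => by
    rw [is_const_of_deriv_eq_zero (fun σ => (e4 σ).differentiableAt) (fun σ => (e4 σ).deriv) σ 0,
      h0, lor_smul_left, lor_smul_right, hw]
    ring
  rw [← sub_eq_zero]
  refine eq_zero_of_second_order (k := k)
    (y := fun σ => a σ - (Real.cosh (k * σ) • a 0 + Real.sinh (k * σ) • w))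
    (fun σ => (h1 σ).sub (hasDerivAt_hyperbola k (a 0) w σ))
    (fun σ => ((h2 σ).sub ((hasDerivAt_hyperbola k w (a 0) σ).const_smul k)).congr_deriv ?_)
    (by simp) (by simp [h0]) σ
  rw [e3, e5]
  module

theorem hyperbola_mem {m w : L3} (hm : m ∈ H2) (hwm : lor w m = 0) (hw : lor w w = 1) (a : ℝ) :
    Real.cosh a • m + Real.sinh a • w ∈ H2 := by
  have hc := Real.cosh_sq a
  refine ⟨?_, ?_⟩
  · simp only [lor_add_left, lor_add_right, lor_smul_left, lor_smul_right, hm.1, hw, hwm,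
      lor_comm m w]
    linear_combination -hc
  · have h1 := apply_zero_sq_le hm hwm
    rw [hw, one_mul] at h1
    have h2 := hm.2
    have h3 := Real.cosh_pos a
    simp only [Pi.add_apply, Pi.smul_apply, smul_eq_mul]
    have h4 : (Real.sinh a * w 0) ^ 2 < (Real.cosh a * m 0) ^ 2 := by
      rw [mul_pow, mul_pow, hc]
      nlinarith [sq_nonneg (Real.sinh a), sq_nonneg (w 0)]
    have := abs_lt_of_sq_lt_sq' h4 (by positivity)
    linarith [this.1]

theorem isGeodesic_hyperbola {p q w z : L3} (hp : p ∈ H2) (hq : q ∈ H2) (hwp : lor w p = 0)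
    (hzq : lor z q = 0) (hw : lor w w = 1) (hz : lor z z = 1) (k : ℝ) :
    IsGeodesic (fun σ => (Real.cosh (k * σ) • p + Real.sinh (k * σ) • w,
      Real.cosh (k * σ) • q + Real.sinh (k * σ) • z)) ∧
    deriv (fun σ => ((Real.cosh (k * σ) • p + Real.sinh (k * σ) • w,
      Real.cosh (k * σ) • q + Real.sinh (k * σ) • z) : L6)) 0 = (k • w, k • z) := by
  have d1 : ∀ p w q z : L3, deriv (fun σ => ((Real.cosh (k * σ) • p + Real.sinh (k * σ) • w,
      Real.cosh (k * σ) • q + Real.sinh (k * σ) • z) : L6)) = fun σ =>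
      k • (Real.cosh (k * σ) • w + Real.sinh (k * σ) • p,
      Real.cosh (k * σ) • z + Real.sinh (k * σ) • q) := fun p w q z => by
    funext σ
    exact ((hasDerivAt_hyperbola k p w σ).prodMk (hasDerivAt_hyperbola k q z σ)).deriv
  have hH : ∀ σ, ((Real.cosh (k * σ) • p + Real.sinh (k * σ) • w,
      Real.cosh (k * σ) • q + Real.sinh (k * σ) • z) : L6) ∈ HH := fun σ =>
    ⟨hyperbola_mem hp hwp hw _, hyperbola_mem hq hzq hz _⟩
  refine ⟨⟨?_, hH, fun σ => ?_⟩, ?_⟩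
  · have hc : ContDiff ℝ ∞ fun σ => Real.cosh (k * σ) :=
      Real.contDiff_cosh.comp (contDiff_const.mul contDiff_id)
    have hs : ContDiff ℝ ∞ fun σ => Real.sinh (k * σ) :=
      Real.contDiff_sinh.comp (contDiff_const.mul contDiff_id)
    exact ((hc.smul contDiff_const).add (hs.smul contDiff_const)).prodMk
      ((hc.smul contDiff_const).add (hs.smul contDiff_const))
  · rw [d1, deriv_fun_const_smul _
      ((hasDerivAt_hyperbola k w p σ).prodMk (hasDerivAt_hyperbola k z q σ)).differentiableAt, d1]
    have h := hH σ
    refine Prod.ext ?_ ?_ <;>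
      simp only [proj, Prod.smul_fst, Prod.smul_snd, lor_smul_left, h.1.1, h.2.1, Prod.fst_zero,
        Prod.snd_zero] <;> module
  · rw [d1]
    simp

/-- `expMap` chooses an unspecified geodesic, so existence alone is not enough:
`hyperbola_of_geodesic` identifies whichever one was chosen. Writing the velocity as `k` times unit
vectors includes `k = 0`. -/
theorem expMap_eq {p q w z : L3} (hp : p ∈ H2) (hq : q ∈ H2) (hwp : lor w p = 0)
    (hzq : lor z q = 0) (hw : lor w w = 1) (hz : lor z z = 1) (k : ℝ) :
    expMap (p, q) (k • w, k • z) = (Real.cosh k • p + Real.sinh k • w,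
      Real.cosh k • q + Real.sinh k • z) := by
  have hex : ∃ γ : ℝ → L6, IsGeodesic γ ∧ γ 0 = (p, q) ∧ deriv γ 0 = (k • w, k • z) :=
    ⟨_, (isGeodesic_hyperbola hp hq hwp hzq hw hz k).1, by simp,
      (isGeodesic_hyperbola hp hq hwp hzq hw hz k).2⟩
  rw [expMap, dif_pos hex]
  obtain ⟨⟨hs, hH, hg⟩, h0, h0'⟩ := hex.choose_spec
  set γ := hex.choose
  have d1 : ∀ σ, HasDerivAt γ (deriv γ σ) σ := fun σ =>
    (hs.differentiable (by simp) σ).hasDerivAt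
  have hs' : ContDiff ℝ ∞ (deriv γ) := (contDiff_infty_iff_deriv.1 hs).2
  have d2 : ∀ σ, HasDerivAt (deriv γ) (deriv (deriv γ) σ) σ := fun σ =>
    (hs'.differentiable (by simp) σ).hasDerivAt
  have f1 := hyperbola_of_geodesic (k := k) (w := w) (a := fun σ => (γ σ).1) (fun σ => (d1 σ).fst)
    (fun σ => (d2 σ).fst) (fun σ => (hH σ).1.1) (fun σ => congrArg Prod.fst (hg σ))
    (by rw [h0']) hw 1
  have f2 := hyperbola_of_geodesic (k := k) (w := z) (a := fun σ => (γ σ).2) (fun σ => (d1 σ).snd)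
    (fun σ => (d2 σ).snd) (fun σ => (hH σ).2.1) (fun σ => congrArg Prod.snd (hg σ))
    (by rw [h0']) hz 1
  simp only [h0, mul_one] at f1 f2
  exact Prod.ext f1 f2

/-! ### Parallel displacement -/

/-- The linear map that agrees with parallel displacement at distance `r` on `Mt t`. -/
def parMap (r t : ℝ) : L6 →L[ℝ] L6 :=
  (Real.cosh (r / Real.sqrt 2) • ContinuousLinearMap.fst ℝ L3 L3 +
      (Real.sinh (r / Real.sqrt 2) / Real.sqrt (t ^ 2 - 1)) •
        (ContinuousLinearMap.snd ℝ L3 L3 - t • ContinuousLinearMap.fst ℝ L3 L3)).prod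
    (Real.cosh (r / Real.sqrt 2) • ContinuousLinearMap.snd ℝ L3 L3 +
      (Real.sinh (r / Real.sqrt 2) / Real.sqrt (t ^ 2 - 1)) •
        (ContinuousLinearMap.fst ℝ L3 L3 - t • ContinuousLinearMap.snd ℝ L3 L3))

theorem parMap_apply (r t : ℝ) (v : L6) : parMap r t v =
    (Real.cosh (r / Real.sqrt 2) • v.1 +
        (Real.sinh (r / Real.sqrt 2) / Real.sqrt (t ^ 2 - 1)) • (v.2 - t • v.1),
      Real.cosh (r / Real.sqrt 2) • v.2 +
        (Real.sinh (r / Real.sqrt 2) / Real.sqrt (t ^ 2 - 1)) • (v.1 - t • v.2)) := rfl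

theorem parallel_eq {t : ℝ} (ht : 1 < t) (r : ℝ) {x : L6} (hx : x ∈ Mt t) :
    parallel (Nt t) r x = parMap r t x := by
  have ht' := t_sq_sub_one_pos ht
  have hS : Real.sqrt (t ^ 2 - 1) ≠ 0 := (Real.sqrt_pos.2 ht').ne'
  have hS2 : Real.sqrt (t ^ 2 - 1) ^ 2 = t ^ 2 - 1 := Real.sq_sqrt ht'.le
  have h1 := hx.1.1.1
  have h2 := hx.1.2.1
  have h3 := hx.2
  have h4 := lor_swap hx
  have key := expMap_eq (w := (Real.sqrt (t ^ 2 - 1))⁻¹ • (x.2 - t • x.1))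
    (z := (Real.sqrt (t ^ 2 - 1))⁻¹ • (x.1 - t • x.2)) hx.1.1 hx.1.2
    (by simp [h1, h4]) (by simp [h2, h3])
    (by simp only [lor_smul_left, lor_smul_right, lor_sub_left, lor_sub_right, h1, h2, h3, h4]
        field_simp
        rw [hS2]; ring)
    (by simp only [lor_smul_left, lor_smul_right, lor_sub_left, lor_sub_right, h1, h2, h3, h4]
        field_simp
        rw [hS2]; ring) (r / Real.sqrt 2)
  have hN : r • Nt t x = ((r / Real.sqrt 2) • (Real.sqrt (t ^ 2 - 1))⁻¹ • (x.2 - t • x.1),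
      (r / Real.sqrt 2) • (Real.sqrt (t ^ 2 - 1))⁻¹ • (x.1 - t • x.2)) := by
    rw [Nt_def, nFactor, Real.sqrt_mul (by norm_num), mul_inv]
    refine Prod.ext ?_ ?_ <;> simp only [Prod.smul_fst, Prod.smul_snd, smul_smul, div_eq_mul_inv] <;>
      congr 1 <;> ring
  rw [parallel, hN, parMap_apply]
  refine key.trans ?_
  simp only [smul_smul, div_eq_mul_inv]

/-- The pair of points at signed distance `a` from `m` in the directions `w` and `-w`. -/
def pairOf (a : ℝ) (m w : L3) : L6 :=
  (Real.cosh a • m + Real.sinh a • w, Real.cosh a • m - Real.sinh a • w)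

theorem pairOf_mem (a : ℝ) {m w : L3} (hm : m ∈ H2) (hwm : lor w m = 0) (hw : lor w w = 1) :
    pairOf a m w ∈ Mt (Real.cosh (2 * a)) := by
  refine ⟨⟨hyperbola_mem hm hwm hw a, ?_⟩, ?_⟩
  · have := hyperbola_mem hm (w := -w) (by simp [hwm]) (by simp [hw]) a
    rwa [smul_neg, ← sub_eq_add_neg] at this
  · simp only [pairOf, lor_add_left, lor_sub_right, lor_smul_left, lor_smul_right, hm.1, hw, hwm,
      lor_comm m w, Real.cosh_two_mul]
    ring

theorem exists_unit_tangent {m : L3} (hm : m ∈ H2) : ∃ w, lor w m = 0 ∧ lor w w = 1 := by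
  have h0 : 1 + m 0 ≠ 0 := by linarith [hm.2]
  have h1 := hm.1
  simp only [lor] at h1
  -- The image of the first spatial basis vector under the Lorentz boost that takes `(1, 0, 0)` to
  -- `m`.
  refine ⟨![m 1, 1 + m 1 ^ 2 / (1 + m 0), m 1 * m 2 / (1 + m 0)], ?_, ?_⟩ <;>
    simp only [lor, Matrix.cons_val_zero, Matrix.cons_val_one, Matrix.cons_val] <;> field_simp
  · linear_combination m 1 * h1
  · linear_combination m 1 ^ 2 * h1

/-- The vectors `m` and `w` are the normalized sum and difference of the two points. For `a = 0` the
points coincide and any unit tangent serves; this case covers the image of parallel displacement at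
the focal distance. -/
theorem exists_pairOf {a : ℝ} {x : L6} (hx : x ∈ Mt (Real.cosh (2 * a))) :
    ∃ m w, m ∈ H2 ∧ lor w m = 0 ∧ lor w w = 1 ∧ x = pairOf a m w := by
  have h1 := hx.1.1.1
  have h2 := hx.1.2.1
  have h3 := hx.2
  have h4 := lor_swap hx
  have hc := Real.cosh_pos a
  have hc2 := Real.cosh_two_mul a
  have hc3 := Real.cosh_sq a
  by_cases ha : a = 0
  · subst ha
    rw [mul_zero, Real.cosh_zero] at h3
    obtain ⟨w, hw1, hw2⟩ := exists_unit_tangent hx.1.1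
    have e := eq_of_lor_eq_neg_one hx.1.1 hx.1.2 h3
    exact ⟨x.1, w, hx.1.1, hw1, hw2, Prod.ext (by simp [pairOf]) (by simp [pairOf, e])⟩
  · have hs : Real.sinh a ≠ 0 := fun h => ha (Real.sinh_eq_zero.1 h)
    refine ⟨(2 * Real.cosh a)⁻¹ • (x.1 + x.2), (2 * Real.sinh a)⁻¹ • (x.1 - x.2), ⟨?_, ?_⟩,
      ?_, ?_, ?_⟩
    · simp only [lor_smul_left, lor_smul_right, lor_add_left, lor_add_right, h1, h2, h3, h4, hc2]
      field_simp
      linear_combination (2 : ℝ) * hc3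
    · have := hx.1.1.2
      have := hx.1.2.2
      simp only [Pi.smul_apply, Pi.add_apply, smul_eq_mul]
      positivity
    · simp only [lor_smul_left, lor_smul_right, lor_add_right, lor_sub_left, h1, h2, h3, h4]
      ring
    · simp only [lor_smul_left, lor_smul_right, lor_sub_left, lor_sub_right, h1, h2, h3, h4, hc2]
      field_simp
      linear_combination (2 : ℝ) * hc3
    · refine Prod.ext ?_ ?_ <;>
      · ext i
        simp only [pairOf, Pi.add_apply, Pi.sub_apply, Pi.smul_apply, smul_eq_mul]
        field_simp
        ring

theorem cosh_half_arcosh {t : ℝ} (ht : 1 < t) :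
    Real.cosh (2 * (Real.arcosh t / 2)) = t ∧
      Real.sinh (2 * (Real.arcosh t / 2)) = Real.sqrt (t ^ 2 - 1) := by
  rw [mul_div_cancel₀ _ two_ne_zero, Real.cosh_arcosh ht.le, Real.sinh_arcosh ht.le]
  simp

theorem half_div_sqrt_two (r : ℝ) : r / Real.sqrt 2 = Real.sqrt 2 * r / 2 := by
  have h : Real.sqrt 2 ≠ 0 := by positivity
  have h2 : Real.sqrt 2 ^ 2 = 2 := Real.sq_sqrt (by norm_num)
  field_simp
  rw [h2]

theorem phi_eq {t : ℝ} (ht : 1 < t) (r : ℝ) :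
    phi r t = Real.cosh (Real.arcosh t - Real.sqrt 2 * r) := by
  rw [Real.cosh_sub, Real.cosh_arcosh ht.le, Real.sinh_arcosh ht.le, phi]

/-- The addition formulas alone give this, so nothing is assumed of `m` and `w`; `parMap_eq`
exploits that freedom. -/
theorem parMap_pairOf {t : ℝ} (ht : 1 < t) (r : ℝ) (m w : L3) :
    parMap r t (pairOf (Real.arcosh t / 2) m w) =
      pairOf ((Real.arcosh t - Real.sqrt 2 * r) / 2) m w := by
  obtain ⟨hc, hs⟩ := cosh_half_arcosh ht
  rw [parMap_apply, ← hs, half_div_sqrt_two, sub_div]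
  have hb : Real.sinh (Real.arcosh t / 2) ≠ 0 := by
    rw [Ne, Real.sinh_eq_zero]
    linarith [Real.arcosh_pos ht]
  set b := Real.arcosh t / 2
  set a := Real.sqrt 2 * r / 2
  have hcb := Real.cosh_pos b
  have hsq := Real.cosh_sq b
  rw [← hc]
  rw [Real.cosh_two_mul, Real.sinh_two_mul]
  refine Prod.ext ?_ ?_ <;> ext i <;>
    simp only [pairOf, Pi.add_apply, Pi.sub_apply, Pi.smul_apply, smul_eq_mul, Real.cosh_sub,
      Real.sinh_sub] <;> field_simp <;> rw [hsq]
  · linear_combination (2 * w i * Real.sinh a * Real.sinh b) * hsq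
  · linear_combination -(2 * w i * Real.sinh a * Real.sinh b) * hsq

theorem exists_pairOf_arcosh {t : ℝ} (ht : 1 < t) {x : L6} (hx : x ∈ Mt t) :
    ∃ m w, m ∈ H2 ∧ lor w m = 0 ∧ lor w w = 1 ∧ x = pairOf (Real.arcosh t / 2) m w :=
  exists_pairOf (by rwa [(cosh_half_arcosh ht).1])

theorem parMap_mem {t : ℝ} (ht : 1 < t) (r : ℝ) {x : L6} (hx : x ∈ Mt t) :
    parMap r t x ∈ Mt (phi r t) := by
  obtain ⟨m, w, hm, hwm, hw, rfl⟩ := exists_pairOf_arcosh ht hx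
  rw [parMap_pairOf ht, phi_eq ht]
  have := pairOf_mem ((Real.arcosh t - Real.sqrt 2 * r) / 2) hm hwm hw
  rwa [mul_div_cancel₀ _ two_ne_zero] at this

theorem parMap_image {t : ℝ} (ht : 1 < t) (r : ℝ) : parMap r t '' Mt t = Mt (phi r t) := by
  refine Subset.antisymm (image_subset_iff.2 fun x hx => parMap_mem ht r hx) fun y hy => ?_
  rw [phi_eq ht, ← mul_div_cancel₀ (Real.arcosh t - Real.sqrt 2 * r) (two_ne_zero (α := ℝ))] at hy
  obtain ⟨m, w, hm, hwm, hw, rfl⟩ := exists_pairOf hy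
  refine ⟨pairOf (Real.arcosh t / 2) m w, ?_, parMap_pairOf ht r m w⟩
  have := pairOf_mem (Real.arcosh t / 2) hm hwm hw
  rwa [(cosh_half_arcosh ht).1] at this

theorem parallel_image {t : ℝ} (ht : 1 < t) (r : ℝ) :
    parallel (Nt t) r '' Mt t = Mt (phi r t) := by
  rw [← parMap_image ht]
  exact image_congr fun x hx => parallel_eq ht r hx

/-! ### Maps that agree on the hypersurface -/

section congr

variable {M : Set L6} {F F' ν ν' : L6 → L6} {x : L6}

theorem dM_congr (h : EqOn F F' M) (hx : x ∈ M) : dM M F x = dM M F' x := by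
  rw [dM, dM, fderivWithin_congr h (h hx)]

theorem IsImmersion.congr (hF : IsImmersion M F) (h : EqOn F' F M) : IsImmersion M F' :=
  ⟨hF.1.congr h, fun x hx => by rw [h hx]; exact hF.2.1 hx, fun x hx => by
    rw [dM_congr h hx]; exact hF.2.2 x hx⟩

theorem IsUnitNormal.congr (hν : IsUnitNormal M F ν) (h : EqOn F' F M) : IsUnitNormal M F' ν :=
  ⟨hν.1, fun x hx => by rw [dM_congr h hx, h hx]; exact hν.2 x hx⟩

theorem IsShapeOperator.congr {A : Module.End ℝ (TM M x)} (hA : IsShapeOperator M F ν x A)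
    (h : EqOn F' F M) (hx : x ∈ M) : IsShapeOperator M F' ν x A := fun v => by
  rw [dM_congr h hx, h hx]
  exact hA v

theorem HasMeanCurvature.congr {c : ℝ} (hc : HasMeanCurvature M F ν x c)
    (h : EqOn F' F M) (hx : x ∈ M) : HasMeanCurvature M F' ν x c := by
  obtain ⟨A, hA, h'⟩ := hc
  exact ⟨A, hA.congr h hx, h'⟩

end congr

/-! ### Immersions with image in some `Mt t'` -/

/-- The mean curvature of `Mt t`. -/
def curvMt (t : ℝ) : ℝ := Real.sqrt 2 * t / (3 * Real.sqrt (t ^ 2 - 1))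

theorem eq_smul_Nt {t : ℝ} (ht : 1 < t) {x v : L6} (hx : x ∈ Mt t) (hv : IsTangentHH x v)
    (h : ∀ w ∈ tanSpace x, ip w v = 0) : v = ip v (Nt t x) • Nt t x := by
  have hN := isTangentHH_Nt hx
  have hN1 := ip_Nt_self ht hx
  set z := v - ip v (Nt t x) • Nt t x with hz
  have hzt : IsTangentHH x z := hv.sub (hN.smul _)
  have hzN : ip z (Nt t x) = 0 := by
    rw [hz, ip_sub_left, ip_smul_left, hN1]
    ring
  have hzm : z ∈ tanSpace x := ⟨hzt, by
    rw [ip_Nt hzt] at hzN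
    exact (mul_eq_zero.1 hzN).resolve_left (nFactor_pos ht).ne'⟩
  have h0 : ip z z = 0 := by
    conv_lhs => arg 2; rw [hz]
    rw [ip_sub_right, ip_smul_right, hzN, h z hzm]
    ring
  exact sub_eq_zero.1 (eq_zero_of_ip_self hx.1 hzt h0)

variable {t t' : ℝ} {x : L6} {F ν : L6 → L6}

theorem dM_mem_TM (ht : 1 < t) (hF : ContDiffOn ℝ ∞ F (Mt t)) (hm : MapsTo F (Mt t) (Mt t'))
    (hx : x ∈ Mt t) (v : TM (Mt t) x) : dM (Mt t) F x v ∈ TM (Mt t') (F x) := by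
  have h := fderiv_mem_tangentCone (M := Mt t')
    ((ContDiffOn.comp_orbitMap hx hF).differentiable (by simp) 0)
    (fun z => hm (orbitMap_mem hx z)) v
  rw [fderiv_comp_orbitMap_zero ht hx hF, Function.comp_apply, orbitMap_zero] at h
  exact Submodule.subset_span h

theorem exists_equiv_dM (ht : 1 < t) (ht' : 1 < t') (hF : IsImmersion (Mt t) F)
    (hm : MapsTo F (Mt t) (Mt t')) (hx : x ∈ Mt t) :
    ∃ e : TM (Mt t) x ≃ₗ[ℝ] TM (Mt t') (F x), ∀ v, (e v : L6) = dM (Mt t) F x v := by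
  let f : TM (Mt t) x →ₗ[ℝ] TM (Mt t') (F x) :=
    (dM (Mt t) F x).codRestrict _ (dM_mem_TM ht hF.1 hm hx)
  have hf : Function.Injective f := fun v w h => hF.2.2 x hx (congrArg Subtype.val h)
  exact ⟨f.linearEquivOfInjective hf ((finrank_TM ht hx).trans (finrank_TM ht' (hm hx)).symm),
    fun v => rfl⟩

theorem isUnitNormal_comp (ht : 1 < t) (ht' : 1 < t') (hF : IsImmersion (Mt t) F)
    (hm : MapsTo F (Mt t) (Mt t')) : IsUnitNormal (Mt t) F (fun x => Nt t' (F x)) :=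
  ⟨(NtL t').contDiff.comp_contDiffOn hF.1, fun x hx =>
    ⟨isTangentHH_Nt (hm hx), ip_Nt_self ht' (hm hx), fun v => by
      have hv := (TM_Mt ht' (hm hx)).le (dM_mem_TM ht hF.1 hm hx v)
      rw [ip_Nt hv.1, hv.2, mul_zero]⟩⟩

/-- Equality of dimensions makes the differential of `F` an isomorphism onto the tangent space of
`Mt t'`. Conjugating `shapeMt` by it preserves traces. -/
theorem exists_shape_comp (ht : 1 < t) (ht' : 1 < t') (hF : IsImmersion (Mt t) F)
    (hm : MapsTo F (Mt t) (Mt t')) (hx : x ∈ Mt t) :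
    ∃ A : Module.End ℝ (TM (Mt t) x), IsShapeOperator (Mt t) F (fun x => Nt t' (F x)) x A ∧
      LinearMap.trace ℝ _ A = 3 * curvMt t' ∧
      LinearMap.trace ℝ _ (A * A) = (t' ^ 2 + 1) / (t' ^ 2 - 1) := by
  obtain ⟨e, he⟩ := exists_equiv_dM ht ht' hF hm hx
  refine ⟨e.symm.conj (shapeMt ht' (hm hx)), fun v => ?_, ?_, ?_⟩
  · rw [← he, LinearEquiv.conj_apply_apply, LinearEquiv.apply_symm_apply, LinearEquiv.symm_symm,
      coe_shapeMt, shapeFormula_eq ((TM_Mt ht' (hm hx)).le (e v).2), he]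
    have hd := (hF.1.differentiableOn (by simp) x hx).hasFDerivWithinAt
    have := dM_eq ((NtL t').hasFDerivAt.comp_hasFDerivWithinAt x hd) v
    rw [show dM (Mt t) (fun x => Nt t' (F x)) x v = Nt t' (dM (Mt t) F x v) from this]
  · rw [LinearMap.trace_conj', trace_shapeMt, curvMt, ← curvature_eq]
    ring
  · have : e.symm.conj (shapeMt ht' (hm hx)) * e.symm.conj (shapeMt ht' (hm hx)) =
        e.symm.conj (shapeMt ht' (hm hx) * shapeMt ht' (hm hx)) := by
      simp only [Module.End.mul_eq_comp, LinearEquiv.conj_comp]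
    rw [this, LinearMap.trace_conj', trace_shapeMt_sq]

theorem normal_eq_smul (ht : 1 < t) (ht' : 1 < t') (hF : IsImmersion (Mt t) F)
    (hm : MapsTo F (Mt t) (Mt t')) (hν : IsUnitNormal (Mt t) F ν) (hx : x ∈ Mt t) :
    ∃ c : ℝ, c ^ 2 = 1 ∧ ν x = c • Nt t' (F x) := by
  obtain ⟨e, he⟩ := exists_equiv_dM ht ht' hF hm hx
  obtain ⟨h1, h2, h3⟩ := hν.2 x hx
  have h4 := eq_smul_Nt ht' (hm hx) h1 fun w hw => by
    have := h3 (e.symm ⟨w, (TM_Mt ht' (hm hx)).ge hw⟩)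
    rwa [← he, LinearEquiv.apply_symm_apply] at this
  refine ⟨_, ?_, h4⟩
  rw [h4, ip_smul_left, ip_smul_right, ip_Nt_self ht' (hm hx)] at h2
  linear_combination h2

/-- The mean curvature vector of an immersion with image in `Mt t'`. -/
theorem meanCurvature_smul (ht : 1 < t) (ht' : 1 < t') (hF : IsImmersion (Mt t) F)
    (hm : MapsTo F (Mt t) (Mt t')) (hν : IsUnitNormal (Mt t) F ν) (hx : x ∈ Mt t) {h : ℝ}
    (hh : HasMeanCurvature (Mt t) F ν x h) : h • ν x = curvMt t' • Nt t' (F x) := by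
  obtain ⟨c, hc, hcν⟩ := normal_eq_smul ht ht' hF hm hν hx
  obtain ⟨A, hA, htr, -⟩ := exists_shape_comp ht ht' hF hm hx
  obtain ⟨A', hA', rfl⟩ := hh
  rw [shape_eq_smul ht hF (isUnitNormal_comp ht ht' hF hm) hν hx hA hA' hcν, map_smul, htr, hcν,
    smul_smul]
  congr 1
  rw [smul_eq_mul]
  linear_combination curvMt t' * hc

theorem trace_shape_sq (ht : 1 < t) (ht' : 1 < t') (hF : IsImmersion (Mt t) F)
    (hm : MapsTo F (Mt t) (Mt t')) (hν : IsUnitNormal (Mt t) F ν) (hx : x ∈ Mt t)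
    {A : Module.End ℝ (TM (Mt t) x)} (hA : IsShapeOperator (Mt t) F ν x A) :
    LinearMap.trace ℝ _ (A * A) = (t' ^ 2 + 1) / (t' ^ 2 - 1) := by
  obtain ⟨c, hc, hcν⟩ := normal_eq_smul ht ht' hF hm hν hx
  obtain ⟨A', hA', -, htr⟩ := exists_shape_comp ht ht' hF hm hx
  rw [shape_eq_smul ht hF (isUnitNormal_comp ht ht' hF hm) hν hx hA' hA hcν, smul_mul_smul_comm,
    map_smul, htr, ← sq, hc, one_smul]

theorem hasMeanCurvature_comp (ht : 1 < t) (ht' : 1 < t') (hF : IsImmersion (Mt t) F)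
    (hm : MapsTo F (Mt t) (Mt t')) (hx : x ∈ Mt t) :
    HasMeanCurvature (Mt t) F (fun x => Nt t' (F x)) x (curvMt t') := by
  obtain ⟨A, hA, htr, -⟩ := exists_shape_comp ht ht' hF hm hx
  exact ⟨A, hA, by rw [htr]; ring⟩

/-! ### Parallel displacement as an immersion -/

/-- The factor by which parallel displacement stretches `p + q`. -/
def plusFactor (r t : ℝ) : ℝ :=
  Real.cosh ((Real.arcosh t - Real.sqrt 2 * r) / 2) / Real.cosh (Real.arcosh t / 2)

/-- The factor by which parallel displacement stretches `p - q`. -/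
def minusFactor (r t : ℝ) : ℝ :=
  Real.sinh ((Real.arcosh t - Real.sqrt 2 * r) / 2) / Real.sinh (Real.arcosh t / 2)

theorem sinh_half_arcosh_pos (ht : 1 < t) : 0 < Real.sinh (Real.arcosh t / 2) :=
  Real.sinh_pos_iff.2 (half_pos (Real.arcosh_pos ht))

/-- Any pair of vectors is a `pairOf` with unnormalized `m` and `w`, so `parMap_pairOf` diagonalizes
the linear map on sums and differences. -/
theorem parMap_eq (ht : 1 < t) (r : ℝ) (v : L6) : parMap r t v =
    ((2⁻¹ * plusFactor r t) • (v.1 + v.2) + (2⁻¹ * minusFactor r t) • (v.1 - v.2),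
      (2⁻¹ * plusFactor r t) • (v.1 + v.2) - (2⁻¹ * minusFactor r t) • (v.1 - v.2)) := by
  have hc := Real.cosh_pos (Real.arcosh t / 2)
  have hs := sinh_half_arcosh_pos ht
  have e := parMap_pairOf ht r ((2 * Real.cosh (Real.arcosh t / 2))⁻¹ • (v.1 + v.2))
    ((2 * Real.sinh (Real.arcosh t / 2))⁻¹ • (v.1 - v.2))
  have e1 : pairOf (Real.arcosh t / 2) ((2 * Real.cosh (Real.arcosh t / 2))⁻¹ • (v.1 + v.2))
      ((2 * Real.sinh (Real.arcosh t / 2))⁻¹ • (v.1 - v.2)) = v := by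
    refine Prod.ext ?_ ?_ <;>
    · ext i
      simp only [pairOf, Pi.add_apply, Pi.sub_apply, Pi.smul_apply, smul_eq_mul]
      field_simp
      ring
  rw [e1] at e
  rw [e]
  simp only [pairOf, smul_smul, plusFactor, minusFactor, div_eq_mul_inv, mul_inv]
  refine Prod.ext ?_ ?_ <;> (dsimp only; congr 2 <;> ring)

theorem one_lt_phi_iff (ht : 1 < t) (r : ℝ) :
    1 < phi r t ↔ Real.sqrt 2 * r ≠ Real.arcosh t := by
  rw [phi_eq ht, Real.one_lt_cosh, sub_ne_zero, ne_comm]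

theorem isImmersion_parMap (ht : 1 < t) {r : ℝ} (hr : 1 < phi r t) :
    IsImmersion (Mt t) (parMap r t) := by
  refine ⟨(parMap r t).contDiff.contDiffOn, fun x hx => (parMap_mem ht r hx).1, fun x hx => ?_⟩
  have hd : ∀ v, dM (Mt t) (parMap r t) x v = parMap r t v := fun v =>
    dM_eq (parMap r t).hasFDerivWithinAt v
  have hm : minusFactor r t ≠ 0 := by
    refine div_ne_zero ?_ (sinh_half_arcosh_pos ht).ne'
    rw [Ne, Real.sinh_eq_zero]
    intro h
    exact (one_lt_phi_iff ht r).1 hr (by linarith)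
  have hp : plusFactor r t ≠ 0 := (div_pos (Real.cosh_pos _) (Real.cosh_pos _)).ne'
  refine (injective_iff_map_eq_zero _).2 fun v hv => ?_
  rw [hd, parMap_eq ht] at hv
  have h1 := congrArg Prod.fst hv
  have h2 := congrArg Prod.snd hv
  simp only [Prod.fst_zero, Prod.snd_zero] at h1 h2
  have h3 : plusFactor r t • ((v : L6).1 + (v : L6).2) = 0 := by
    have := congrArg₂ (· + ·) h1 h2
    rw [add_zero] at this
    rw [← this]
    module
  have h4 : minusFactor r t • ((v : L6).1 - (v : L6).2) = 0 := by
    have := congrArg₂ (· - ·) h1 h2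
    rw [sub_zero] at this
    rw [← this]
    module
  have h5 := (smul_eq_zero.1 h3).resolve_left hp
  have h6 := (smul_eq_zero.1 h4).resolve_left hm
  have e : ((v : L6).1 : L3) = (v : L6).2 := sub_eq_zero.1 h6
  rw [e, ← two_smul ℝ, smul_eq_zero] at h5
  have h7 := h5.resolve_left two_ne_zero
  exact Subtype.ext (Prod.ext (e.trans h7) h7)

/-- At the focal distance `minusFactor` vanishes and the principal direction `(p × q, -(p × q))` is
collapsed. -/
theorem one_lt_phi_of_isImmersion (ht : 1 < t) {r : ℝ} (h : IsImmersion (Mt t) (parMap r t)) :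
    1 < phi r t := by
  rw [one_lt_phi_iff ht]
  intro hr
  obtain ⟨x, hx⟩ := Mt_nonempty ht
  have hd : ∀ v, dM (Mt t) (parMap r t) x v = parMap r t v := fun v =>
    dM_eq (parMap r t).hasFDerivWithinAt v
  have h0 : minusFactor r t = 0 := by simp [minusFactor, hr]
  have : principalBasis ht hx 0 = 0 := h.2.2 x hx (by
    rw [(dM (Mt t) (parMap r t) x).map_zero, hd, principalBasis_apply, parMap_eq ht, h0]
    simp [principalVec])
  exact (principalBasis ht hx).ne_zero 0 this

theorem hasDerivAt_pairOf (m w : L3) (a : ℝ) : HasDerivAt (fun a => pairOf a m w)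
    (Real.sinh a • m + Real.cosh a • w, Real.sinh a • m - Real.cosh a • w) a :=
  (((Real.hasDerivAt_cosh a).smul_const m).add ((Real.hasDerivAt_sinh a).smul_const w)).prodMk
    (((Real.hasDerivAt_cosh a).smul_const m).sub ((Real.hasDerivAt_sinh a).smul_const w))

theorem Nt_pairOf {a : ℝ} (ha : 0 < a) (m w : L3) : Nt (Real.cosh (2 * a)) (pairOf a m w) =
    -(Real.sqrt 2)⁻¹ • (Real.sinh a • m + Real.cosh a • w, Real.sinh a • m - Real.cosh a • w) := by
  have hs : 0 < Real.sinh (2 * a) := Real.sinh_pos_iff.2 (by linarith)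
  have h1 : Real.sqrt (Real.cosh (2 * a) ^ 2 - 1) = Real.sinh (2 * a) := by
    rw [Real.cosh_sq, add_sub_cancel_right, Real.sqrt_sq hs.le]
  have hs' : 0 < Real.sinh a := Real.sinh_pos_iff.2 ha
  have hc := Real.cosh_pos a
  have hsq := Real.cosh_sq a
  rw [Nt_def, nFactor, Real.sqrt_mul (by norm_num), h1, Real.sinh_two_mul, Real.cosh_two_mul]
  have h2 : Real.sqrt 2 ≠ 0 := by positivity
  refine Prod.ext ?_ ?_ <;> ext i <;>
    simp only [pairOf, Prod.smul_fst, Prod.smul_snd, Pi.add_apply, Pi.sub_apply, Pi.smul_apply,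
      smul_eq_mul] <;> field_simp
  · linear_combination (-Real.cosh a * m i + Real.sinh a * w i) * hsq
  · linear_combination (-Real.cosh a * m i - Real.sinh a * w i) * hsq

/-- Parallel displacement moves each point with velocity the unit normal field. -/
theorem hasDerivAt_parMap (ht : 1 < t) {r : ℝ} (hr : Real.sqrt 2 * r < Real.arcosh t)
    (hx : x ∈ Mt t) :
    HasDerivAt (fun r => parMap r t x) (Nt (phi r t) (parMap r t x)) r := by
  obtain ⟨m, w, hm, hwm, hw, rfl⟩ := exists_pairOf_arcosh ht hx
  have e : (fun r => parMap r t (pairOf (Real.arcosh t / 2) m w)) =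
      fun r => pairOf ((Real.arcosh t - Real.sqrt 2 * r) / 2) m w := by
    funext r
    rw [parMap_pairOf ht]
  rw [e, parMap_pairOf ht, phi_eq ht]
  have ha : 0 < (Real.arcosh t - Real.sqrt 2 * r) / 2 := by linarith
  have h1 := Nt_pairOf ha m w
  rw [mul_div_cancel₀ _ two_ne_zero] at h1
  rw [h1]
  have h2 : HasDerivAt (fun r => (Real.arcosh t - Real.sqrt 2 * r) / 2) (-(Real.sqrt 2)⁻¹) r := by
    have := (((hasDerivAt_id r).const_mul (Real.sqrt 2)).const_sub (Real.arcosh t)).div_const 2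
    refine this.congr_deriv ?_
    have h2 : Real.sqrt 2 ≠ 0 := by positivity
    have h3 : Real.sqrt 2 ^ 2 = 2 := Real.sq_sqrt (by norm_num)
    field_simp
    rw [h3]
  exact (hasDerivAt_pairOf m w _).scomp r h2

theorem isIsoparametric_Mt (ht : 1 < t) : IsIsoparametric (Mt t) (Nt t) := by
  -- The focal distance, the only `r` at which `parMap` fails to be an immersion.
  refine ⟨isHypersurface_Mt ht, isUnitNormal_Nt ht, Real.arcosh t / Real.sqrt 2,
    div_pos (Real.arcosh_pos ht) (by positivity), fun r hr => ?_⟩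
  have he : EqOn (parallel (Nt t) r) (parMap r t) (Mt t) := fun x hx => parallel_eq ht r hx
  have hr' : 1 < phi r t := by
    rw [one_lt_phi_iff ht]
    rw [lt_div_iff₀ (by positivity), mul_comm] at hr
    refine (lt_of_le_of_lt ?_ hr).ne
    exact mul_le_mul_of_nonneg_left (le_abs_self r) (Real.sqrt_nonneg 2)
  have hI := isImmersion_parMap ht hr'
  have hm : MapsTo (parMap r t) (Mt t) (Mt (phi r t)) := fun x hx => parMap_mem ht r hx
  exact ⟨hI.congr he, _, (isUnitNormal_comp ht hr' hI hm).congr he, curvMt (phi r t),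
    fun x hx => (hasMeanCurvature_comp ht hr' hI hm hx).congr he hx⟩

/-! ### The initial value problem -/

theorem eq_of_hasDerivWithinAt_zero {E : Type*} [NormedAddCommGroup E] [NormedSpace ℝ E] {T : ℝ}
    {f : ℝ → E} (h : ∀ τ ∈ Ico 0 T, HasDerivWithinAt f 0 (Ico 0 T) τ) {τ : ℝ} (hτ : τ ∈ Ico 0 T) :
    f τ = f 0 := by
  have h0 : (0 : ℝ) ∈ Ico 0 T := ⟨le_rfl, hτ.1.trans_lt hτ.2⟩
  have hu : UniqueDiffOn ℝ (Ico (0 : ℝ) T) := uniqueDiffOn_Ico 0 T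
  refine (convex_Ico 0 T).is_const_of_fderivWithin_eq_zero (𝕜 := ℝ)
    (fun σ hσ => (h σ hσ).differentiableWithinAt) (fun σ hσ => ?_) hτ h0
  rw [(h σ hσ).hasFDerivWithinAt.fderivWithin (hu σ hσ)]
  ext
  simp

/-- `s e^{-2τ/3}`: the value of `-⟨p, q⟩` at time `τ` along the flow. -/
def uSol (s τ : ℝ) : ℝ := s * Real.exp (-(2 / 3) * τ)

/-- The explicit solution of the initial value problem. -/
def epsSol (s τ : ℝ) : ℝ := (Real.sqrt 2)⁻¹ * (Real.arcosh s - Real.arcosh (uSol s τ))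

variable {s T : ℝ} {ε : ℝ → ℝ}

theorem hasDerivAt_uSol (s τ : ℝ) : HasDerivAt (uSol s) (-(2 / 3) * uSol s τ) τ := by
  have := ((((hasDerivAt_id τ).const_mul (-(2 / 3))).exp).const_mul s)
  exact this.congr_deriv (by simp [uSol]; ring)

theorem uSol_zero (s : ℝ) : uSol s 0 = s := by simp [uSol]

theorem uSol_pos (hs : 1 < s) (τ : ℝ) : 0 < uSol s τ :=
  mul_pos (by linarith) (Real.exp_pos _)

theorem uSol_antitone (hs : 1 < s) {τ τ' : ℝ} (h : τ ≤ τ') : uSol s τ' ≤ uSol s τ :=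
  mul_le_mul_of_nonneg_left (Real.exp_le_exp.2 (by linarith)) (by linarith)

theorem contDiff_uSol (s : ℝ) : ContDiff ℝ ∞ (uSol s) :=
  contDiff_const.mul (Real.contDiff_exp.comp (contDiff_const.mul contDiff_id))

/-- The condition `1 < phi` only says that `ε` avoids the focal distance; starting from `0`,
continuity keeps it on the near side. -/
theorem lt_arcosh_of_continuousOn (hs : 1 < s) (hc : ContinuousOn ε (Ico 0 T)) (h0 : ε 0 = 0)
    (h : ∀ τ ∈ Ico 0 T, 1 < phi (ε τ) s) {τ : ℝ} (hτ : τ ∈ Ico 0 T) :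
    Real.sqrt 2 * ε τ < Real.arcosh s := by
  by_contra! hle
  have hsub : Icc 0 τ ⊆ Ico 0 T := fun σ hσ => ⟨hσ.1, hσ.2.trans_lt hτ.2⟩
  have hc' : ContinuousOn (fun σ => Real.sqrt 2 * ε σ) (Icc 0 τ) :=
    continuousOn_const.mul (hc.mono hsub)
  obtain ⟨σ, hσ, he⟩ := intermediate_value_Icc hτ.1 hc'
    (show Real.arcosh s ∈ Icc _ _ from ⟨by simpa [h0] using (Real.arcosh_pos hs).le, hle⟩)
  exact (one_lt_phi_iff hs _).1 (h σ (hsub hσ)) he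

theorem sqrt_phi (hs : 1 < s) {r : ℝ} (hr : Real.sqrt 2 * r < Real.arcosh s) :
    Real.sqrt (phi r s ^ 2 - 1) = Real.sinh (Real.arcosh s - Real.sqrt 2 * r) := by
  rw [phi_eq hs, Real.cosh_sq, add_sub_cancel_right,
    Real.sqrt_sq (Real.sinh_pos_iff.2 (by linarith)).le]

theorem SolvesODE.lt_arcosh (hs : 1 < s) (h : SolvesODE s T ε) {τ : ℝ} (hτ : τ ∈ Ico 0 T) :
    Real.sqrt 2 * ε τ < Real.arcosh s :=
  lt_arcosh_of_continuousOn hs (fun σ hσ => (h.2 σ hσ).2.continuousWithinAt) h.1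
    (fun σ hσ => (h.2 σ hσ).1) hτ

/-- Since `phi = cosh (arcosh s - √2 ε)`, the chain rule produces a hyperbolic sine that cancels the
square root in `ε'`, leaving the linear equation `u' = -(2/3) u`. -/
theorem SolvesODE.phi_eq (hs : 1 < s) (h : SolvesODE s T ε) {τ : ℝ} (hτ : τ ∈ Ico 0 T) :
    phi (ε τ) s = uSol s τ := by
  have hd : ∀ σ ∈ Ico 0 T, HasDerivWithinAt (fun σ => phi (ε σ) s) (-(2 / 3) * phi (ε σ) s)
      (Ico 0 T) σ := fun σ hσ => by
    have hlt := h.lt_arcosh hs hσ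
    have h1 := (((h.2 σ hσ).2.const_mul (Real.sqrt 2)).const_sub (Real.arcosh s)).cosh
    have e : (fun σ => phi (ε σ) s) = fun σ => Real.cosh (Real.arcosh s - Real.sqrt 2 * ε σ) :=
      funext fun σ => HHFlow.phi_eq hs _
    rw [e]
    refine h1.congr_deriv ?_
    have hsh : 0 < Real.sinh (Real.arcosh s - Real.sqrt 2 * ε σ) :=
      Real.sinh_pos_iff.2 (by linarith)
    rw [sqrt_phi hs hlt]
    have h2 : Real.sqrt 2 ^ 2 = 2 := Real.sq_sqrt (by norm_num)
    field_simp
    rw [h2]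
    ring
  have hz : ∀ σ ∈ Ico 0 T, HasDerivWithinAt (fun σ => Real.exp (2 / 3 * σ) * phi (ε σ) s) 0
      (Ico 0 T) σ := fun σ hσ => by
    have h1 := ((((hasDerivAt_id σ).const_mul (2 / 3)).exp).hasDerivWithinAt (s := Ico 0 T)).mul
      (hd σ hσ)
    exact h1.congr_deriv (by simp; ring)
  have := eq_of_hasDerivWithinAt_zero hz hτ
  rw [h.1, HHFlow.phi_eq hs 0, mul_zero, Real.exp_zero, mul_zero, sub_zero,
    Real.cosh_arcosh hs.le, one_mul] at this
  calc phi (ε τ) s = Real.exp (-(2 / 3) * τ) * (Real.exp (2 / 3 * τ) * phi (ε τ) s) := by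
        rw [← mul_assoc, ← Real.exp_add]
        simp
    _ = uSol s τ := by rw [this, uSol, mul_comm]

theorem SolvesODE.eq_epsSol (hs : 1 < s) (h : SolvesODE s T ε) {τ : ℝ} (hτ : τ ∈ Ico 0 T) :
    ε τ = epsSol s τ := by
  have h1 := h.phi_eq hs hτ
  have h2 := h.lt_arcosh hs hτ
  rw [epsSol, ← h1, HHFlow.phi_eq hs, Real.arcosh_cosh (by linarith), sub_sub_cancel,
    inv_mul_cancel_left₀ (by positivity)]

theorem sqrt_two_mul_epsSol (s τ : ℝ) :
    Real.sqrt 2 * epsSol s τ = Real.arcosh s - Real.arcosh (uSol s τ) := by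
  rw [epsSol, mul_inv_cancel_left₀ (by positivity)]

theorem phi_epsSol (hs : 1 < s) {τ : ℝ} (h : 1 < uSol s τ) : phi (epsSol s τ) s = uSol s τ := by
  rw [HHFlow.phi_eq hs, sqrt_two_mul_epsSol, sub_sub_cancel, Real.cosh_arcosh h.le]

theorem solvesODE_epsSol (hs : 1 < s) (hT : ∀ τ ∈ Ico 0 T, 1 < uSol s τ) :
    SolvesODE s T (epsSol s) := by
  refine ⟨by simp [epsSol, uSol_zero], fun τ hτ => ?_⟩
  have hu := hT τ hτ
  rw [phi_epsSol hs hu]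
  refine ⟨hu, HasDerivAt.hasDerivWithinAt ?_⟩
  have h1 := (((Real.hasDerivAt_arcosh hu).comp τ (hasDerivAt_uSol s τ)).const_sub
    (Real.arcosh s)).const_mul (Real.sqrt 2)⁻¹
  refine h1.congr_deriv ?_
  have h3 : 0 < Real.sqrt (uSol s τ ^ 2 - 1) := Real.sqrt_pos.2 (by nlinarith)
  have h2 : Real.sqrt 2 ^ 2 = 2 := Real.sq_sqrt (by norm_num)
  field_simp
  rw [h2]

theorem exists_solvesODE (hs : 1 < s) : ∃ T > 0, ∃ ε, SolvesODE s T ε := by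
  -- The maximal time is `(3/2) log s`, when `uSol` reaches `1`; a shorter interval suffices for
  -- local existence.
  refine ⟨Real.log s, Real.log_pos hs, epsSol s, solvesODE_epsSol hs fun τ hτ => ?_⟩
  rw [uSol, ← Real.exp_log (show 0 < s by linarith), ← Real.exp_add, Real.one_lt_exp_iff]
  have := Real.log_pos hs
  linarith [hτ.2]

theorem solvesODE_unique (hs : 1 < s) {ε₁ ε₂ : ℝ → ℝ} (h₁ : SolvesODE s T ε₁)
    (h₂ : SolvesODE s T ε₂) : EqOn ε₁ ε₂ (Ico 0 T) := fun τ hτ => by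
  rw [h₁.eq_epsSol hs hτ, h₂.eq_epsSol hs hτ]

theorem SolvesODE.one_lt_uSol (hs : 1 < s) (h : SolvesODE s T ε) {τ : ℝ} (hτ : τ ∈ Ico 0 T) :
    1 < uSol s τ := by
  rw [← h.phi_eq hs hτ]
  exact (h.2 τ hτ).1

/-! ### Reparametrized parallel flows -/

theorem IsMCF.congr {M : Set L6} {F F' : L6 → ℝ → L6} (h : IsMCF M T F)
    (hT : 0 < T) (he : ∀ x ∈ M, ∀ τ ∈ Ico 0 T, F' x τ = F x τ) : IsMCF M T F' := by
  obtain ⟨h1, h2, h3, ν, H, h4, h5⟩ := h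
  refine ⟨h1.congr fun z hz => he _ hz.1 _ hz.2, fun x hx => ?_, fun τ hτ => ?_, ν, H, h4,
    fun τ hτ => ⟨?_, fun x hx => ⟨?_, ?_⟩⟩⟩
  · rw [he x hx 0 ⟨le_rfl, hT⟩, h2 x hx]
  · exact (h3 τ hτ).congr fun x hx => he x hx τ hτ
  · exact (h5 τ hτ).1.congr fun x hx => he x hx τ hτ
  · exact ((h5 τ hτ).2 x hx).1.congr (fun x hx => he x hx τ hτ) hx
  · exact ((h5 τ hτ).2 x hx).2.congr (fun σ hσ => he x hx σ hσ) (he x hx τ hτ)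

theorem contDiff_parMap (s : ℝ) : ContDiff ℝ ∞ (fun z : L6 × ℝ => parMap z.2 s z.1) := by
  have hr : ContDiff ℝ ∞ (fun z : L6 × ℝ => z.2 / Real.sqrt 2) := contDiff_snd.div_const _
  have hc := Real.contDiff_cosh.comp hr
  have hs := (Real.contDiff_sinh.comp hr).div_const (Real.sqrt (s ^ 2 - 1))
  have h1 : ContDiff ℝ ∞ (fun z : L6 × ℝ => z.1.1) := contDiff_fst.comp contDiff_fst
  have h2 : ContDiff ℝ ∞ (fun z : L6 × ℝ => z.1.2) := contDiff_snd.comp contDiff_fst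
  exact ((hc.smul h1).add (hs.smul (h2.sub ((contDiff_const (c := s)).smul h1)))).prodMk
    ((hc.smul h2).add (hs.smul (h1.sub ((contDiff_const (c := s)).smul h2))))

theorem contDiffOn_epsSol (s : ℝ) {S : Set ℝ} (hS : ∀ τ ∈ S, 1 < uSol s τ) :
    ContDiffOn ℝ ∞ (epsSol s) S :=
  contDiffOn_const.mul (contDiffOn_const.sub
    (Real.contDiffOn_arcosh.comp (contDiff_uSol s).contDiffOn hS))

theorem contDiffOn_Nt {E : Type*} [NormedAddCommGroup E] [NormedSpace ℝ E] {S : Set E}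
    {u : E → ℝ} {F : E → L6} (hu : ContDiffOn ℝ ∞ u S) (h1 : ∀ z ∈ S, 1 < u z)
    (hF : ContDiffOn ℝ ∞ F S) : ContDiffOn ℝ ∞ (fun z => Nt (u z) (F z)) S := by
  have hn : ContDiffOn ℝ ∞ (fun z => nFactor (u z)) S := by
    have h2 : ∀ z ∈ S, 0 < 2 * (u z ^ 2 - 1) := fun z hz => by
      linarith [t_sq_sub_one_pos (h1 z hz)]
    exact ((contDiffOn_const.mul ((hu.pow 2).sub contDiffOn_const)).sqrt
      fun z hz => (h2 z hz).ne').inv fun z hz => (Real.sqrt_pos.2 (h2 z hz)).ne'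
  have hf := contDiff_fst.comp_contDiffOn hF
  have hs := contDiff_snd.comp_contDiffOn hF
  exact hn.smul ((hs.sub (hu.smul hf)).prodMk (hf.sub (hu.smul hs)))

theorem isMCF_parMap (hs : 1 < s) (h : SolvesODE s T ε) :
    IsMCF (Mt s) T (fun x τ => parMap (ε τ) s x) := by
  have hu : ∀ τ ∈ Ico 0 T, 1 < uSol s τ := fun τ hτ => h.one_lt_uSol hs hτ
  have hF : ContDiffOn ℝ ∞ (fun z : L6 × ℝ => parMap (ε z.2) s z.1) (Mt s ×ˢ Ico 0 T) := by
    -- A solution is only assumed once differentiable; smoothness comes from its agreement with the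
    -- explicit `epsSol`.
    have h1 := (contDiff_parMap s).comp_contDiffOn (s := Mt s ×ˢ Ico 0 T)
      (contDiffOn_fst.prodMk ((contDiffOn_epsSol s hu).comp contDiffOn_snd fun z hz => hz.2))
    refine h1.congr fun z hz => ?_
    simp only [Function.comp_apply]
    rw [h.eq_epsSol hs hz.2]
  have hI : ∀ τ ∈ Ico 0 T, IsImmersion (Mt s) (parMap (ε τ) s) := fun τ hτ =>
    isImmersion_parMap hs (h.2 τ hτ).1
  have hm : ∀ τ ∈ Ico 0 T, MapsTo (parMap (ε τ) s) (Mt s) (Mt (uSol s τ)) := fun τ hτ x hx => by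
    rw [← h.phi_eq hs hτ]
    exact parMap_mem hs _ hx
  refine ⟨hF, fun x hx => ?_, hI, fun x τ => Nt (uSol s τ) (parMap (ε τ) s x),
    fun x τ => curvMt (uSol s τ), ?_, fun τ hτ => ⟨isUnitNormal_comp hs (hu τ hτ) (hI τ hτ) (hm τ hτ),
      fun x hx => ⟨hasMeanCurvature_comp hs (hu τ hτ) (hI τ hτ) (hm τ hτ) hx, ?_⟩⟩⟩
  · change parMap (ε 0) s x = x
    rw [h.1, parMap_apply]
    simp
  · exact contDiffOn_Nt ((contDiff_uSol s).comp_contDiffOn contDiffOn_snd) (fun z hz => hu _ hz.2) hF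
  · have h1 := (hasDerivAt_parMap hs (h.lt_arcosh hs hτ) hx).scomp_hasDerivWithinAt τ (h.2 τ hτ).2
    rw [h.phi_eq hs hτ] at h1
    exact h1

/-- The displacement `r` can be recovered smoothly, through `arsinh`, from the displaced position.
This makes an arbitrary function `ε` differentiable as soon as the flow it defines is. -/
theorem lor_parMap (hs : 1 < s) {x : L6} (hx : x ∈ Mt s) (r : ℝ) :
    lor (parMap r s x).1 x.2 - s * lor (parMap r s x).1 x.1 =
      Real.sinh (r / Real.sqrt 2) * Real.sqrt (s ^ 2 - 1) := by
  have h := t_sq_sub_one_pos hs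
  have hS := Real.sqrt_pos.2 h
  have hS2 := Real.sq_sqrt h.le
  simp only [parMap_apply, lor_add_left, lor_smul_left, lor_sub_left, hx.1.1.1, hx.1.2.1, hx.2,
    lor_swap hx]
  field_simp
  rw [hS2]
  ring

theorem solvesODE_of_isMCF (hs : 1 < s)
    (h : IsMCF (Mt s) T (fun x τ => parMap (ε τ) s x)) : SolvesODE s T ε := by
  obtain ⟨-, h0, hI, ν, H, -, h5⟩ := h
  obtain ⟨x, hx⟩ := Mt_nonempty hs
  have hS := Real.sqrt_pos.2 (t_sq_sub_one_pos hs)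
  have hε : ∀ τ, ε τ = Real.arsinh ((Real.sqrt (s ^ 2 - 1))⁻¹ *
      (lor (parMap (ε τ) s x).1 x.2 - s * lor (parMap (ε τ) s x).1 x.1)) * Real.sqrt 2 := fun τ => by
    rw [lor_parMap hs hx, mul_comm (Real.sinh _), inv_mul_cancel_left₀ hS.ne', Real.arsinh_sinh,
      div_mul_cancel₀ _ (by positivity)]
  have hd : ∀ τ ∈ Ico 0 T, ∃ ε', HasDerivWithinAt ε ε' (Ico 0 T) τ := fun τ hτ => by
    have h1 : HasDerivWithinAt (fun σ => (parMap (ε σ) s x).1) (H x τ • ν x τ).1 (Ico 0 T) τ :=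
      ((h5 τ hτ).2 x hx).2.fst
    have h2 := (((h1.lor (hasDerivWithinAt_const τ _ x.2)).sub
      ((h1.lor (hasDerivWithinAt_const τ _ x.1)).const_mul s)).const_mul
        (Real.sqrt (s ^ 2 - 1))⁻¹).arsinh.mul_const (Real.sqrt 2)
    exact ⟨_, h2.congr (fun σ _ => hε σ) (hε τ)⟩
  have hφ : ∀ τ ∈ Ico 0 T, 1 < phi (ε τ) s := fun τ hτ => one_lt_phi_of_isImmersion hs (hI τ hτ)
  have he0 : ε 0 = 0 := by
    have h1 : parMap (ε 0) s x = x := h0 x hx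
    rw [hε 0, h1, hx.2, hx.1.1.1]
    simp
  have hlt : ∀ τ ∈ Ico 0 T, Real.sqrt 2 * ε τ < Real.arcosh s := fun τ hτ =>
    lt_arcosh_of_continuousOn hs
      (fun σ hσ => (hd σ hσ).choose_spec.continuousWithinAt) he0 hφ hτ
  refine ⟨he0, fun τ hτ => ⟨hφ τ hτ, ?_⟩⟩
  obtain ⟨ε', hε'⟩ := hd τ hτ
  have h1 := (hasDerivAt_parMap hs (hlt τ hτ) hx).scomp_hasDerivWithinAt τ hε'
  have h2 := ((h5 τ hτ).2 x hx).2
  have hm : MapsTo (parMap (ε τ) s) (Mt s) (Mt (phi (ε τ) s)) := fun x hx => parMap_mem hs _ hx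
  have h3 := meanCurvature_smul hs (hφ τ hτ) (hI τ hτ) hm (h5 τ hτ).1 hx ((h5 τ hτ).2 x hx).1
  rw [h3] at h2
  have h4 := (uniqueDiffOn_Ico 0 T τ hτ).eq_deriv _ h1 h2
  have h6 := congrArg (fun v => ip v (Nt (phi (ε τ) s) (parMap (ε τ) s x))) h4
  simp only [ip_smul_left, ip_Nt_self (hφ τ hτ) (hm hx), mul_one] at h6
  rw [h6] at hε'
  exact hε'

theorem isMCF_parallel_iff (hs : 1 < s) (hT : 0 < T) :
    IsMCF (Mt s) T (fun x τ => parallel (Nt s) (ε τ) x) ↔ SolvesODE s T ε :=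
  ⟨fun h => solvesODE_of_isMCF hs (h.congr hT fun _ hx _ _ => (parallel_eq hs _ hx).symm),
    fun h => (isMCF_parMap hs h).congr hT fun _ hx _ _ => parallel_eq hs _ hx⟩

theorem hasBoundedSecondForm_of_solves (hs : 1 < s) (h : SolvesODE s T ε) {F : L6 → ℝ → L6}
    (hF : ∀ x ∈ Mt s, ∀ τ ∈ Ico 0 T, F x τ = parallel (Nt s) (ε τ) x) :
    HasBoundedSecondForm (Mt s) T F := by
  intro T' hT'
  -- This is `|A|² = (u² + 1) / (u² - 1)` at `u = uSol s T'`, its largest value on the interval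
  -- because `uSol` decreases.
  refine ⟨1 + 2 / (uSol s T' ^ 2 - 1), fun τ hτ ν hν x hx A hA => ?_⟩
  have hτ' : τ ∈ Ico 0 T := ⟨hτ.1, hτ.2.trans_lt hT'⟩
  have hu := h.one_lt_uSol hs hτ'
  have hu' := h.one_lt_uSol hs (τ := T') ⟨hτ.1.trans hτ.2, hT'⟩
  have he : EqOn (parMap (ε τ) s) (fun x => F x τ) (Mt s) := fun y hy => by
    simp only [hF y hy τ hτ', parallel_eq hs _ hy]
  have hI := isImmersion_parMap hs (h.2 τ hτ').1
  have hm : MapsTo (parMap (ε τ) s) (Mt s) (Mt (uSol s τ)) := fun x hx => by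
    rw [← h.phi_eq hs hτ']
    exact parMap_mem hs _ hx
  rw [trace_shape_sq hs hu hI hm (hν.congr he) hx (hA.congr he hx)]
  have h1 := t_sq_sub_one_pos hu
  have h2 := t_sq_sub_one_pos hu'
  have h3 := uSol_antitone hs hτ.2
  rw [show uSol s τ ^ 2 + 1 = (uSol s τ ^ 2 - 1) + 2 by ring, add_div, div_self h1.ne']
  gcongr

/-! ### Second order conditions at an extremum along an immersion -/

/-- If `d` were positive, `0` would also be a local minimum, so `g` would be locally constant and
`d` would vanish. -/
theorem second_order_of_max {g g' : ℝ → ℝ} {d : ℝ} (h1 : ∀ σ, HasDerivAt g (g' σ) σ)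
    (h2 : HasDerivAt g' d 0) (hm : ∀ σ, g σ ≤ g 0) : g' 0 = 0 ∧ d ≤ 0 := by
  have hg : deriv g = g' := funext fun σ => (h1 σ).deriv
  have hmax : IsLocalMax g 0 := Filter.Eventually.of_forall hm
  have h0 : g' 0 = 0 := hmax.hasDerivAt_eq_zero (h1 0)
  refine ⟨h0, ?_⟩
  by_contra! hd
  have hmin : IsLocalMin g 0 := isLocalMin_of_deriv_deriv_pos (by rw [hg, h2.deriv]; exact hd)
    (by rw [hg, h0]) (h1 0).continuousAt
  have he : g =ᶠ[nhds 0] fun _ => g 0 := by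
    filter_upwards [hmin] with σ hσ
    exact le_antisymm (hm σ) hσ
  have h3 : deriv g =ᶠ[nhds 0] fun _ => 0 := by
    simpa using he.deriv
  have := h3.deriv_eq
  rw [hg, h2.deriv, deriv_const] at this
  exact hd.ne' this

/-- The barrier function `-a ⟨p, q⟩ + c (p₀ + q₀)`. -/
def barrier (a c : ℝ) (y : L6) : ℝ := a * -lor y.1 y.2 + c * (y.1 0 + y.2 0)

/-- The differential of the barrier function. -/
def barrierDiff (a c : ℝ) (y v : L6) : ℝ :=
  a * -(lor v.1 y.2 + lor y.1 v.2) + c * (v.1 0 + v.2 0)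

theorem barrierDiff_add (a c : ℝ) (y v w : L6) :
    barrierDiff a c y (v + w) = barrierDiff a c y v + barrierDiff a c y w := by
  simp only [barrierDiff, Prod.fst_add, Prod.snd_add, lor_add_left, lor_add_right, Pi.add_apply]
  ring

theorem barrierDiff_smul (a c : ℝ) (y : L6) (k : ℝ) (v : L6) :
    barrierDiff a c y (k • v) = k * barrierDiff a c y v := by
  simp only [barrierDiff, Prod.smul_fst, Prod.smul_snd, lor_smul_left, lor_smul_right,
    Pi.smul_apply, smul_eq_mul]
  ring

/-- The differential of the barrier function as a linear form. -/
def barrierDiffL (a c : ℝ) (y : L6) : L6 →ₗ[ℝ] ℝ where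
  toFun := barrierDiff a c y
  map_add' := barrierDiff_add a c y
  map_smul' k v := barrierDiff_smul a c y k v

theorem hasDerivAt_apply {f : ℝ → L3} {f' : L3} {σ : ℝ} {S : Set ℝ}
    (h : HasDerivWithinAt f f' S σ) (i : Fin 3) :
    HasDerivWithinAt (fun σ => f σ i) (f' i) S σ :=
  hasDerivWithinAt_pi.1 h i

theorem hasDerivWithinAt_barrier (a c : ℝ) {γ : ℝ → L6} {γ' : L6} {σ : ℝ} {S : Set ℝ}
    (h : HasDerivWithinAt γ γ' S σ) :
    HasDerivWithinAt (fun σ => barrier a c (γ σ)) (barrierDiff a c (γ σ) γ') S σ :=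
  (((h.fst_L6.lor h.snd_L6).neg.const_mul a).add
    (((hasDerivAt_apply h.fst_L6 0).add (hasDerivAt_apply h.snd_L6 0)).const_mul c))

theorem hasDerivAt_barrierDiff (a c : ℝ) {γ w : ℝ → L6} {γ' w' : L6} {σ : ℝ}
    (h : HasDerivAt γ γ' σ) (hw : HasDerivAt w w' σ) :
    HasDerivAt (fun σ => barrierDiff a c (γ σ) (w σ)) (barrierDiff a c (γ σ) w' +
      a * -(lor (w σ).1 γ'.2 + lor γ'.1 (w σ).2)) σ := by
  rw [← hasDerivWithinAt_univ] at *
  refine ((((hw.fst_L6.lor h.snd_L6).add (h.fst_L6.lor hw.snd_L6)).neg.const_mul a).add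
    (((hasDerivAt_apply hw.fst_L6 0).add (hasDerivAt_apply hw.snd_L6 0)).const_mul c)).congr_deriv ?_
  simp only [barrierDiff]
  ring

/-- Exchange of the two factors. -/
def swapL : Module.End ℝ L6 := (LinearMap.snd ℝ L3 L3).prod (LinearMap.fst ℝ L3 L3)

theorem swapL_apply (v : L6) : swapL v = (v.2, v.1) := rfl

/-- Changing the sign of the second factor conjugates the exchange into its negative. -/
theorem trace_swapL : LinearMap.trace ℝ L6 swapL = 0 := by
  let e : L6 ≃ₗ[ℝ] L6 := (LinearEquiv.refl ℝ L3).prodCongr (LinearEquiv.neg ℝ)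
  have h : e.conj swapL = -swapL := by
    ext v i <;> simp [e, swapL, LinearEquiv.conj_apply]
  have h2 := LinearMap.trace_conj' swapL e
  rw [h, map_neg] at h2
  linarith

/-- A positively oriented orthonormal frame of `H² × H²` together with the position vectors. -/
theorem exists_basis_of_orthonormal {y ν : L6} (hy : y ∈ HH) (hν : IsTangentHH y ν)
    (hν1 : ip ν ν = 1) {e : Fin 3 → L6} (he : ∀ i, IsTangentHH y (e i))
    (hee : ∀ i j, ip (e i) (e j) = if i = j then 1 else 0) (heν : ∀ i, ip (e i) ν = 0) :
    (∀ z : L6, z = ∑ i, ip (e i) z • e i + ip ν z • ν - lor z.1 y.1 • (y.1, (0 : L3)) -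
      lor z.2 y.2 • ((0 : L3), y.2)) ∧
    ∑ i, 2 * lor (e i).1 (e i).2 = -(2 * lor ν.1 ν.2) := by
  let f : Fin 3 ⊕ Fin 3 → L6 := Sum.elim e ![ν, (y.1, 0), (0, y.2)]
  let s : Fin 3 ⊕ Fin 3 → ℝ := Sum.elim (fun _ => 1) ![1, -1, -1]
  have hs : ∀ i, s i * s i = 1 := by
    rintro (i | i)
    · simp [s]
    · fin_cases i <;> simp [s]
  have h1 : ∀ i, ip (e i) (y.1, 0) = 0 := fun i => by simp [ip, (he i).1]
  have h2 : ∀ i, ip (e i) (0, y.2) = 0 := fun i => by simp [ip, (he i).2]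
  have hff : ∀ i j, ip (f i) (f j) = if i = j then s i else 0 := by
    rintro (i | i) (j | j)
    · simp [f, s, hee]
    · fin_cases j <;> simp [f, h1, h2, heν]
    · fin_cases i <;> simp [f, h1, h2, heν, ip_comm _ (e j)]
    · fin_cases i <;> fin_cases j <;>
        simp [f, s, ip, hy.1.1, hy.2.1, hν.1, hν.2, lor_comm y.1 ν.1, lor_comm y.2 ν.2]
      exact hν1
  have hli : LinearIndependent ℝ f := by
    rw [Fintype.linearIndependent_iff]
    intro g hg i
    have h : ipL (f i) (∑ j, g j • f j) = 0 := by rw [hg, map_zero]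
    simp only [map_sum, map_smul, ipL_apply, hff, smul_eq_mul, mul_ite, mul_zero,
      Finset.sum_ite_eq, Finset.mem_univ, if_true] at h
    exact (mul_eq_zero.1 h).resolve_right fun h0 => by simpa [h0] using hs i
  let b := basisOfLinearIndependentOfCardEqFinrank hli (by simp)
  have hb : ∀ i, b i = f i := fun i => by simp [b]
  let B : L6 →ₗ[ℝ] L6 →ₗ[ℝ] ℝ := LinearMap.mk₂ ℝ ip (by simp) (by simp) (by simp) (by simp)
  have hbb : ∀ i j, B (b i) (b j) = if i = j then s i else 0 := fun i j => by
    rw [hb, hb]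
    exact hff i j
  constructor
  · intro z
    have h := b.sum_repr z
    simp only [repr_eq_of_orthogonal hs hbb, hb, Fintype.sum_sum_type] at h
    rw [Fin.sum_univ_three (fun i : Fin 3 => (s (Sum.inr i) * B (f (Sum.inr i)) z) • f (Sum.inr i))]
      at h
    conv_lhs => rw [← h]
    simp only [s, f, B, Sum.elim_inl, Sum.elim_inr, LinearMap.mk₂_apply, Matrix.cons_val_zero,
      Matrix.cons_val_one, Matrix.cons_val, one_mul]
    rw [show ip (y.1, 0) z = lor z.1 y.1 by simp [ip, lor_comm],
      show ip (0, y.2) z = lor z.2 y.2 by simp [ip, lor_comm]]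
    module
  -- The exchange has trace zero. The two position vectors contribute nothing, since each is
  -- orthogonal to its exchanged image, so the contributions of the `e i` and of `ν` must cancel.
  · have h := trace_eq_sum_of_orthogonal hs hbb swapL
    rw [trace_swapL, Fintype.sum_sum_type,
      Fin.sum_univ_three (fun i : Fin 3 => s (Sum.inr i) * B (b (Sum.inr i)) (swapL (b (Sum.inr i))))]
      at h
    simp only [hb] at h
    simp only [s, f, B, Sum.elim_inl, Sum.elim_inr, LinearMap.mk₂_apply, Matrix.cons_val_zero,
      Matrix.cons_val_one, Matrix.cons_val, one_mul, swapL_apply, ip, lor_zero_left,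
      lor_zero_right] at h
    have h3 : ∀ v : L6, lor v.1 v.2 + lor v.2 v.1 = 2 * lor v.1 v.2 := fun v => by
      rw [lor_comm v.2]
      ring
    simp only [h3] at h
    linarith

variable {t : ℝ} {x : L6} {F ν : L6 → L6}

/-- Obtained by differentiating, in each factor, the orthogonality of position and velocity along a
curve. -/
theorem lor_hess_fst (ht : 1 < t) (hF : IsImmersion (Mt t) F) (hx : x ∈ Mt t) (v : TM (Mt t) x) :
    lor (hess t F x v v).1 (F x).1 = -lor (dM (Mt t) F x v).1 (dM (Mt t) F x v).1 ∧
    lor (hess t F x v v).2 (F x).2 = -lor (dM (Mt t) F x v).2 (dM (Mt t) F x v).2 := by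
  have h1 := hasDerivAt_fderiv_line hF.1 hx v v
  have h2 := hasDerivAt_comp_line ((ContDiffOn.comp_orbitMap hx hF.1).differentiable (by simp))
    (v : L6)
  have h3 : ∀ σ : ℝ, IsTangentHH ((F ∘ orbitMap t x) (σ • (v : L6)))
      (fderiv ℝ (F ∘ orbitMap t x) (σ • (v : L6)) v) := fun σ => by
    obtain ⟨w', -, hw'⟩ := fderiv_comp_orbitMap hx hF.1 (σ • (v : L6)) v
    rw [hw']
    exact isTangentHH_dM ht hF (orbitMap_mem hx _) w'
  have h4 := h1.fst_L6.lor (h2 0).fst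
  have h5 := h1.snd_L6.lor (h2 0).snd
  simp only [(h3 _).1] at h4
  simp only [(h3 _).2] at h5
  have h6 := h4.unique (hasDerivAt_const 0 0)
  have h7 := h5.unique (hasDerivAt_const 0 0)
  rw [zero_smul, fderiv_comp_orbitMap_zero ht hx hF.1, Function.comp_apply, orbitMap_zero]
    at h6 h7
  exact ⟨by linarith, by linarith⟩

theorem barrier_deriv_of_max (ht : 1 < t) (hF : IsImmersion (Mt t) F) (hx : x ∈ Mt t) {a c : ℝ}
    (hmax : ∀ y ∈ Mt t, barrier a c (F y) ≤ barrier a c (F x)) (v : TM (Mt t) x) :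
    barrierDiff a c (F x) (dM (Mt t) F x v) = 0 ∧
    barrierDiff a c (F x) (hess t F x v v) -
      a * (2 * lor (dM (Mt t) F x v).1 (dM (Mt t) F x v).2) ≤ 0 := by
  have h1 := hasDerivAt_fderiv_line hF.1 hx v v
  have h2 := hasDerivAt_comp_line ((ContDiffOn.comp_orbitMap hx hF.1).differentiable (by simp))
    (v : L6)
  have h3 : ∀ σ : ℝ, HasDerivAt (fun σ : ℝ => barrier a c ((F ∘ orbitMap t x) (σ • (v : L6))))
      (barrierDiff a c ((F ∘ orbitMap t x) (σ • (v : L6)))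
        (fderiv ℝ (F ∘ orbitMap t x) (σ • (v : L6)) v)) σ := fun σ => by
    have := h2 σ
    rw [← hasDerivWithinAt_univ] at *
    exact hasDerivWithinAt_barrier a c this
  have h4 := hasDerivAt_barrierDiff a c (h2 0) h1
  have h5 := second_order_of_max h3 h4 fun σ => by
    rw [zero_smul, Function.comp_apply, Function.comp_apply, orbitMap_zero]
    exact hmax _ (orbitMap_mem hx _)
  rw [zero_smul, fderiv_comp_orbitMap_zero ht hx hF.1, Function.comp_apply, orbitMap_zero] at h5
  exact ⟨h5.1, by linarith [h5.2]⟩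

/-- The last inequality says that the Laplacian of the barrier along `F` is nonpositive. The
first-order condition kills the differential on tangential frame vectors, leaving its normal
component; summing the second-order conditions over the frame produces `tr A = 3H` and, by the trace
identity for the exchange, `2⟨ν₁, ν₂⟩`. The number `S` is the contribution of the position vectors
to the height. -/
theorem barrier_of_max (ht : 1 < t) (hF : IsImmersion (Mt t) F) (hν : IsUnitNormal (Mt t) F ν)
    (hx : x ∈ Mt t) {H : ℝ} (hH : HasMeanCurvature (Mt t) F ν x H) {a c : ℝ}
    (hmax : ∀ y ∈ Mt t, barrier a c (F y) ≤ barrier a c (F x)) :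
    (∀ v, IsTangentHH (F x) v → barrierDiff a c (F x) v =
      barrierDiff a c (F x) (ν x) * ip v (ν x)) ∧
    ∃ S, 0 ≤ S ∧ S ≤ 3 * ((F x).1 0 + (F x).2 0) ∧
      a * (2 * lor (ν x).1 (ν x).2 + 3 * -lor (F x).1 (F x).2) + c * S +
        3 * H * barrierDiff a c (F x) (ν x) ≤ 0 := by
  obtain ⟨A, hA, rfl⟩ := hH
  obtain ⟨b, hb⟩ := exists_orthonormal_basis_of_posDef (pullback_comm (t := t) (F := F) (x := x))
    (pullback_pos ht hF hx)
  have htr := trace_eq_sum_of_orthonormal hb A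
  revert b
  rw [finrank_TM ht hx]
  intro b hb htr
  have hFx := hF.2.1 hx
  obtain ⟨hν0, hν1, hν2⟩ := hν.2 x hx
  set e : Fin 3 → L6 := fun i => dM (Mt t) F x (b i) with he
  have het : ∀ i, IsTangentHH (F x) (e i) := fun i => isTangentHH_dM ht hF hx (b i)
  obtain ⟨hdec, hswap⟩ := exists_basis_of_orthonormal hFx hν0 hν1 het hb fun i => hν2 (b i)
  have hmx := fun i => barrier_deriv_of_max ht hF hx hmax (b i)
  have hD : ∀ z : L6, barrierDiff a c (F x) z = ip (ν x) z * barrierDiff a c (F x) (ν x) -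
      lor z.1 (F x).1 * (a * -lor (F x).1 (F x).2 + c * (F x).1 0) -
      lor z.2 (F x).2 * (a * -lor (F x).1 (F x).2 + c * (F x).2 0) := fun z => by
    have h1 : barrierDiffL a c (F x) z = _ := congrArg (barrierDiffL a c (F x)) (hdec z)
    simp only [map_sub, map_add, map_sum, map_smul, smul_eq_mul] at h1
    have h2 : ∀ i, barrierDiffL a c (F x) (e i) = 0 := fun i => (hmx i).1
    simp only [h2, mul_zero, Finset.sum_const_zero, zero_add] at h1
    refine h1.trans ?_
    simp [barrierDiffL, barrierDiff]
  have hpull : ∀ i, ip (ν x) (hess t F x (b i) (b i)) = pullback t F x (b i) (A (b i)) := fun i => by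
    rw [pullback_comm, pullback_shape ht hF hν hx hA, ip_comm]
  have hlor := fun i => lor_hess_fst ht hF hx (b i)
  refine ⟨fun v hv => ?_, ∑ i, (lor (e i).1 (e i).1 * (F x).1 0 + lor (e i).2 (e i).2 * (F x).2 0),
    Finset.sum_nonneg fun i _ => ?_, ?_, ?_⟩
  · rw [hD, hv.1, hv.2, ip_comm]
    ring
  · exact add_nonneg (mul_nonneg (lor_self_nonneg hFx.1 (het i).1) hFx.1.2.le)
      (mul_nonneg (lor_self_nonneg hFx.2 (het i).2) hFx.2.2.le)
  · have h3 : ∀ i, lor (e i).1 (e i).1 * (F x).1 0 + lor (e i).2 (e i).2 * (F x).2 0 ≤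
        (F x).1 0 + (F x).2 0 := fun i => by
      have h4 := lor_self_nonneg hFx.1 (het i).1
      have h5 := lor_self_nonneg hFx.2 (het i).2
      have h6 : lor (e i).1 (e i).1 + lor (e i).2 (e i).2 = 1 := (hb i i).trans (if_pos rfl)
      nlinarith [hFx.1.2, hFx.2.2]
    rw [Fin.sum_univ_three]
    linarith [h3 0, h3 1, h3 2]
  · have h7 := Finset.sum_nonpos fun i (_ : i ∈ Finset.univ) => (hmx i).2
    have h8 : ∀ i, barrierDiff a c (F x) (hess t F x (b i) (b i)) =
        pullback t F x (b i) (A (b i)) * barrierDiff a c (F x) (ν x) +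
        a * -lor (F x).1 (F x).2 +
        c * (lor (e i).1 (e i).1 * (F x).1 0 + lor (e i).2 (e i).2 * (F x).2 0) := fun i => by
      have h6 : lor (e i).1 (e i).1 + lor (e i).2 (e i).2 = 1 := (hb i i).trans (if_pos rfl)
      rw [hD, hpull, (hlor i).1, (hlor i).2]
      linear_combination a * -lor (F x).1 (F x).2 * h6
    simp only [h8, Finset.sum_sub_distrib, Finset.sum_add_distrib, ← Finset.mul_sum,
      ← Finset.sum_mul, ← htr] at h7
    rw [← Finset.mul_sum] at hswap
    simp only [Finset.sum_const, Finset.card_univ, Fintype.card_fin, nsmul_eq_mul] at h7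
    have h9 : a * (2 * ∑ i, lor (e i).1 (e i).2) = a * -(2 * lor (ν x).1 (ν x).2) := by rw [hswap]
    rw [Finset.sum_add_distrib, ← Finset.sum_mul, ← Finset.sum_mul]
    push_cast at h7
    simp only [he] at h7 h9 ⊢
    linarith

/-! ### Pinching of the normal at an almost critical point -/

/-- `lor_sq_le_mul` followed by the arithmetic–geometric mean inequality. Both signs matter: it
bounds the reaction term and makes `pinchForm` semidefinite and bounded. -/
theorem abs_two_mul_lor_le {x v : L6} (hx : x ∈ HH) (hv : IsTangentHH x v) :
    |2 * lor v.1 v.2| ≤ -lor x.1 x.2 * ip v v := by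
  have h1 := one_le_neg_lor hx.1 hx.2
  have h2 := lor_sq_le_mul hx.1 hx.2 hv.1 hv.2
  refine abs_le_of_sq_le_sq ?_ (mul_nonneg (by linarith) (ip_self_nonneg hx hv))
  have h3 : lor v.1 v.1 * lor v.2 v.2 * 4 ≤ ip v v ^ 2 := by
    simp only [ip]
    nlinarith [sq_nonneg (lor v.1 v.1 - lor v.2 v.2)]
  nlinarith [sq_nonneg (lor x.1 x.2)]

/-- A positive semidefinite form on the tangent space whose kernel contains the gradient of
`⟨p, q⟩`. -/
def pinchForm (x v w : L6) : ℝ := lor v.1 w.2 + lor v.2 w.1 - lor x.1 x.2 * ip v w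

theorem pinchForm_sq_le {x v w : L6} (hx : x ∈ HH) (hv : IsTangentHH x v)
    (hw : IsTangentHH x w) : pinchForm x v w ^ 2 ≤ pinchForm x v v * pinchForm x w w := by
  have hnn : ∀ z, IsTangentHH x z → 0 ≤ pinchForm x z z := fun z hz => by
    have := neg_le_of_abs_le (abs_two_mul_lor_le hx hz)
    rw [pinchForm, lor_comm z.2]
    linarith
  have h : ∀ c : ℝ, 0 ≤ pinchForm x w w * (c * c) + 2 * pinchForm x v w * c + pinchForm x v v :=
    fun c => by
      have := hnn _ (hv.add (hw.smul c))
      simp only [pinchForm, ip_add_left, ip_add_right, ip_smul_left, ip_smul_right, Prod.fst_add,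
        Prod.snd_add, Prod.smul_fst, Prod.smul_snd, lor_add_left, lor_add_right, lor_smul_left,
        lor_smul_right] at this ⊢
      rw [ip_comm w v, lor_comm w.1 v.2, lor_comm w.2 v.1] at this
      linarith
  have := discrim_le_zero h
  simp only [discrim] at this
  nlinarith

theorem pinchForm_self_le {x v : L6} (hx : x ∈ HH) (hv : IsTangentHH x v) :
    0 ≤ pinchForm x v v ∧ pinchForm x v v ≤ 2 * -lor x.1 x.2 * ip v v := by
  have := abs_le.1 (abs_two_mul_lor_le hx hv)
  rw [pinchForm, lor_comm v.2]
  constructor <;> linarith [this.1, this.2]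

/-- The gradient of `⟨p, q⟩`. -/
def gradLor (x : L6) : L6 := (x.2 + lor x.1 x.2 • x.1, x.1 + lor x.1 x.2 • x.2)

/-- The gradient of `p₀ + q₀`. -/
def gradHeight (x : L6) : L6 :=
  (x.1 0 • x.1 - ![1, 0, 0], x.2 0 • x.2 - ![1, 0, 0])

theorem lor_e0 (v : L3) : lor v ![1, 0, 0] = -v 0 := by simp [lor]

theorem isTangentHH_gradLor {x : L6} (hx : x ∈ HH) : IsTangentHH x (gradLor x) := by
  constructor <;> simp [gradLor, hx.1.1, hx.2.1, lor_comm x.2 x.1]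

theorem isTangentHH_gradHeight {x : L6} (hx : x ∈ HH) : IsTangentHH x (gradHeight x) := by
  constructor <;> simp only [gradHeight, lor_sub_left, lor_smul_left, hx.1.1, hx.2.1]
  · rw [lor_comm _ x.1, lor_e0]; ring
  · rw [lor_comm _ x.2, lor_e0]; ring

theorem ip_gradLor {x v : L6} (hv : IsTangentHH x v) :
    ip v (gradLor x) = lor v.1 x.2 + lor x.1 v.2 := by
  simp [ip, gradLor, hv.1, hv.2, lor_comm v.2 x.1]

theorem ip_gradLor_self {x : L6} (hx : x ∈ HH) :
    ip (gradLor x) (gradLor x) = 2 * (lor x.1 x.2 ^ 2 - 1) := by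
  rw [ip_gradLor (isTangentHH_gradLor hx)]
  simp only [gradLor, lor_add_left, lor_add_right, lor_smul_left, lor_smul_right, hx.1.1, hx.2.1]
  ring

theorem ip_gradHeight {x v : L6} (hv : IsTangentHH x v) :
    ip v (gradHeight x) = v.1 0 + v.2 0 := by
  simp only [ip, gradHeight, lor_sub_right, lor_smul_right, hv.1, hv.2, lor_e0]
  ring

theorem ip_gradHeight_self_le {x : L6} (hx : x ∈ HH) :
    ip (gradHeight x) (gradHeight x) ≤ (x.1 0 + x.2 0) ^ 2 := by
  rw [ip_gradHeight (isTangentHH_gradHeight hx)]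
  simp only [gradHeight, Pi.sub_apply, Pi.smul_apply, smul_eq_mul, Matrix.cons_val_zero]
  nlinarith [hx.1.2, hx.2.2]

theorem pinchForm_gradLor {x v : L6} (hv : IsTangentHH x v) : pinchForm x v (gradLor x) = 0 := by
  rw [pinchForm, ip_gradLor hv]
  simp only [gradLor, lor_add_right, lor_smul_right, hv.1, hv.2, lor_comm v.2 x.1]
  ring

theorem barrierDiff_eq_ip {x v : L6} (hv : IsTangentHH x v) (c : ℝ) :
    barrierDiff (-1) c x v = ip v (gradLor x + c • gradHeight x) := by
  rw [ip_add_right, ip_smul_right, ip_gradLor hv, ip_gradHeight hv, barrierDiff]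
  ring

/-- If the differential of `⟨p, q⟩ + c (p₀ + q₀)` is a multiple of `⟨·, ν⟩` with small `c`, then
`ν` is close to the direction in which `⟨ν₁, ν₂⟩` is smallest. -/
theorem normal_pinching {x ν : L6} {c l : ℝ} (hx : x ∈ HH) (hν : IsTangentHH x ν)
    (hν1 : ip ν ν = 1) (h : ∀ v, IsTangentHH x v → barrierDiff (-1) c x v = l * ip v ν) :
    (2 * lor ν.1 ν.2 - lor x.1 x.2) * Real.sqrt (2 * (lor x.1 x.2 ^ 2 - 1)) ≤
      4 * -lor x.1 x.2 * (|c| * (x.1 0 + x.2 0)) := by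
  have hu := one_le_neg_lor hx.1 hx.2
  have hL := isTangentHH_gradLor hx
  set z := c • gradHeight x with hz
  have hzt : IsTangentHH x z := (isTangentHH_gradHeight hx).smul c
  have e : gradLor x = l • ν - z := by
    have ht : IsTangentHH x (gradLor x + z - l • ν) := (hL.add hzt).sub (hν.smul l)
    have h0 := eq_zero_of_ip_self hx ht (by
      rw [ip_sub_right, ← barrierDiff_eq_ip ht, ip_smul_right, h _ ht, sub_self])
    rw [sub_eq_zero] at h0
    rw [← h0, add_sub_cancel_right]
  set P := pinchForm x ν ν with hP
  have hP0 : P = 2 * lor ν.1 ν.2 - lor x.1 x.2 := by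
    rw [hP, pinchForm, lor_comm ν.2, hν1]
    ring
  obtain ⟨hP1, hP2⟩ := pinchForm_self_le hx hν
  rw [hν1, mul_one] at hP2
  -- Pair `gradLor x = l • ν - z` with `ν` in `pinchForm`, whose kernel contains the gradient. If
  -- `z` is small and the gradient is not, `l` is large and `P` is forced to be small.
  have hlP : l * P = pinchForm x ν z := by
    have h1 := pinchForm_gradLor hν
    rw [e] at h1
    have h2 : pinchForm x ν (l • ν - z) = l * P - pinchForm x ν z := by
      simp only [hP, pinchForm, ip_sub_right, ip_smul_right, Prod.fst_sub, Prod.snd_sub,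
        Prod.smul_fst, Prod.smul_snd, lor_sub_right, lor_smul_right]
      ring
    linarith
  set Z := Real.sqrt (ip z z) with hZ
  have hZ2 : Z ^ 2 = ip z z := Real.sq_sqrt (ip_self_nonneg hx hzt)
  have hZ0 : 0 ≤ Z := Real.sqrt_nonneg _
  have hlZ : |l| * P ≤ 2 * -lor x.1 x.2 * Z := by
    rw [show |l| * P = |pinchForm x ν z| by rw [← hlP, abs_mul, abs_of_nonneg (a := P) hP1]]
    refine abs_le_of_sq_le_sq ?_ (by positivity)
    have h3 := pinchForm_sq_le hx hν hzt
    obtain ⟨h4, h5⟩ := pinchForm_self_le hx hzt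
    rw [← hZ2] at h5
    calc pinchForm x ν z ^ 2 ≤ P * pinchForm x z z := h3
      _ ≤ (2 * -lor x.1 x.2) * (2 * -lor x.1 x.2 * Z ^ 2) := by gcongr
      _ = (2 * -lor x.1 x.2 * Z) ^ 2 := by ring
  have hk : Real.sqrt (2 * (lor x.1 x.2 ^ 2 - 1)) ≤ |l| + Z := by
    refine Real.sqrt_le_iff.2 ⟨by positivity, ?_⟩
    rw [← ip_gradLor_self hx, e]
    simp only [ip_sub_left, ip_sub_right, ip_smul_left, ip_smul_right, hν1, ip_comm z ν]
    have h6 : |ip ν z| ≤ Z := by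
      refine abs_le_of_sq_le_sq ?_ hZ0
      have := ip_sq_le hx hν hzt
      rwa [hν1, one_mul, ← hZ2] at this
    have h7 : -(l * ip ν z) ≤ |l| * Z := by
      refine (neg_le_abs _).trans ?_
      rw [abs_mul]
      gcongr
    rw [← hZ2]
    nlinarith [sq_abs l]
  have hZc : Z ≤ |c| * (x.1 0 + x.2 0) := by
    have h8 : 0 ≤ x.1 0 + x.2 0 := by linarith [hx.1.2, hx.2.2]
    refine Real.sqrt_le_iff.2 ⟨by positivity, ?_⟩
    rw [hz, ip_smul_left, ip_smul_right, mul_pow, sq_abs]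
    nlinarith [ip_gradHeight_self_le hx, sq_nonneg c]
  rw [← hP0]
  calc P * Real.sqrt (2 * (lor x.1 x.2 ^ 2 - 1)) ≤ P * (|l| + Z) := by gcongr
    _ = |l| * P + P * Z := by ring
    _ ≤ 2 * -lor x.1 x.2 * Z + 2 * -lor x.1 x.2 * Z := by gcongr
    _ = 4 * -lor x.1 x.2 * Z := by ring
    _ ≤ _ := by gcongr

/-! ### Flows with bounded mean curvature -/

/-- `F` is a mean curvature flow with initial data `Mt s`, with normal `ν` and mean curvature `H`
bounded by `C`. -/
structure IsBoundedFlow (s T C : ℝ) (F ν : L6 → ℝ → L6) (H : L6 → ℝ → ℝ) : Prop where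
  cont : ContinuousOn (fun z : L6 × ℝ => F z.1 z.2) (Mt s ×ˢ Ico 0 T)
  init : ∀ x ∈ Mt s, F x 0 = x
  imm : ∀ τ ∈ Ico 0 T, IsImmersion (Mt s) (fun x => F x τ)
  normal : ∀ τ ∈ Ico 0 T, IsUnitNormal (Mt s) (fun x => F x τ) (fun x => ν x τ)
  curv : ∀ τ ∈ Ico 0 T, ∀ x ∈ Mt s,
    HasMeanCurvature (Mt s) (fun y => F y τ) (fun y => ν y τ) x (H x τ)
  deriv : ∀ τ ∈ Ico 0 T, ∀ x ∈ Mt s,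
    HasDerivWithinAt (fun σ => F x σ) (H x τ • ν x τ) (Ico 0 T) τ
  bound : ∀ τ ∈ Ico 0 T, ∀ x ∈ Mt s, |H x τ| ≤ C

theorem monotone_of_hasDerivWithinAt {T : ℝ} {f f' : ℝ → ℝ}
    (hf : ∀ τ ∈ Ico 0 T, HasDerivWithinAt f (f' τ) (Ico 0 T) τ) (h : ∀ τ ∈ Ico 0 T, 0 ≤ f' τ) :
    MonotoneOn f (Ico 0 T) := by
  refine monotoneOn_of_hasDerivWithinAt_nonneg (f' := f') (convex_Ico 0 T)
    (fun τ hτ => (hf τ hτ).continuousWithinAt)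
    (fun τ hτ => (hf τ (interior_subset hτ)).mono interior_subset)
    fun τ hτ => h τ (interior_subset hτ)

/-- Multiplied by `exp (K τ)` the function increases, and multiplied by `exp (-K τ)` it decreases.
-/
theorem exp_bounds {T K : ℝ} {f f' : ℝ → ℝ}
    (hf : ∀ τ ∈ Ico 0 T, HasDerivWithinAt f (f' τ) (Ico 0 T) τ)
    (h : ∀ τ ∈ Ico 0 T, |f' τ| ≤ K * f τ) {σ τ : ℝ} (hσ : σ ∈ Ico 0 T) (hτ : τ ∈ Ico 0 T)
    (hστ : σ ≤ τ) : f σ * Real.exp (-K * (τ - σ)) ≤ f τ ∧ f τ ≤ f σ * Real.exp (K * (τ - σ)) := by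
  have he : ∀ (c τ : ℝ), HasDerivAt (fun τ => Real.exp (c * τ)) (c * Real.exp (c * τ)) τ :=
    fun c τ => ((hasDerivAt_id τ).const_mul c).exp.congr_deriv (by simp [mul_comm])
  have h1 := monotone_of_hasDerivWithinAt
    (fun τ hτ => ((he K τ).hasDerivWithinAt (s := Ico 0 T)).mul (hf τ hτ)) (fun τ hτ => by
      have := neg_le_of_abs_le (h τ hτ)
      nlinarith [Real.exp_pos (K * τ)]) hσ hτ hστ
  have h2 := monotone_of_hasDerivWithinAt
    (fun τ hτ => (((he (-K) τ).hasDerivWithinAt (s := Ico 0 T)).mul (hf τ hτ)).neg) (fun τ hτ => by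
      have := le_of_abs_le (h τ hτ)
      nlinarith [Real.exp_pos (-K * τ)]) hσ hτ hστ
  simp only [Pi.mul_apply, Pi.neg_apply, neg_le_neg_iff] at h1 h2
  have e1 := Real.exp_pos (K * τ)
  have e2 := Real.exp_pos (-K * τ)
  constructor
  · rw [show -K * (τ - σ) = K * σ - K * τ by ring, Real.exp_sub, ← mul_div_assoc, div_le_iff₀ e1]
    linarith
  · rw [show K * (τ - σ) = -K * σ - -K * τ by ring, Real.exp_sub, ← mul_div_assoc, le_div_iff₀ e2]
    linarith

section

variable {s T C : ℝ} {F ν : L6 → ℝ → L6} {H : L6 → ℝ → ℝ} {x : L6}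

theorem IsBoundedFlow.mem (hF : IsBoundedFlow s T C F ν H) {τ : ℝ} (hτ : τ ∈ Ico 0 T)
    (hx : x ∈ Mt s) : F x τ ∈ HH := (hF.imm τ hτ).2.1 hx

/-- These bounds make the logarithmic rate of change of `-⟨p, q⟩` and of the height at most `2 |H|`
along the flow, which is what keeps the height proper. -/
theorem lor_unit_le {y v : L6} (hy : y ∈ HH) (hv : IsTangentHH y v) (h1 : ip v v = 1) :
    |lor v.1 y.2| ≤ -lor y.1 y.2 ∧ |lor y.1 v.2| ≤ -lor y.1 y.2 ∧ |v.1 0| ≤ y.1 0 ∧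
      |v.2 0| ≤ y.2 0 := by
  have hu := one_le_neg_lor hy.1 hy.2
  have n1 := lor_self_nonneg hy.1 hv.1
  have n2 := lor_self_nonneg hy.2 hv.2
  simp only [ip] at h1
  have a1 := lor_sq_le_of_mem hy.1 hy.2 hv.1
  have a2 := lor_sq_le_of_mem hy.2 hy.1 hv.2
  have a3 := apply_zero_sq_le hy.1 hv.1
  have a4 := apply_zero_sq_le hy.2 hv.2
  have b1 := one_le_of_mem_H2 hy.1
  have b2 := one_le_of_mem_H2 hy.2
  rw [lor_comm y.1 v.2]
  rw [lor_comm y.2 y.1] at a2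
  refine ⟨abs_le_of_sq_le_sq ?_ (by linarith), abs_le_of_sq_le_sq ?_ (by linarith),
    abs_le_of_sq_le_sq ?_ (by linarith), abs_le_of_sq_le_sq ?_ (by linarith)⟩ <;> nlinarith

theorem IsBoundedFlow.abs_mul_le (hF : IsBoundedFlow s T C F ν H) (hx : x ∈ Mt s) {τ a b : ℝ}
    (hτ : τ ∈ Ico 0 T) (h : |a| ≤ b) : |H x τ * a| ≤ C * b := by
  rw [abs_mul]
  exact mul_le_mul (hF.bound τ hτ x hx) h (abs_nonneg _)
    ((abs_nonneg _).trans (hF.bound τ hτ x hx))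

theorem IsBoundedFlow.barrier_bounds (hF : IsBoundedFlow s T C F ν H) (hx : x ∈ Mt s) {a c : ℝ}
    (ha : 0 ≤ a) (hc : 0 ≤ c) {σ τ : ℝ} (hσ : σ ∈ Ico 0 T) (hτ : τ ∈ Ico 0 T) (hστ : σ ≤ τ) :
    barrier a c (F x σ) * Real.exp (-(2 * C) * (τ - σ)) ≤ barrier a c (F x τ) ∧
      barrier a c (F x τ) ≤ barrier a c (F x σ) * Real.exp (2 * C * (τ - σ)) := by
  refine exp_bounds (fun τ hτ => hasDerivWithinAt_barrier a c (hF.deriv τ hτ x hx))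
    (fun τ hτ => ?_) hσ hτ hστ
  obtain ⟨h1, h2, -⟩ := (hF.normal τ hτ).2 x hx
  obtain ⟨b1, b2, b3, b4⟩ := lor_unit_le (hF.mem hτ hx) h1 h2
  have hm := hF.mem hτ hx
  rw [barrierDiff_smul, mul_comm 2 C, mul_assoc]
  refine hF.abs_mul_le hx hτ ?_
  have hp1 := hm.1.2
  have hp2 := hm.2.2
  rw [barrierDiff, barrier]
  rw [abs_le] at *
  constructor <;> nlinarith

/-! ### Compact exhaustion and attained maxima -/

theorem isCompact_sublevel (s R : ℝ) : IsCompact {x : L6 | x ∈ Mt s ∧ x.1 0 + x.2 0 ≤ R} := by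
  have hsub : {x : L6 | x ∈ Mt s ∧ x.1 0 + x.2 0 ≤ R} = {x : L6 | lor x.1 x.1 = -1 ∧
      1 ≤ x.1 0 ∧ lor x.2 x.2 = -1 ∧ 1 ≤ x.2 0 ∧ lor x.1 x.2 = -s ∧ x.1 0 + x.2 0 ≤ R} := by
    ext x
    constructor
    · rintro ⟨⟨⟨h1, h2⟩, h3⟩, h4⟩
      exact ⟨h1.1, one_le_of_mem_H2 h1, h2.1, one_le_of_mem_H2 h2, h3, h4⟩
    · rintro ⟨h1, h2, h3, h4, h5, h6⟩
      exact ⟨⟨⟨⟨h1, by linarith⟩, h3, by linarith⟩, h5⟩, h6⟩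
  refine Metric.isCompact_of_isClosed_isBounded ?_ ?_
  · rw [hsub]
    simp only [lor, Set.ofPred_and]
    refine IsClosed.inter ?_ (IsClosed.inter ?_ (IsClosed.inter ?_ (IsClosed.inter ?_
      (IsClosed.inter ?_ ?_))))
    · exact isClosed_eq (by fun_prop) continuous_const
    · exact isClosed_le continuous_const (by fun_prop)
    · exact isClosed_eq (by fun_prop) continuous_const
    · exact isClosed_le continuous_const (by fun_prop)
    · exact isClosed_eq (by fun_prop) continuous_const
    · exact isClosed_le (by fun_prop) continuous_const
  · refine (Metric.isBounded_closedBall (x := (0 : L6)) (r := R)).subset ?_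
    rw [hsub]
    rintro x ⟨h1, h2, h3, h4, -, h6⟩
    have key : ∀ p : L3, lor p p = -1 → 1 ≤ p 0 → p 0 ≤ R → ‖p‖ ≤ R := fun p hp hp0 hpR => by
      simp only [lor] at hp
      rw [pi_norm_le_iff_of_nonneg (by linarith)]
      intro i
      rw [Real.norm_eq_abs]
      refine abs_le_of_sq_le_sq ?_ (by linarith)
      fin_cases i <;> simp <;> nlinarith [sq_nonneg (p 1), sq_nonneg (p 2)]
    rw [mem_closedBall_zero_iff, Prod.norm_def]
    exact max_le (key _ h1 h2 (by linarith)) (key _ h3 h4 (by linarith))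

theorem exists_max_of_proper {w : L6 → ℝ → ℝ} {t₀ t₁ R : ℝ}
    (hw : ContinuousOn (fun z : L6 × ℝ => w z.1 z.2) (Mt s ×ˢ Icc t₀ t₁))
    (hR : ∀ x ∈ Mt s, ∀ τ ∈ Icc t₀ t₁, R < x.1 0 + x.2 0 → w x τ ≤ 0)
    (h : ∃ x ∈ Mt s, ∃ τ ∈ Icc t₀ t₁, 0 < w x τ) :
    ∃ x ∈ Mt s, ∃ τ ∈ Icc t₀ t₁, 0 < w x τ ∧ ∀ y ∈ Mt s, ∀ σ ∈ Icc t₀ t₁, w y σ ≤ w x τ := by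
  obtain ⟨x₁, hx₁, τ₁, hτ₁, h₁⟩ := h
  have hK : IsCompact ({x : L6 | x ∈ Mt s ∧ x.1 0 + x.2 0 ≤ R} ×ˢ Icc t₀ t₁) :=
    (isCompact_sublevel s R).prod isCompact_Icc
  have hx₁' : x₁.1 0 + x₁.2 0 ≤ R := by
    by_contra! hlt
    exact h₁.not_ge (hR x₁ hx₁ τ₁ hτ₁ hlt)
  obtain ⟨⟨x, τ⟩, ⟨hx, hτ⟩, hmax⟩ := hK.exists_isMaxOn ⟨(x₁, τ₁), ⟨hx₁, hx₁'⟩, hτ₁⟩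
    (hw.mono fun z hz => ⟨hz.1.1, hz.2⟩)
  have hpos : 0 < w x τ := h₁.trans_le (hmax (show (x₁, τ₁) ∈ _ from ⟨⟨hx₁, hx₁'⟩, hτ₁⟩))
  refine ⟨x, hx.1, τ, hτ, hpos, fun y hy σ hσ => ?_⟩
  by_cases hyR : y.1 0 + y.2 0 ≤ R
  · exact hmax (show (y, σ) ∈ _ from ⟨⟨hy, hyR⟩, hσ⟩)
  · exact (hR y hy σ hσ (not_le.1 hyR)).trans hpos.le

theorem deriv_nonneg_of_max_right {T d t₀ τ : ℝ} {f : ℝ → ℝ} (h0 : 0 ≤ t₀) (hτ : t₀ < τ)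
    (hT : τ < T) (hf : HasDerivWithinAt f d (Ico 0 T) τ) (hm : ∀ σ ∈ Icc t₀ τ, f σ ≤ f τ) :
    0 ≤ d := by
  have h1 : HasDerivWithinAt f d (Iic τ) τ :=
    (hf.hasDerivAt (Ico_mem_nhds (by linarith) hT)).hasDerivWithinAt
  have h2 : IsLocalMaxOn f (Iic τ) τ := by
    filter_upwards [self_mem_nhdsWithin, mem_nhdsWithin_of_mem_nhds (Ioi_mem_nhds hτ)] with σ h3 h4
    exact hm σ ⟨le_of_lt h4, h3⟩
  have h3 := h2.hasFDerivWithinAt_nonpos h1.hasFDerivWithinAt (y := -1)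
    (mem_posTangentConeAt_of_segment_subset ((convex_Iic τ).segment_subset (by simp)
      (by simp)))
  simpa using h3

end

/-! ### The maximum principle -/

variable {s T C : ℝ} {F ν : L6 → ℝ → L6} {H : L6 → ℝ → ℝ} {x : L6}

theorem barrier_zero_one (y : L6) : barrier 0 1 y = y.1 0 + y.2 0 := by simp [barrier]

theorem barrier_one_zero (y : L6) : barrier 1 0 y = -lor y.1 y.2 := by simp [barrier]

theorem continuous_barrier (a c : ℝ) : Continuous (barrier a c) := by
  unfold barrier lor
  fun_prop

theorem IsBoundedFlow.nonneg (hF : IsBoundedFlow s T C F ν H) (hx : x ∈ Mt s) {τ : ℝ}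
    (hτ : τ ∈ Ico 0 T) : 0 ≤ C := (abs_nonneg _).trans (hF.bound τ hτ x hx)

theorem IsBoundedFlow.height_pos (hF : IsBoundedFlow s T C F ν H) (hx : x ∈ Mt s) {τ : ℝ}
    (hτ : τ ∈ Ico 0 T) : 0 < (F x τ).1 0 + (F x τ).2 0 :=
  add_pos (hF.mem hτ hx).1.2 (hF.mem hτ hx).2.2

theorem IsBoundedFlow.height_lower (hF : IsBoundedFlow s T C F ν H) (hx : x ∈ Mt s) {τ t₁ : ℝ}
    (hτ : τ ∈ Icc 0 t₁) (ht₁ : t₁ < T) :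
    (x.1 0 + x.2 0) * Real.exp (-(2 * C) * t₁) ≤ (F x τ).1 0 + (F x τ).2 0 := by
  have hτ' : τ ∈ Ico 0 T := ⟨hτ.1, hτ.2.trans_lt ht₁⟩
  have h0 : (0 : ℝ) ∈ Ico 0 T := ⟨le_rfl, hτ.1.trans_lt hτ'.2⟩
  have h := (hF.barrier_bounds hx (a := 0) (c := 1) le_rfl zero_le_one h0 hτ' hτ.1).1
  rw [barrier_zero_one, barrier_zero_one, hF.init x hx, sub_zero] at h
  refine le_trans (mul_le_mul_of_nonneg_left (Real.exp_le_exp.2 ?_) ?_) h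
  · nlinarith [hF.nonneg hx h0, hτ.2]
  · exact (add_pos hx.1.1.2 hx.1.2.2).le

/-- At a positive maximum of `a (u - uSol) - δ e^{Dτ} (p₀ + q₀)` the evolution equation gives an
inequality between `u`, `uSol` and `⟨ν₁, ν₂⟩`. -/
theorem IsBoundedFlow.exists_max (hs : 1 < s) (hF : IsBoundedFlow s T C F ν H) {a D δ t₀ t₁ B : ℝ}
    (hδ : 0 < δ) (hD : 0 ≤ D) (h₀ : 0 ≤ t₀) (h₁ : t₁ < T)
    (hB : ∀ x ∈ Mt s, ∀ τ ∈ Icc t₀ t₁, a * (-lor (F x τ).1 (F x τ).2 - uSol s τ) ≤ B)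
    (hinit : ∀ x ∈ Mt s, a * (-lor (F x t₀).1 (F x t₀).2 - uSol s t₀) ≤ 0)
    (hpos : ∃ x ∈ Mt s, ∃ τ ∈ Icc t₀ t₁, 0 < a * (-lor (F x τ).1 (F x τ).2 - uSol s τ) -
      δ * Real.exp (D * τ) * ((F x τ).1 0 + (F x τ).2 0)) :
    ∃ x ∈ Mt s, ∃ τ ∈ Icc t₀ t₁, ∃ c < 0, ∃ l,
      0 < a * (-lor (F x τ).1 (F x τ).2 - uSol s τ) + c * ((F x τ).1 0 + (F x τ).2 0) ∧
      (∀ v, IsTangentHH (F x τ) v → barrierDiff a c (F x τ) v = l * ip v (ν x τ)) ∧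
      a * (2 * lor (ν x τ).1 (ν x τ).2 + 3 * -lor (F x τ).1 (F x τ).2 - 2 * uSol s τ) ≤
        3 * (D - 1) * (c * ((F x τ).1 0 + (F x τ).2 0)) := by
  have hIco : ∀ τ ∈ Icc t₀ t₁, τ ∈ Ico 0 T := fun τ hτ => ⟨h₀.trans hτ.1, hτ.2.trans_lt h₁⟩
  let w : L6 → ℝ → ℝ := fun x τ => a * (barrier 1 0 (F x τ) - uSol s τ) -
    δ * Real.exp (D * τ) * barrier 0 1 (F x τ)
  have hw : ContinuousOn (fun z : L6 × ℝ => w z.1 z.2) (Mt s ×ˢ Icc t₀ t₁) := by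
    have hFc : ContinuousOn (fun z : L6 × ℝ => F z.1 z.2) (Mt s ×ˢ Icc t₀ t₁) :=
      hF.cont.mono (prod_mono_right hIco)
    have hu : Continuous fun z : L6 × ℝ => uSol s z.2 :=
      (contDiff_uSol s).continuous.comp continuous_snd
    have he : Continuous fun z : L6 × ℝ => δ * Real.exp (D * z.2) := by fun_prop
    exact (continuousOn_const.mul (((continuous_barrier 1 0).comp_continuousOn hFc).sub
      hu.continuousOn)).sub (he.continuousOn.mul ((continuous_barrier 0 1).comp_continuousOn hFc))
  -- The height falls by a factor of at least `exp (-2 C t₁)`, so beyond this initial height the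
  -- penalty exceeds the bound `B`.
  have hR : ∀ x ∈ Mt s, ∀ τ ∈ Icc t₀ t₁, B / (δ * Real.exp (-(2 * C) * t₁)) < x.1 0 + x.2 0 →
      w x τ ≤ 0 := fun x hx τ hτ hlt => by
    rw [div_lt_iff₀ (by positivity)] at hlt
    have h2 := hB x hx τ hτ
    have h3 := hF.height_lower hx ⟨h₀.trans hτ.1, hτ.2⟩ h₁
    have h4 : 1 ≤ Real.exp (D * τ) := Real.one_le_exp (mul_nonneg hD (h₀.trans hτ.1))
    have h5 := hF.height_pos hx (hIco τ hτ)
    have h6 : δ * ((x.1 0 + x.2 0) * Real.exp (-(2 * C) * t₁)) ≤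
        δ * ((F x τ).1 0 + (F x τ).2 0) := by gcongr
    have h7 : δ * ((F x τ).1 0 + (F x τ).2 0) * 1 ≤
        δ * ((F x τ).1 0 + (F x τ).2 0) * Real.exp (D * τ) := by gcongr
    simp only [w, barrier_one_zero, barrier_zero_one]
    linarith
  obtain ⟨x, hx, τ, hτ, hpw, hmax⟩ := exists_max_of_proper hw hR (by
    obtain ⟨x, hx, τ, hτ, h⟩ := hpos
    exact ⟨x, hx, τ, hτ, by simpa only [w, barrier_one_zero, barrier_zero_one] using h⟩)
  have hτ' := hIco τ hτ
  have hh := hF.height_pos hx hτ'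
  have hτ0 : t₀ < τ := by
    refine lt_of_le_of_ne hτ.1 ?_
    rintro rfl
    have h2 := hinit x hx
    have h3 : 0 < δ * Real.exp (D * t₀) * ((F x t₀).1 0 + (F x t₀).2 0) := by positivity
    simp only [w, barrier_one_zero, barrier_zero_one] at hpw
    linarith
  set c := -(δ * Real.exp (D * τ)) with hc
  have hc0 : c < 0 := neg_lt_zero.2 (by positivity)
  have hwb : ∀ y, w y τ = barrier a c (F y τ) - a * uSol s τ := fun y => by
    simp only [w, barrier, hc]
    ring
  obtain ⟨hgrad, S, -, hS1, hS2⟩ := barrier_of_max hs (hF.imm τ hτ') (hF.normal τ hτ') hx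
    (hF.curv τ hτ' x hx) (a := a) (c := c) (fun y hy => by
      have := hmax y hy τ hτ
      rw [hwb, hwb] at this
      linarith)
  have hderiv : HasDerivWithinAt (w x) (a * (barrierDiff 1 0 (F x τ) (H x τ • ν x τ) -
      -(2 / 3) * uSol s τ) - (δ * (D * Real.exp (D * τ)) * barrier 0 1 (F x τ) +
        δ * Real.exp (D * τ) * barrierDiff 0 1 (F x τ) (H x τ • ν x τ))) (Ico 0 T) τ := by
    have he : HasDerivAt (fun τ => δ * Real.exp (D * τ)) (δ * (D * Real.exp (D * τ))) τ :=
      (((hasDerivAt_id τ).const_mul D).exp.const_mul δ).congr_deriv (by simp [mul_comm])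
    have hd := hF.deriv τ hτ' x hx
    exact (((hasDerivWithinAt_barrier 1 0 hd).sub
      (hasDerivAt_uSol s τ).hasDerivWithinAt).const_mul a).sub
        (he.hasDerivWithinAt.mul (hasDerivWithinAt_barrier 0 1 hd))
  have htime := deriv_nonneg_of_max_right h₀ hτ0 hτ'.2 hderiv fun σ hσ =>
    hmax x hx σ ⟨hσ.1, hσ.2.trans hτ.2⟩
  have hsplit : barrierDiff a c (F x τ) (ν x τ) = a * barrierDiff 1 0 (F x τ) (ν x τ) +
      c * barrierDiff 0 1 (F x τ) (ν x τ) := by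
    simp only [barrierDiff]
    ring
  refine ⟨x, hx, τ, hτ, c, hc0, _, ?_, hgrad, ?_⟩
  · rw [hwb, barrier] at hpw
    linarith
  -- Adding the Laplacian inequality to three times the time inequality cancels every term
  -- containing `H`. As `c < 0`, the bound `S ≤ 3 (p₀ + q₀)` turns the remaining penalty terms into
  -- the factor `D - 1`.
  · rw [barrierDiff_smul, barrierDiff_smul, barrier_zero_one] at htime
    rw [hsplit] at hS2
    have h8 : c * (3 * ((F x τ).1 0 + (F x τ).2 0)) ≤ c * S :=
      mul_le_mul_of_nonpos_left hS1 hc0.le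
    have h9 : δ * (D * Real.exp (D * τ)) = -(D * c) := by rw [hc]; ring
    have h10 : δ * Real.exp (D * τ) = -c := by rw [hc]; ring
    rw [h9, h10] at htime
    linarith

theorem two_mul_lor_normal_ge (hF : IsBoundedFlow s T C F ν H) (hx : x ∈ Mt s) {τ : ℝ}
    (hτ : τ ∈ Ico 0 T) :
    lor (F x τ).1 (F x τ).2 ≤ 2 * lor (ν x τ).1 (ν x τ).2 ∧
      2 * lor (ν x τ).1 (ν x τ).2 ≤ -lor (F x τ).1 (F x τ).2 := by
  obtain ⟨h1, h2, -⟩ := (hF.normal τ hτ).2 x hx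
  have := abs_two_mul_lor_le (hF.mem hτ hx) h1
  rw [h2, mul_one, abs_le] at this
  exact ⟨by linarith [this.1], this.2⟩

theorem IsBoundedFlow.lor_bounds (hF : IsBoundedFlow s T C F ν H) (hx : x ∈ Mt s) {σ τ : ℝ}
    (hσ : σ ∈ Ico 0 T) (hτ : τ ∈ Ico 0 T) (hστ : σ ≤ τ) :
    -lor (F x σ).1 (F x σ).2 * Real.exp (-(2 * C) * (τ - σ)) ≤ -lor (F x τ).1 (F x τ).2 ∧
      -lor (F x τ).1 (F x τ).2 ≤ -lor (F x σ).1 (F x σ).2 * Real.exp (2 * C * (τ - σ)) := by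
  simpa only [barrier_one_zero] using
    hF.barrier_bounds hx (a := 1) (c := 0) zero_le_one le_rfl hσ hτ hστ

/-- With `D = 1` the penalty leaves no term, and `2⟨ν₁, ν₂⟩ ≥ -u` gives `2 (u - uSol) ≤ 0` at a
point where the penalized difference is positive. The weight `δ` is chosen so that half of the
supposed excess survives. -/
theorem IsBoundedFlow.le_uSol (hs : 1 < s) (hF : IsBoundedFlow s T C F ν H) (hx : x ∈ Mt s) {τ : ℝ}
    (hτ : τ ∈ Ico 0 T) : -lor (F x τ).1 (F x τ).2 ≤ uSol s τ := by
  by_contra! hlt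
  have h0 : (0 : ℝ) ∈ Ico 0 T := ⟨le_rfl, hτ.1.trans_lt hτ.2⟩
  have hC := hF.nonneg hx hτ
  have hh := hF.height_pos hx hτ
  have hmax := hF.exists_max hs (a := 1) (D := 1)
    (δ := (-lor (F x τ).1 (F x τ).2 - uSol s τ) /
      (2 * (Real.exp (1 * τ) * ((F x τ).1 0 + (F x τ).2 0)))) (t₀ := 0) (t₁ := τ)
    (B := s * Real.exp (2 * C * τ)) (div_pos (by linarith) (by positivity)) zero_le_one le_rfl
    hτ.2 (fun y hy σ hσ => ?_) (fun y hy => ?_) ⟨x, hx, τ, ⟨hτ.1, le_rfl⟩, ?_⟩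
  rotate_left
  · have hσ' : σ ∈ Ico 0 T := ⟨hσ.1, hσ.2.trans_lt hτ.2⟩
    have h3 := (hF.lor_bounds hy h0 hσ' hσ.1).2
    rw [hF.init y hy, hy.2, neg_neg, sub_zero] at h3
    have h4 : s * Real.exp (2 * C * σ) ≤ s * Real.exp (2 * C * τ) := by
      have := hσ.2
      gcongr
    linarith [uSol_pos hs σ]
  · rw [hF.init y hy, hy.2, uSol_zero]
    simp
  · have e : (-lor (F x τ).1 (F x τ).2 - uSol s τ) /
      (2 * (Real.exp (1 * τ) * ((F x τ).1 0 + (F x τ).2 0))) * Real.exp (1 * τ) *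
        ((F x τ).1 0 + (F x τ).2 0) = (-lor (F x τ).1 (F x τ).2 - uSol s τ) / 2 := by
      have := Real.exp_pos (1 * τ)
      field_simp
    rw [e]
    linarith
  obtain ⟨y, hy, σ, hσ, c, hc, l, h1, -, h2⟩ := hmax
  have h3 := (two_mul_lor_normal_ge hF hy ⟨hσ.1, hσ.2.trans_lt hτ.2⟩).1
  have h4 := mul_neg_of_neg_of_pos hc (hF.height_pos hy ⟨hσ.1, hσ.2.trans_lt hτ.2⟩)
  linarith

/-- Here an upper bound for `2⟨ν₁, ν₂⟩ + u` is needed. `normal_pinching` provides one proportional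
to the penalty, and the lower bound `m > 1` keeps the gradient of `u` from degenerating. -/
theorem IsBoundedFlow.uSol_le_of_slab (hs : 1 < s) (hF : IsBoundedFlow s T C F ν H) {t₀ t₁ m : ℝ}
    (h₀ : 0 ≤ t₀) (h₁ : t₁ < T) (hm : 1 < m)
    (hslab : ∀ x ∈ Mt s, ∀ τ ∈ Icc t₀ t₁, m ≤ -lor (F x τ).1 (F x τ).2)
    (hinit : ∀ x ∈ Mt s, uSol s t₀ ≤ -lor (F x t₀).1 (F x t₀).2) (hx : x ∈ Mt s) {τ : ℝ}
    (hτ : τ ∈ Icc t₀ t₁) : uSol s τ ≤ -lor (F x τ).1 (F x τ).2 := by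
  by_contra! hlt
  have hIco : ∀ τ ∈ Icc t₀ t₁, τ ∈ Ico 0 T := fun τ hτ => ⟨h₀.trans hτ.1, hτ.2.trans_lt h₁⟩
  have hh := hF.height_pos hx (hIco τ hτ)
  set k := Real.sqrt (2 * (m ^ 2 - 1)) with hk
  have hk0 : 0 < k := Real.sqrt_pos.2 (by linarith [t_sq_sub_one_pos hm])
  -- The pinching constant: `u ≤ s` at the point considered, and `k` bounds the gradient norm from
  -- below. With `D = K / 3 + 1` the factor `3 (D - 1)` equals `K` and absorbs the error exactly.
  set K := 4 * s / k with hK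
  have hK0 : 0 < K := div_pos (by linarith) hk0
  have hmax := hF.exists_max hs (a := -1) (D := K / 3 + 1)
    (δ := (uSol s τ - -lor (F x τ).1 (F x τ).2) /
      (2 * (Real.exp ((K / 3 + 1) * τ) * ((F x τ).1 0 + (F x τ).2 0)))) (t₀ := t₀) (t₁ := t₁)
    (B := s) (div_pos (by linarith) (by positivity)) (by positivity) h₀ h₁ (fun y hy σ hσ => ?_)
    (fun y hy => ?_) ⟨x, hx, τ, hτ, ?_⟩
  rotate_left
  · have hσ' := hIco σ hσ
    have := uSol_antitone hs hσ'.1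
    rw [uSol_zero] at this
    linarith [hslab y hy σ hσ]
  · linarith [hinit y hy]
  · have e : (uSol s τ - -lor (F x τ).1 (F x τ).2) /
      (2 * (Real.exp ((K / 3 + 1) * τ) * ((F x τ).1 0 + (F x τ).2 0))) *
        Real.exp ((K / 3 + 1) * τ) * ((F x τ).1 0 + (F x τ).2 0) =
        (uSol s τ - -lor (F x τ).1 (F x τ).2) / 2 := by
      have := Real.exp_pos ((K / 3 + 1) * τ)
      field_simp
    rw [e]
    linarith
  obtain ⟨y, hy, σ, hσ, c, hc, l, h1, hgrad, h2⟩ := hmax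
  have hσ' := hIco σ hσ
  have hy' := hF.mem hσ' hy
  obtain ⟨n1, n2, -⟩ := (hF.normal σ hσ').2 y hy
  have h3 := normal_pinching hy' n1 n2 hgrad
  set u := -lor (F y σ).1 (F y σ).2 with hu
  have hψ := hF.height_pos hy hσ'
  have hcψ := mul_neg_of_neg_of_pos hc hψ
  have hus : u ≤ s := by
    have := uSol_antitone hs hσ'.1
    rw [uSol_zero] at this
    linarith
  have hmu : m ≤ u := hslab y hy σ hσ
  have h4 : k ≤ Real.sqrt (2 * (lor (F y σ).1 (F y σ).2 ^ 2 - 1)) := by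
    refine Real.sqrt_le_sqrt ?_
    have : lor (F y σ).1 (F y σ).2 ^ 2 = u ^ 2 := by rw [hu]; ring
    rw [this]
    nlinarith
  have h5 := (two_mul_lor_normal_ge hF hy hσ').1
  have h6 : (2 * lor (ν y σ).1 (ν y σ).2 + u) * k ≤
      4 * s * (|c| * ((F y σ).1 0 + (F y σ).2 0)) := by
    calc _ ≤ (2 * lor (ν y σ).1 (ν y σ).2 + u) *
            Real.sqrt (2 * (lor (F y σ).1 (F y σ).2 ^ 2 - 1)) :=
          mul_le_mul_of_nonneg_left h4 (by linarith)
      _ ≤ 4 * u * (|c| * ((F y σ).1 0 + (F y σ).2 0)) := by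
          rw [show 2 * lor (ν y σ).1 (ν y σ).2 + u =
            2 * lor (ν y σ).1 (ν y σ).2 - lor (F y σ).1 (F y σ).2 by rw [hu]; ring]
          exact h3
      _ ≤ _ := by gcongr
  have h7 : 2 * lor (ν y σ).1 (ν y σ).2 + u ≤ K * -(c * ((F y σ).1 0 + (F y σ).2 0)) := by
    rw [hK, div_mul_eq_mul_div, le_div_iff₀ hk0]
    rw [abs_of_neg hc] at h6
    linarith
  linarith

/-- Bounded mean curvature keeps `u` above `m' > 1` for a uniform time `η` once `u ≥ uSol` holds.
The slab estimate restores that inequality at the end of each step, so induction covers the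
interval. -/
theorem IsBoundedFlow.uSol_le (hs : 1 < s) (hF : IsBoundedFlow s T C F ν H) {m : ℝ} (hm : 1 < m)
    (hu : ∀ τ ∈ Ico 0 T, m ≤ uSol s τ) (hx : x ∈ Mt s) {τ : ℝ} (hτ : τ ∈ Ico 0 T) :
    uSol s τ ≤ -lor (F x τ).1 (F x τ).2 := by
  have hC := hF.nonneg hx hτ
  set m' := (m + 1) / 2 with hm'
  have hm1 : 1 < m' := by linarith
  have hmm : m' < m := by linarith
  -- Short enough that decay at rate `2C` cannot take `m` below `m'`; the added `1` covers `C = 0`.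
  set η := Real.log (m / m') / (2 * C + 1) with hη
  have hη0 : 0 < η := div_pos (Real.log_pos ((one_lt_div (by linarith)).2 hmm)) (by linarith)
  have hηm : m' ≤ m * Real.exp (-(2 * C) * η) := by
    have h1 : (2 * C) * η ≤ Real.log (m / m') := by
      rw [hη, mul_div_assoc', div_le_iff₀ (by linarith), mul_comm]
      have := Real.log_pos ((one_lt_div (by linarith)).2 hmm)
      nlinarith
    have h2 : Real.exp (-Real.log (m / m')) ≤ Real.exp (-(2 * C) * η) :=
      Real.exp_le_exp.2 (by linarith)
    rw [Real.exp_neg, Real.exp_log (by positivity), inv_div] at h2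
    rw [div_le_iff₀ (by linarith)] at h2
    linarith
  have step : ∀ n : ℕ, ∀ x ∈ Mt s, ∀ τ ∈ Ico 0 T, τ ≤ n * η →
      uSol s τ ≤ -lor (F x τ).1 (F x τ).2 := by
    intro n
    induction n with
    | zero =>
      intro x hx τ hτ hle
      have h0 : τ = 0 := le_antisymm (by simpa using hle) hτ.1
      rw [h0, hF.init x hx, hx.2, uSol_zero, neg_neg]
    | succ n ih =>
      intro x hx τ hτ hle
      by_cases hn : τ ≤ n * η
      · exact ih x hx τ hτ hn
      · push Not at hn
        have ht0 : (n * η : ℝ) ∈ Ico 0 T := ⟨by positivity, hn.trans hτ.2⟩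
        refine hF.uSol_le_of_slab hs (t₀ := n * η) (t₁ := τ) ht0.1 hτ.2 hm1 (fun y hy σ hσ => ?_)
          (fun y hy => ih y hy _ ht0 le_rfl) hx ⟨hn.le, le_rfl⟩
        have hσ' : σ ∈ Ico 0 T := ⟨ht0.1.trans hσ.1, hσ.2.trans_lt hτ.2⟩
        have h1 := (hF.lor_bounds hy ht0 hσ' hσ.1).1
        have h2 := ih y hy _ ht0 le_rfl
        have h3 := hu _ ht0
        have h4 : Real.exp (-(2 * C) * η) ≤ Real.exp (-(2 * C) * (σ - n * η)) := by
          refine Real.exp_le_exp.2 ?_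
          have : σ - n * η ≤ η := by
            push_cast at hle
            linarith [hσ.2]
          nlinarith
        calc m' ≤ m * Real.exp (-(2 * C) * η) := hηm
          _ ≤ -lor (F y (n * η)).1 (F y (n * η)).2 * Real.exp (-(2 * C) * (σ - n * η)) := by
            refine mul_le_mul (h3.trans h2) h4 (Real.exp_pos _).le ?_
            linarith
          _ ≤ _ := h1
  obtain ⟨n, hn⟩ := exists_nat_ge (τ / η)
  exact step n x hx τ hτ ((div_le_iff₀ hη0).1 hn)

/-! ### Uniqueness of the mean curvature flow -/

/-- The first component of the differential would inject a three-dimensional space into `L3`, hence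
be onto. Then the position vector would be tangent, contradicting `⟨p, p⟩ = -1`. -/
theorem not_isImmersion_diagonal (hs : 1 < s) {G : L6 → L6} (hG : IsImmersion (Mt s) G)
    (h : ∀ x ∈ Mt s, (G x).1 = (G x).2) : False := by
  obtain ⟨x, hx⟩ := Mt_nonempty hs
  have hd : ∀ v : TM (Mt s) x, (dM (Mt s) G x v).1 = (dM (Mt s) G x v).2 := fun v => by
    rw [← fderiv_comp_orbitMap_zero hs hx hG.1]
    have h1 := hasDerivAt_comp_line ((ContDiffOn.comp_orbitMap hx hG.1).differentiable (by simp))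
      (v : L6) 0
    rw [zero_smul] at h1
    refine h1.fst_L6.unique (h1.snd_L6.congr_of_eventuallyEq (Filter.Eventually.of_forall fun σ => ?_))
    exact h _ (orbitMap_mem hx _)
  let f : TM (Mt s) x →ₗ[ℝ] L3 := LinearMap.fst ℝ L3 L3 ∘ₗ dM (Mt s) G x
  have hf : Function.Injective f := fun v w hvw => hG.2.2 x hx
    (Prod.ext hvw (by rw [← hd, ← hd]; exact hvw))
  have hsurj : Function.Surjective f :=
    (LinearMap.injective_iff_surjective_of_finrank_eq_finrank (by
      rw [finrank_TM hs hx]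
      simp)).1 hf
  obtain ⟨v, hv⟩ := hsurj (G x).1
  have h2 := (isTangentHH_dM hs hG hx v).1
  rw [show (dM (Mt s) G x v).1 = (G x).1 from hv, (hG.2.1 hx).1.1] at h2
  norm_num at h2

theorem IsBoundedFlow.one_lt_uSol (hs : 1 < s) (hF : IsBoundedFlow s T C F ν H) {τ : ℝ}
    (hτ : τ ∈ Ico 0 T) : 1 < uSol s τ := by
  by_contra! hle
  refine not_isImmersion_diagonal hs (hF.imm τ hτ) fun x hx => ?_
  have h1 := hF.le_uSol hs hx hτ
  have h2 := hF.mem hτ hx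
  have h3 := one_le_neg_lor h2.1 h2.2
  exact eq_of_lor_eq_neg_one h2.1 h2.2 (by linarith)

/-- Dividing by a nonvanishing scalar solution `h` gives a constant, so no regularity of the
coefficient `k` is required. -/
theorem eq_zero_of_linear_ode {E : Type*} [NormedAddCommGroup E] [NormedSpace ℝ E] {k h : ℝ → ℝ}
    {y : ℝ → E} (hy : ∀ τ ∈ Ico 0 T, HasDerivWithinAt y (k τ • y τ) (Ico 0 T) τ)
    (hh : ∀ τ ∈ Ico 0 T, HasDerivWithinAt h (k τ * h τ) (Ico 0 T) τ)
    (hne : ∀ τ ∈ Ico 0 T, h τ ≠ 0) (h0 : y 0 = 0) {τ : ℝ} (hτ : τ ∈ Ico 0 T) : y τ = 0 := by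
  have h1 : ∀ τ ∈ Ico 0 T, HasDerivWithinAt (fun τ => (h τ)⁻¹ • y τ) 0 (Ico 0 T) τ := fun τ hτ => by
    refine (((hh τ hτ).inv (hne τ hτ)).smul (hy τ hτ)).congr_deriv ?_
    have := hne τ hτ
    rw [smul_smul, ← add_smul]
    convert zero_smul ℝ (y τ) using 2
    simp only [Pi.inv_apply]
    field_simp
    ring
  have h2 := eq_of_hasDerivWithinAt_zero h1 hτ
  simp only [h0, smul_zero] at h2
  exact (smul_eq_zero.1 h2).resolve_left (inv_ne_zero (hne τ hτ))

/-- Two integral curves of the rescaled normal fields with the same starting point agree. -/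
theorem eq_of_hasDerivWithinAt_Nt {y z : ℝ → L6} {k u : ℝ → ℝ}
    (hy : ∀ τ ∈ Ico 0 T, HasDerivWithinAt y (k τ • Nt (u τ) (y τ)) (Ico 0 T) τ)
    (hz : ∀ τ ∈ Ico 0 T, HasDerivWithinAt z (k τ • Nt (u τ) (z τ)) (Ico 0 T) τ)
    (h0 : y 0 = z 0) {a b : L3}
    (ha : ∀ τ ∈ Ico 0 T, lor ((z τ).1 + (z τ).2) a ≠ 0)
    (hb : ∀ τ ∈ Ico 0 T, lor ((z τ).1 - (z τ).2) b ≠ 0) {τ : ℝ} (hτ : τ ∈ Ico 0 T) :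
    y τ = z τ := by
  -- Sums and differences of the two components diagonalize `Nt`, leaving scalar linear equations.
  have hp : ∀ {w : ℝ → L6} {τ : ℝ},
      HasDerivWithinAt w (k τ • Nt (u τ) (w τ)) (Ico 0 T) τ →
      HasDerivWithinAt (fun τ => (w τ).1 + (w τ).2)
        ((k τ * nFactor (u τ) * (1 - u τ)) • ((w τ).1 + (w τ).2)) (Ico 0 T) τ := fun h =>
    (h.fst_L6.add h.snd_L6).congr_deriv (by
      simp only [Nt_def, Prod.smul_fst, Prod.smul_snd]
      module)
  have hm : ∀ {w : ℝ → L6} {τ : ℝ},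
      HasDerivWithinAt w (k τ • Nt (u τ) (w τ)) (Ico 0 T) τ →
      HasDerivWithinAt (fun τ => (w τ).1 - (w τ).2)
        ((k τ * nFactor (u τ) * (-1 - u τ)) • ((w τ).1 - (w τ).2)) (Ico 0 T) τ := fun h =>
    (h.fst_L6.sub h.snd_L6).congr_deriv (by
      simp only [Nt_def, Prod.smul_fst, Prod.smul_snd]
      module)
  have e1 := eq_zero_of_linear_ode (k := fun τ => k τ * nFactor (u τ) * (1 - u τ))
    (h := fun τ => lor ((z τ).1 + (z τ).2) a)
    (fun τ hτ => ((hp (hy τ hτ)).sub (hp (hz τ hτ))).congr_deriv (smul_sub _ _ _).symm)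
    (fun τ hτ => ((hp (hz τ hτ)).lor (hasDerivWithinAt_const τ _ a)).congr_deriv (by simp; ring))
    ha (by simp [h0]) hτ
  have e2 := eq_zero_of_linear_ode (k := fun τ => k τ * nFactor (u τ) * (-1 - u τ))
    (h := fun τ => lor ((z τ).1 - (z τ).2) b)
    (fun τ hτ => ((hm (hy τ hτ)).sub (hm (hz τ hτ))).congr_deriv (smul_sub _ _ _).symm)
    (fun τ hτ => ((hm (hz τ hτ)).lor (hasDerivWithinAt_const τ _ b)).congr_deriv (by simp))
    hb (by simp [h0]) hτ
  simp only [Pi.sub_apply] at e1 e2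
  have e3 := sub_eq_zero.1 e1
  have e4 := sub_eq_zero.1 e2
  refine Prod.ext ?_ ?_
  · have := congrArg₂ (fun v w => (2 : ℝ)⁻¹ • (v + w)) e3 e4
    calc (y τ).1 = _ := by module
      _ = _ := this
      _ = _ := by module
  · have := congrArg₂ (fun v w => (2 : ℝ)⁻¹ • (v - w)) e3 e4
    calc (y τ).2 = _ := by module
      _ = _ := this
      _ = _ := by module

theorem parMap_eq_of_isIntegralCurve (hs : 1 < s) (hu : ∀ τ ∈ Ico 0 T, 1 < uSol s τ) (hx : x ∈ Mt s)
    {y : ℝ → L6} (h0 : y 0 = x) (hy : ∀ τ ∈ Ico 0 T, HasDerivWithinAt y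
      (curvMt (uSol s τ) • Nt (uSol s τ) (y τ)) (Ico 0 T) τ) {τ : ℝ} (hτ : τ ∈ Ico 0 T) :
    y τ = parMap (epsSol s τ) s x := by
  have hε := solvesODE_epsSol hs hu
  have hsum : ∀ r, (parMap r s x).1 + (parMap r s x).2 = plusFactor r s • (x.1 + x.2) := fun r => by
    rw [parMap_eq hs]
    module
  have hdiff : ∀ r, (parMap r s x).1 - (parMap r s x).2 = minusFactor r s • (x.1 - x.2) :=
    fun r => by
      rw [parMap_eq hs]
      module
  refine eq_of_hasDerivWithinAt_Nt (k := fun τ => curvMt (uSol s τ)) (u := uSol s)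
    (z := fun τ => parMap (epsSol s τ) s x) (a := x.1 + x.2) (b := x.1 - x.2) hy
    (fun σ hσ => ?_) ?_ (fun σ hσ => ?_) (fun σ hσ => ?_) hτ
  · have h1 := (hasDerivAt_parMap hs (hε.lt_arcosh hs hσ) hx).scomp_hasDerivWithinAt σ (hε.2 σ hσ).2
    rw [hε.phi_eq hs hσ] at h1
    exact h1
  · rw [h0, hε.1, parMap_apply]
    simp
  · rw [hsum, lor_smul_left]
    refine mul_ne_zero (div_pos (Real.cosh_pos _) (Real.cosh_pos _)).ne' ?_
    simp only [lor_add_left, lor_add_right, hx.1.1.1, hx.1.2.1, hx.2, lor_swap hx]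
    linarith
  · rw [hdiff, lor_smul_left]
    refine mul_ne_zero (div_pos (Real.sinh_pos_iff.2 ?_) (sinh_half_arcosh_pos hs)).ne' ?_
    · linarith [hε.lt_arcosh hs hσ]
    · simp only [lor_sub_left, lor_sub_right, hx.1.1.1, hx.1.2.1, hx.2, lor_swap hx]
      linarith

theorem IsBoundedFlow.lor_eq (hs : 1 < s) (hF : IsBoundedFlow s T C F ν H) {m : ℝ} (hm : 1 < m)
    (hu : ∀ τ ∈ Ico 0 T, m ≤ uSol s τ) {τ : ℝ} (hτ : τ ∈ Ico 0 T) :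
    MapsTo (fun x => F x τ) (Mt s) (Mt (uSol s τ)) := fun x hx =>
  ⟨hF.mem hτ hx, by
    show lor (F x τ).1 (F x τ).2 = -uSol s τ
    linarith [hF.le_uSol hs hx hτ, hF.uSol_le hs hm hu hx hτ]⟩

/-- `trace_sq_le` in dimension three gives `H² ≤ |A|² / 3`. -/
theorem IsMCF.exists_isBoundedFlow (hs : 1 < s) (hF : IsMCF (Mt s) T F)
    (hb : HasBoundedSecondForm (Mt s) T F) {T₁ : ℝ} (hT₁ : T₁ < T) :
    ∃ C ν H, IsBoundedFlow s T₁ C F ν H := by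
  obtain ⟨h1, h2, h3, ν, H, -, h5⟩ := hF
  obtain ⟨C, hC⟩ := hb T₁ hT₁
  have hsub : Ico 0 T₁ ⊆ Ico 0 T := Ico_subset_Ico_right hT₁.le
  refine ⟨|C| + 1, ν, H, (h1.continuousOn).mono (prod_mono_right hsub), h2,
    fun τ hτ => h3 τ (hsub hτ), fun τ hτ => (h5 τ (hsub hτ)).1,
    fun τ hτ x hx => ((h5 τ (hsub hτ)).2 x hx).1,
    fun τ hτ x hx => ((h5 τ (hsub hτ)).2 x hx).2.mono hsub, fun τ hτ x hx => ?_⟩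
  obtain ⟨A, hA, hH⟩ := ((h5 τ (hsub hτ)).2 x hx).1
  have hI := h3 τ (hsub hτ)
  have hν := (h5 τ (hsub hτ)).1
  have h6 := hC τ ⟨hτ.1, hτ.2.le⟩ _ hν x hx A hA
  have h7 := trace_sq_le (pullback_comm (t := s) (F := fun x => F x τ) (x := x))
    (pullback_pos hs hI hx) (shape_symm hs hI hν hx hA)
  rw [finrank_TM hs hx] at h7
  push_cast at h7
  refine abs_le_of_sq_le_sq ?_ (by positivity)
  rw [hH, div_pow]
  nlinarith [le_abs_self C, abs_nonneg C, sq_nonneg (|C|)]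

/-- A mean curvature flow of `Mt s` with bounded second fundamental form consists of parallel
hypersurfaces. -/
theorem exists_solvesODE_of_isMCF (hs : 1 < s) (hF : IsMCF (Mt s) T F)
    (hb : HasBoundedSecondForm (Mt s) T F) : ∃ ε, SolvesODE s T ε ∧
      ∀ x ∈ Mt s, ∀ τ ∈ Ico 0 T, F x τ = parallel (Nt s) (ε τ) x := by
  -- Curvature bounds hold only up to times before `T`, so each `τ` is treated on an interval ending
  -- halfway between `τ` and `T`.
  have hmid : ∀ τ ∈ Ico 0 T, τ ∈ Ico 0 ((τ + T) / 2) ∧ (τ + T) / 2 < T := fun τ hτ =>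
    ⟨⟨hτ.1, by linarith [hτ.2]⟩, by linarith [hτ.2]⟩
  have hu : ∀ τ ∈ Ico 0 T, 1 < uSol s τ := fun τ hτ => by
    obtain ⟨C, ν, H, hfl⟩ := hF.exists_isBoundedFlow hs hb (hmid τ hτ).2
    exact hfl.one_lt_uSol hs (hmid τ hτ).1
  refine ⟨epsSol s, solvesODE_epsSol hs hu, fun x hx τ hτ => ?_⟩
  obtain ⟨h1, h2⟩ := hmid τ hτ
  obtain ⟨C, ν, H, hfl⟩ := hF.exists_isBoundedFlow hs hb h2
  have h3 : (τ + T) / 2 ∈ Ico 0 T := ⟨h1.1.trans h1.2.le, h2⟩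
  have hsub : ∀ σ ∈ Ico 0 ((τ + T) / 2), 1 < uSol s σ := fun σ hσ => hu σ ⟨hσ.1, hσ.2.trans h2⟩
  rw [parallel_eq hs _ hx]
  refine parMap_eq_of_isIntegralCurve hs hsub hx (hfl.init x hx) (fun σ hσ => ?_) h1
  -- The uniform lower bound `m > 1` is the value of the decreasing `uSol` at the midpoint.
  have hm := hfl.lor_eq hs (hu _ h3) (fun σ hσ => uSol_antitone hs hσ.2.le) hσ
  rw [← meanCurvature_smul hs (hsub σ hσ) (hfl.imm σ hσ) hm (hfl.normal σ hσ) hx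
    (hfl.curv σ hσ x hx)]
  exact hfl.deriv σ hσ x hx

end HHFlow

end

theorem mainTheorem5 (t : ℝ) (ht : 1 < t) :
    -- `Mt t` is a nonempty hypersurface, and it is isoparametric with unit normal field `Nt t`
    (HHFlow.Mt t).Nonempty ∧
    HHFlow.IsIsoparametric (HHFlow.Mt t) (HHFlow.Nt t) ∧
    -- the shape operator, its three distinct constant eigenvalues, and the mean curvature
    (∀ x ∈ HHFlow.Mt t,
      Module.finrank ℝ (HHFlow.TM (HHFlow.Mt t) x) = 3 ∧
      (∃ A : Module.End ℝ (HHFlow.TM (HHFlow.Mt t) x),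
        HHFlow.IsShapeOperator (HHFlow.Mt t) id (HHFlow.Nt t) x A ∧
        (∀ v : HHFlow.TM (HHFlow.Mt t) x, ((A v : HHFlow.L6)) =
          (Real.sqrt (2 * (t ^ 2 - 1)))⁻¹ •
            (t • (v : HHFlow.L6) - ((v : HHFlow.L6).2, (v : HHFlow.L6).1) +
              (HHFlow.lor (v : HHFlow.L6).1 x.2 • x.1, HHFlow.lor (v : HHFlow.L6).2 x.1 • x.2))) ∧
        ∀ κ : ℝ, Module.End.HasEigenvalue A κ ↔
          κ = 1 / Real.sqrt 2 * Real.sqrt ((t + 1) / (t - 1)) ∨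
          κ = 1 / Real.sqrt 2 * Real.sqrt ((t - 1) / (t + 1)) ∨ κ = 0) ∧
      HHFlow.HasMeanCurvature (HHFlow.Mt t) id (HHFlow.Nt t) x
        (Real.sqrt 2 * t / (3 * Real.sqrt (t ^ 2 - 1)))) ∧
    [1 / Real.sqrt 2 * Real.sqrt ((t + 1) / (t - 1)),
      1 / Real.sqrt 2 * Real.sqrt ((t - 1) / (t + 1)), 0].Nodup ∧
    -- parallel displacement
    (∀ r : ℝ,
      (∀ x ∈ HHFlow.Mt t, HHFlow.parallel (HHFlow.Nt t) r x =
        (Real.cosh (r / Real.sqrt 2) • x.1 +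
            (Real.sinh (r / Real.sqrt 2) / Real.sqrt (t ^ 2 - 1)) • (x.2 - t • x.1),
          Real.cosh (r / Real.sqrt 2) • x.2 +
            (Real.sinh (r / Real.sqrt 2) / Real.sqrt (t ^ 2 - 1)) • (x.1 - t • x.2))) ∧
      HHFlow.parallel (HHFlow.Nt t) r '' HHFlow.Mt t = HHFlow.Mt (HHFlow.phi r t)) ∧
    -- the initial value problem for `ε` is solvable, with a unique solution
    (∃ T > 0, ∃ ε, HHFlow.SolvesODE t T ε) ∧
    (∀ T > 0, ∀ ε₁ ε₂, HHFlow.SolvesODE t T ε₁ → HHFlow.SolvesODE t T ε₂ →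
      Set.EqOn ε₁ ε₂ (Set.Ico 0 T)) ∧
    -- a reparametrized parallel flow is a mean curvature flow exactly if `ε` solves the problem
    (∀ T > 0, ∀ ε : ℝ → ℝ,
      HHFlow.IsMCF (HHFlow.Mt t) T (fun x τ => HHFlow.parallel (HHFlow.Nt t) (ε τ) x) ↔
        HHFlow.SolvesODE t T ε) ∧
    -- the mean curvature flows with initial data `Mt t` (with bounded second fundamental form on
    -- compact time intervals) are these and no others
    (∀ T > 0, ∀ F : HHFlow.L6 → ℝ → HHFlow.L6,
      (HHFlow.IsMCF (HHFlow.Mt t) T F ∧ HHFlow.HasBoundedSecondForm (HHFlow.Mt t) T F) ↔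
        ∃ ε, HHFlow.SolvesODE t T ε ∧
          ∀ x ∈ HHFlow.Mt t, ∀ τ ∈ Set.Ico 0 T,
            F x τ = HHFlow.parallel (HHFlow.Nt t) (ε τ) x) := by
  refine ⟨HHFlow.Mt_nonempty ht, HHFlow.isIsoparametric_Mt ht, fun x hx =>
    ⟨HHFlow.finrank_TM ht hx, ⟨HHFlow.shapeMt ht hx, HHFlow.isShapeOperator_shapeMt ht hx,
      fun v => rfl, fun κ => ?_⟩, HHFlow.hasMeanCurvature_Nt ht hx⟩,
    HHFlow.principalCurvatures_nodup ht, fun r => ⟨fun x hx => HHFlow.parallel_eq ht r hx,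
      HHFlow.parallel_image ht r⟩, HHFlow.exists_solvesODE ht,
    fun T _ ε₁ ε₂ h₁ h₂ => HHFlow.solvesODE_unique ht h₁ h₂,
    fun T hT ε => HHFlow.isMCF_parallel_iff ht hT, fun T hT F => ⟨fun h => ?_, ?_⟩⟩
  · rw [HHFlow.hasEigenvalue_shapeMt, Fin.exists_fin_succ, Fin.exists_fin_two]
    simp only [HHFlow.principalCurv, HHFlow.nFactor_mul_add_one ht, HHFlow.nFactor_mul_sub_one ht]
    simp [eq_comm]
  · exact HHFlow.exists_solvesODE_of_isMCF ht h.1 h.2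
  · rintro ⟨ε, hε, hF⟩
    exact ⟨((HHFlow.isMCF_parallel_iff ht hT).2 hε).congr hT hF,
      HHFlow.hasBoundedSecondForm_of_solves ht hε hF⟩
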